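/- Let $d_1,d_2,d_3,d_4\in\mathbb C$ be distinct, let $\alpha,\beta,\gamma,\delta,\epsilon,q''\in\mathbb C$ with $\alpha+\beta-\gamma-\delta-\epsilon+1=0$, and consider the canonical general-form Heun equation $$\frac{d^2u}{ds^2}+\left(\frac{\gamma}{s-d_1}+\frac{\delta}{s-d_2}+\frac{\epsilon}{s-d_3}+\frac{1-\alpha-\beta}{s-d_4}\right)\frac{du}{ds}+\frac{\alpha\beta\,\frac{\prod_{i=1}^3(d_4-d_i)}{s-d_4}-q''}{(s-d_1)(s-d_2)(s-d_3)(s-d_4)}\,u=0 .\qquad(*)$$ Assume that each of $d_1,d_2,d_3,d_4$ is a singular point of $(*)$ (after cancellation, at least one of the two coefficients has a pole there), and that $(*)$ is nontrivial, i.e. $\alpha\beta\ne0$ or $q''\ne0$. Say that a nonconstant rational function $R$ *reduces* $(*)$ to the hypergeometric equation if, for some $a,b,c\in\mathbb C$, substituting $z=R(s)$ in $$\frac{d^2y}{dz^2}+\left(\frac cz+\frac{a+b-c+1}{z-1}\right)\frac{dy}{dz}+\frac{ab}{z(z-1)}\,y=0$$ gives (with leading coefficient normalized to $1$) exactly the equation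 $(*)$. The cross-ratio orbit of a set of four points of $\mathbb{CP}^1$ is the set of the cross-ratios $(A,B;C,D)=\frac{(C-A)(D-B)}{(D-A)(C-B)}$ of all its orderings. The seven subcases below list a number $D$, a number $p$, a condition on numbers $g_0,g_1,g_2$, and a polynomial $P$. * (1a) $D=2$, $p=1$; $g_0=g_2$; $P(t)=t(2-t)$. * (1b) $D=4$, $p=1$; $1-g_1=2(1-g_2)$ and $g_0=\frac12$; $P(t)=(t-1)^2(1-t/4)$. * (1c) $D=2$, $p=1$; $g_0=g_2$ and $1-g_1=2(1-g_0)$; $P(t)=4[t(2-t)-\frac12]^2$. * (2a) $D=\frac12+i\frac{\sqrt3}2$, $p=\frac12+i\frac{\sqrt3}6$; $g_0=g_1=g_2$; $P(t)=(1-t/p)^3$. * (2b) $D=\frac12+i\frac{5\sqrt2}4$, $p=\frac12+i\frac{\sqrt2}4$; $g_2=\frac23$ and $g_0=g_1=\frac12$; $P(t)=(1-t/D)(1-t/p)^3$. * (2c) $D=\frac12+i\frac{11\sqrt{15}}{90}$, $p=\frac12+i\frac{\sqrt{15}}{18}$; $g_2=\frac12$ and $g_0=g_1=\frac23$; $P(t)=-i\frac{2025\sqrt{15}}{64}\,t(t-1)(t-p)^3$.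 * (2d) $D=\frac12+i\frac{\sqrt3}2$, $p=\frac12+i\frac{\sqrt3}6$; $g_0=g_1=g_2=\frac23$; $P(t)=4[(1-t/p)^3-\frac12]^2$. For an ordering $(x,y,w)$ of $d_1,d_2,d_3$, let $(g_x,g_y,g_w)$ be the corresponding ordering of $\gamma,\delta,\epsilon$, and let $M_{x,y}(s)=\frac{(s-x)(y-d_4)}{(y-x)(s-d_4)}$ be the Möbius transformation with $x\mapsto0$, $y\mapsto1$, $d_4\mapsto\infty$. Then the following hold. **A.** Some nonconstant rational function reduces $(*)$ to the hypergeometric equation if and only if $\alpha\beta\neq0$ and there is a subcase such that: (i) the cross-ratio orbit of $\{d_1,d_2,d_3,d_4\}$ is that of $\{0,1,D,\infty\}$; and, for some ordering $(x,y,w)$ of $d_1,d_2,d_3$ with $M_{x,y}(w)=D$, (ii) $(g_0,g_1,g_2)=(g_x,g_y,g_w)$ satisfies the condition of the subcase; and (iii) $q''=\alpha\beta\,[\,p(y-x)-(y-d_4)\,]\,(w-d_4)$. **B.** For every subcase for which (i) holds, an ordering $(x,y,w)$ with $M_{x,y}(w)=D$ exists, and the right-hand side of (iii) is the same for all such orderings;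 so the value required of $q''$ is determined uniquely by the subcase, by $\alpha\beta$ and by $d_1,d_2,d_3,d_4$. **C.** A given rational function $R$ reduces $(*)$ to the hypergeometric equation if and only if $\alpha\beta\ne0$ and there are a subcase and an ordering $(x,y,w)$ of $d_1,d_2,d_3$ with $M_{x,y}(w)=D$ for which (ii) and (iii) hold and $R=P\circ M_{x,y}$ or $R=1-P\circ M_{x,y}$. -/

import Mathlib

open scoped OnePoint

namespace HeunReduction

noncomputable section

/-- A linear second-order equation `y'' + p y' + q y = 0` on the Riemann sphere, with
coefficients that are rational functions of the independent variable. -/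
@[ext]
structure LinODE where
  p : RatFunc ℂ
  q : RatFunc ℂ

/-- The derivative of a rational function (quotient rule for the reduced fraction). -/
def ratDeriv (R : RatFunc ℂ) : RatFunc ℂ :=
  algebraMap (Polynomial ℂ) (RatFunc ℂ)
      (Polynomial.derivative R.num * R.denom - R.num * Polynomial.derivative R.denom) /
    algebraMap (Polynomial ℂ) (RatFunc ℂ) (R.denom ^ 2)

/-- Composition `F ∘ R` of rational functions (meaningful when `R` is not constant). -/
def ratComp (F R : RatFunc ℂ) : RatFunc ℂ := RatFunc.eval RatFunc.C R F

/-- The equation satisfied by `u(t) = y(R(t))` when `y'' + p y' + q y = 0`, normalized to have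
leading coefficient `1`; `R` is a nonconstant rational function. -/
def LinODE.pullback (E : LinODE) (R : RatFunc ℂ) : LinODE where
  p := ratComp E.p R * ratDeriv R - ratDeriv (ratDeriv R) / ratDeriv R
  q := ratComp E.q R * ratDeriv R ^ 2

/-- The point `x ∈ ℂ` is a singular point: after cancellation, one of the two coefficients has
a pole there. -/
def LinODE.IsSingularAt (E : LinODE) (x : ℂ) : Prop :=
  E.p.denom.IsRoot x ∨ E.q.denom.IsRoot x

/-- The rational function `s - x`. -/
def lin (x : ℂ) : RatFunc ℂ := RatFunc.X - RatFunc.C x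

/-- The Gauss hypergeometric equation
`y'' + (c / z + (a + b - c + 1) / (z - 1)) y' + a b / (z (z - 1)) y = 0`. -/
def hypergeometric (a b c : ℂ) : LinODE where
  p := RatFunc.C c / lin 0 + RatFunc.C (a + b - c + 1) / lin 1
  q := RatFunc.C (a * b) / (lin 0 * lin 1)

/-- The canonical general-form Heun equation with finite singular points `d₁, d₂, d₃, d₄`,
exponents `0, 1-γ`; `0, 1-δ`; `0, 1-ε`; `α, β` there, and accessory parameter `q`. -/
def generalHeun (d₁ d₂ d₃ d₄ α β γ δ ε q : ℂ) : LinODE where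
  p := RatFunc.C γ / lin d₁ + RatFunc.C δ / lin d₂ + RatFunc.C ε / lin d₃
    + RatFunc.C (1 - α - β) / lin d₄
  q := (RatFunc.C (α * β * ((d₄ - d₁) * (d₄ - d₂) * (d₄ - d₃))) / lin d₄ - RatFunc.C q) /
    (lin d₁ * lin d₂ * lin d₃ * lin d₄)

/-- The nonconstant rational substitution `z = R(s)` reduces `E` to a hypergeometric equation. -/
def ReducedBy (E : LinODE) (R : RatFunc ℂ) : Prop :=
  (∀ k : ℂ, R ≠ RatFunc.C k) ∧ ∃ a b c : ℂ, E = (hypergeometric a b c).pullback R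

/-! ### Cross-ratios on the projective line `ℂ ∪ {∞}` -/

/-- Homogeneous coordinates: `z ↦ (z : 1)`, `∞ ↦ (1 : 0)`. -/
def homog (P : OnePoint ℂ) : ℂ × ℂ := P.elim (1, 0) fun z => (z, 1)

/-- The determinant of two points; it is `z - w` when both are finite. -/
def bracket (P Q : OnePoint ℂ) : ℂ :=
  (homog P).1 * (homog Q).2 - (homog P).2 * (homog Q).1

/-- The cross-ratio `(A, B; C, D) = (C - A)(D - B) / ((D - A)(C - B))`. -/
def crossRatio (A B C D : OnePoint ℂ) : ℂ :=
  (bracket C A * bracket D B) / (bracket D A * bracket C B)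

/-- The cross-ratio orbit of a set of four points: the cross-ratios of all its orderings. -/
def crossRatioOrbit (P : Fin 4 → OnePoint ℂ) : Set ℂ :=
  Set.range fun σ : Equiv.Perm (Fin 4) => crossRatio (P (σ 0)) (P (σ 1)) (P (σ 2)) (P (σ 3))

/-! ### The seven subcases -/

/-- The seven types of substitution. -/
inductive Subcase : Type where
  | harmonic
  | realCubic
  | specialHarmonic
  | equianharmonic
  | quartic
  | quintic
  | specialEquianharmonic

namespace Subcase

/-- The normalized position `D` of the fourth singular point (the others being `0, 1, ∞`). -/
def D : Subcase → ℂ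
  | harmonic => 2
  | realCubic => 4
  | specialHarmonic => 2
  | equianharmonic => 1 / 2 + Complex.I * ((√3 : ℝ) : ℂ) / 2
  | quartic => 1 / 2 + Complex.I * (5 * ((√2 : ℝ) : ℂ) / 4)
  | quintic => 1 / 2 + Complex.I * (11 * ((√15 : ℝ) : ℂ) / 90)
  | specialEquianharmonic => 1 / 2 + Complex.I * ((√3 : ℝ) : ℂ) / 2

/-- The normalized accessory parameter `q / (α β)` when the singular points are
`0, 1, D, ∞`. -/
def p : Subcase → ℂ
  | harmonic => 1
  | realCubic => 1
  | specialHarmonic => 1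
  | equianharmonic => 1 / 2 + Complex.I * ((√3 : ℝ) : ℂ) / 6
  | quartic => 1 / 2 + Complex.I * (((√2 : ℝ) : ℂ) / 4)
  | quintic => 1 / 2 + Complex.I * (((√15 : ℝ) : ℂ) / 18)
  | specialEquianharmonic => 1 / 2 + Complex.I * ((√3 : ℝ) : ℂ) / 6

/-- The condition on the exponent parameters: `g₀, g₁, g₂` belong to the singular points
in the positions `0, 1, D`, so that the exponents there are `0, 1 - gᵢ`. -/
def ExponentCondition : Subcase → ℂ → ℂ → ℂ → Prop
  | harmonic, g₀, _, g₂ => g₀ = g₂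
  | realCubic, g₀, g₁, g₂ => 1 - g₁ = 2 * (1 - g₂) ∧ g₀ = 1 / 2
  | specialHarmonic, g₀, g₁, g₂ => g₀ = g₂ ∧ 1 - g₁ = 2 * (1 - g₀)
  | equianharmonic, g₀, g₁, g₂ => g₀ = g₁ ∧ g₁ = g₂
  | quartic, g₀, g₁, g₂ => g₂ = 2 / 3 ∧ g₀ = 1 / 2 ∧ g₁ = 1 / 2
  | quintic, g₀, g₁, g₂ => g₂ = 1 / 2 ∧ g₀ = 2 / 3 ∧ g₁ = 2 / 3
  | specialEquianharmonic, g₀, g₁, g₂ => g₀ = 2 / 3 ∧ g₁ = 2 / 3 ∧ g₂ = 2 / 3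

/-- The polynomial substitution in normalized position, evaluated at a rational function. -/
def poly (κ : Subcase) (t : RatFunc ℂ) : RatFunc ℂ :=
  match κ with
  | harmonic => t * (2 - t)
  | realCubic => (t - 1) ^ 2 * (1 - t / 4)
  | specialHarmonic => 4 * (t * (2 - t) - 1 / 2) ^ 2
  | equianharmonic => (1 - t / RatFunc.C (p equianharmonic)) ^ 3
  | quartic => (1 - t / RatFunc.C (D quartic)) * (1 - t / RatFunc.C (p quartic)) ^ 3
  | quintic => RatFunc.C (-Complex.I * (2025 * ((√15 : ℝ) : ℂ) / 64)) * t * (t - 1) *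
      (t - RatFunc.C (p quintic)) ^ 3
  | specialEquianharmonic =>
      4 * ((1 - t / RatFunc.C (p specialEquianharmonic)) ^ 3 - 1 / 2) ^ 2

end Subcase

/-- The Möbius transformation with `x ↦ 0`, `y ↦ 1`, `d₄ ↦ ∞`, as a rational function. -/
def moebius (x y d₄ : ℂ) : RatFunc ℂ :=
  RatFunc.C ((y - d₄) / (y - x)) * (lin x / lin d₄)

/-- For distinct points: the Möbius transformation with `x ↦ 0`, `y ↦ 1`, `d₄ ↦ ∞`
sends `w` to `D`. -/
def Normalizes (x y w d₄ D : ℂ) : Prop :=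
  (w - x) * (y - d₄) / ((y - x) * (w - d₄)) = D

/-- The accessory parameter of the general-form equation with finite singular points
`x, y, w, d₄` for which the Heun equation obtained by the Möbius transformation
`x ↦ 0`, `y ↦ 1`, `d₄ ↦ ∞` has normalized accessory parameter `p`. -/
def accessory (x y w d₄ α β p : ℂ) : ℂ :=
  α * β * (p * (y - x) - (y - d₄)) * (w - d₄)

end

end HeunReduction

open HeunReduction

namespace HeunReduction

open Polynomial

/-! ### Differentiation and composition of rational functions -/

/-! Substituting `z = R(s)` turns the last hypergeometric coefficient into `ab R'² / (R (R - 1))`,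
which has a double pole at every finite pole of `R` and decays only like `s⁻²` at infinity if `R`
has a pole there. The last Heun coefficient has at most simple poles at `d₁, d₂, d₃` and decays at
least like `s⁻⁴`. Hence `d₄` is the only possible pole, and `R` is a polynomial `P` in the
coordinate `T = 1 / (s - d₄) + v` (`exists_polynomial`). In that coordinate the reduction amounts to
two polynomial identities (`pullback_iff`). Comparing degrees in the one for the last coefficient
gives `αβ ≠ 0`, so that coefficient has a zero in `T`, and `v` is chosen to put it at the origin.

With `n = deg P` and `x, y, w` the images of `d₁, d₂, d₃`, the identities become `P'² (X - x)(X -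
y)(X - w) = n² X P (P - 1)` and a first-order consequence free of `P''` (`NormalPullback`). Local
analysis now suffices. The first-order identity at the origin forces `P(0)` to be `0` or `1`, and `P
↦ 1 - P` reduces to `P(0) = 0`. If the origin is nonsingular, it is a triple zero and `c = 2/3`; if
it is singular, it is a double zero and `2c - 1` is the residue there, nonzero because the point is
truly singular. In both cases `2c - 1 ≠ 0`, so every other zero of `P` is one of `x, y, w`, and it
is simple. Up to a constant, `P` is therefore `X³` or `X²` times a product of some of the remaining
linear factors: four types and three types up to permutation. The quadratic identity then fixes the
positions and the constant, and comparison of residues gives the exponent conditions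
(`hasNormalForm`).

Conversely each of the seven polynomials satisfies both identities, and `a, b` are recovered from
their sum and product. In the affine coordinate with `x ↦ 0`, `y ↦ 1`, the number `D` is the
position of `w` and `p` that of the origin, the zero of the last coefficient. So the accessory
parameter encodes this zero, and its uniqueness is a finite check on the orderings that share the
same `D`. -/

theorem ratDeriv_div (f g : ℂ[X]) (hg : g ≠ 0) :
    ratDeriv (algebraMap ℂ[X] (RatFunc ℂ) f / algebraMap ℂ[X] (RatFunc ℂ) g) =
      algebraMap ℂ[X] (RatFunc ℂ) (derivative f * g - f * derivative g) /
        algebraMap ℂ[X] (RatFunc ℂ) (g ^ 2) := by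
  have h : (algebraMap ℂ[X] (RatFunc ℂ) f / algebraMap ℂ[X] (RatFunc ℂ) g).num * g =
      f * (algebraMap ℂ[X] (RatFunc ℂ) f / algebraMap ℂ[X] (RatFunc ℂ) g).denom :=
    (RatFunc.num_mul_eq_mul_denom_iff hg).2 rfl
  have hd := (algebraMap ℂ[X] (RatFunc ℂ) f / algebraMap ℂ[X] (RatFunc ℂ) g).denom_ne_zero
  unfold ratDeriv
  generalize (algebraMap ℂ[X] (RatFunc ℂ) f / algebraMap ℂ[X] (RatFunc ℂ) g).num = n at *
  generalize (algebraMap ℂ[X] (RatFunc ℂ) f / algebraMap ℂ[X] (RatFunc ℂ) g).denom = d at *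
  have h' := congrArg derivative h
  simp only [derivative_mul] at h'
  have key : (derivative n * d - n * derivative d) * g ^ 2 =
      (derivative f * g - f * derivative g) * d ^ 2 := by
    linear_combination d * g * h' - (derivative d * g + d * derivative g) * h
  rw [div_eq_div_iff, ← map_mul, ← map_mul, key]
  · simpa using hd
  · simpa using hg

theorem exists_div (F : RatFunc ℂ) : ∃ f g : ℂ[X], g ≠ 0 ∧
    F = algebraMap ℂ[X] (RatFunc ℂ) f / algebraMap ℂ[X] (RatFunc ℂ) g :=
  ⟨F.num, F.denom, F.denom_ne_zero, F.num_div_denom.symm⟩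

theorem ratDeriv_add (F G : RatFunc ℂ) : ratDeriv (F + G) = ratDeriv F + ratDeriv G := by
  obtain ⟨f, g, hg, rfl⟩ := exists_div F
  obtain ⟨h, k, hk, rfl⟩ := exists_div G
  have hg' : algebraMap ℂ[X] (RatFunc ℂ) g ≠ 0 := by simpa using hg
  have hk' : algebraMap ℂ[X] (RatFunc ℂ) k ≠ 0 := by simpa using hk
  rw [div_add_div _ _ hg' hk', ← map_mul, ← map_mul, ← map_add, ← map_mul,
    ratDeriv_div _ _ (mul_ne_zero hg hk), ratDeriv_div _ _ hg, ratDeriv_div _ _ hk]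
  simp only [derivative_mul, map_mul, map_add, map_sub, map_pow]
  field_simp
  ring

theorem ratDeriv_mul (F G : RatFunc ℂ) :
    ratDeriv (F * G) = ratDeriv F * G + F * ratDeriv G := by
  obtain ⟨f, g, hg, rfl⟩ := exists_div F
  obtain ⟨h, k, hk, rfl⟩ := exists_div G
  have hg' : algebraMap ℂ[X] (RatFunc ℂ) g ≠ 0 := by simpa using hg
  have hk' : algebraMap ℂ[X] (RatFunc ℂ) k ≠ 0 := by simpa using hk
  rw [div_mul_div_comm, ← map_mul, ← map_mul,
    ratDeriv_div _ _ (mul_ne_zero hg hk), ratDeriv_div _ _ hg, ratDeriv_div _ _ hk]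
  simp only [derivative_mul, map_mul, map_add, map_sub, map_pow]
  field_simp
  ring

theorem ratDeriv_algebraMap (f : ℂ[X]) :
    ratDeriv (algebraMap ℂ[X] (RatFunc ℂ) f) = algebraMap ℂ[X] (RatFunc ℂ) (derivative f) := by
  simpa using ratDeriv_div f 1 one_ne_zero

theorem ratDeriv_C (k : ℂ) : ratDeriv (RatFunc.C k) = 0 := by
  simpa using ratDeriv_algebraMap (C k)

theorem ratDeriv_lin (x : ℂ) : ratDeriv (lin x) = 1 := by
  have h := ratDeriv_algebraMap (X - C x)
  simpa [lin] using h

/-- Chain rule. -/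
theorem ratDeriv_aeval (T : RatFunc ℂ) (P : ℂ[X]) :
    ratDeriv (aeval T P) = aeval T (derivative P) * ratDeriv T := by
  have hpow : ∀ n : ℕ, ratDeriv (T ^ n) = (n : RatFunc ℂ) * T ^ (n - 1) * ratDeriv T := by
    intro n
    induction n with
    | zero => simpa using ratDeriv_C 1
    | succ n ih =>
      rw [pow_succ, ratDeriv_mul, ih]
      rcases n with _ | n
      · simp
      · simp only [Nat.add_sub_cancel]
        push_cast
        ring
  induction P using Polynomial.induction_on' with
  | add p q hp hq => rw [map_add, ratDeriv_add, hp, hq, map_add, map_add, add_mul]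
  | monomial n a =>
    rw [aeval_monomial, ratDeriv_mul, hpow, derivative_monomial, aeval_monomial,
      RatFunc.algebraMap_eq_C, ratDeriv_C]
    simp only [map_mul, map_natCast]
    ring

theorem lin_eq (x : ℂ) : lin x = algebraMap ℂ[X] (RatFunc ℂ) (X - C x) := by
  simp [lin]

theorem lin_ne_zero (x : ℂ) : lin x ≠ 0 := by
  rw [lin_eq]
  exact RatFunc.algebraMap_ne_zero (X_sub_C_ne_zero x)

theorem transcendental_of_forall_ne_C {R : RatFunc ℂ} (h : ∀ k : ℂ, R ≠ RatFunc.C k) :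
    Transcendental ℂ R :=
  RatFunc.transcendental_of_ne_C R (by rintro ⟨k, hk⟩; exact h k hk)

/-- A nonconstant `R` is transcendental over `ℂ`, so substitution is the isomorphism of `ℂ(X)` with
`ℂ(R)`; this is what makes it commute with division. -/
theorem exists_ringHom_ratComp {R : RatFunc ℂ} (h : ∀ k : ℂ, R ≠ RatFunc.C k) :
    ∃ φ : RatFunc ℂ →+* RatFunc ℂ, (∀ F, ratComp F R = φ F) ∧
      (∀ k, φ (RatFunc.C k) = RatFunc.C k) ∧ φ RatFunc.X = R := by
  have ht := transcendental_of_forall_ne_C h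
  let ψ := (IntermediateField.val _).comp (RatFunc.algEquivOfTranscendental R ht).toAlgHom
  refine ⟨ψ.toRingHom, fun F => ?_, fun k => ?_, ?_⟩
  · change _ = ((RatFunc.algEquivOfTranscendental R ht F : _) : RatFunc ℂ)
    rw [RatFunc.algEquivOfTranscendental_apply]
    rfl
  · exact ψ.commutes k
  · change ((RatFunc.algEquivOfTranscendental R ht RatFunc.X : _) : RatFunc ℂ) = R
    rw [RatFunc.algEquivOfTranscendental_X]

theorem hypergeometric_pullback {R : RatFunc ℂ} (h : ∀ k : ℂ, R ≠ RatFunc.C k) (a b c : ℂ) :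
    (hypergeometric a b c).pullback R =
      ⟨(RatFunc.C c / R + RatFunc.C (a + b - c + 1) / (R - 1)) * ratDeriv R -
          ratDeriv (ratDeriv R) / ratDeriv R,
        RatFunc.C (a * b) / (R * (R - 1)) * ratDeriv R ^ 2⟩ := by
  obtain ⟨φ, h1, h2, h3⟩ := exists_ringHom_ratComp h
  simp only [LinODE.pullback, hypergeometric, h1, lin, map_add, map_div₀, map_mul, map_sub, h2, h3,
    map_zero, map_one, sub_zero]

/-! ### Pull-back in an affine coordinate that sends `d₄` to infinity -/

/-- The coordinate `u / (s - d₄) + v` on the Riemann sphere. -/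
noncomputable def coord (d₄ u v : ℂ) : RatFunc ℂ := RatFunc.C u / lin d₄ + RatFunc.C v

theorem coord_sub_C (d₄ u v : ℂ) : coord d₄ u v - RatFunc.C v = RatFunc.C u / lin d₄ := by
  simp [coord]

theorem C_ne_zero' {u : ℂ} (hu : u ≠ 0) : (RatFunc.C u : RatFunc ℂ) ≠ 0 := by
  simpa using hu

theorem coord_sub_C_ne_zero {d₄ u : ℂ} (hu : u ≠ 0) (v : ℂ) :
    coord d₄ u v - RatFunc.C v ≠ 0 := by
  rw [coord_sub_C]
  exact div_ne_zero (C_ne_zero' hu) (lin_ne_zero _)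

theorem lin_infty_eq {d₄ u : ℂ} (hu : u ≠ 0) (v : ℂ) :
    lin d₄ = RatFunc.C u / (coord d₄ u v - RatFunc.C v) := by
  rw [coord_sub_C, div_div_cancel₀ (C_ne_zero' hu)]

/-- As a function of `T`, `s - d` is a Möbius transformation: its zero is the image of `d`, and its
pole `v` is the image of `s = ∞`. -/
theorem lin_eq_coord {d d₄ u : ℂ} (hu : u ≠ 0) (v : ℂ) (hd : d ≠ d₄) :
    lin d = RatFunc.C (d₄ - d) * (coord d₄ u v - RatFunc.C (u / (d - d₄) + v)) /
      (coord d₄ u v - RatFunc.C v) := by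
  have h1 : lin d = lin d₄ + RatFunc.C (d₄ - d) := by simp only [lin, map_sub]; ring
  have h2 : RatFunc.C (d₄ - d) * RatFunc.C (u / (d - d₄)) = - RatFunc.C u := by
    rw [← map_mul, ← map_neg]
    congr 1
    have := sub_ne_zero.2 hd
    field_simp
    ring
  rw [eq_div_iff (coord_sub_C_ne_zero hu v), h1, add_mul]
  nth_rw 1 [lin_infty_eq hu v]
  rw [div_mul_cancel₀ _ (coord_sub_C_ne_zero hu v), map_add]
  linear_combination h2

theorem ratDeriv_coord {d₄ u : ℂ} (hu : u ≠ 0) (v : ℂ) :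
    ratDeriv (coord d₄ u v) = - (coord d₄ u v - RatFunc.C v) ^ 2 / RatFunc.C u := by
  have h : coord d₄ u v * lin d₄ = RatFunc.C u + RatFunc.C v * lin d₄ := by
    rw [coord, add_mul, div_mul_cancel₀ _ (lin_ne_zero _)]
  have h' := congrArg ratDeriv h
  rw [ratDeriv_mul, ratDeriv_add, ratDeriv_mul, ratDeriv_lin, ratDeriv_C, ratDeriv_C] at h'
  have hL := lin_ne_zero d₄
  have hC := C_ne_zero' hu
  rw [coord_sub_C, eq_div_iff hC, div_pow, ← neg_div, eq_div_iff (pow_ne_zero 2 hL)]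
  have h'' : ratDeriv (coord d₄ u v) * lin d₄ = - (coord d₄ u v - RatFunc.C v) := by
    linear_combination h'
  rw [coord_sub_C, ← neg_div, eq_div_iff hL] at h''
  linear_combination RatFunc.C u * h''

theorem coord_ne_C {d₄ u : ℂ} (hu : u ≠ 0) (v k : ℂ) : coord d₄ u v ≠ RatFunc.C k := by
  intro h
  have h1 := ratDeriv_coord (d₄ := d₄) hu v
  rw [h, ratDeriv_C, ← h] at h1
  exact div_ne_zero (neg_ne_zero.2 (pow_ne_zero 2 (coord_sub_C_ne_zero hu v))) (C_ne_zero' hu)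
    h1.symm

theorem aeval_coord_injective {d₄ u : ℂ} (hu : u ≠ 0) (v : ℂ) :
    Function.Injective (aeval (coord d₄ u v) : ℂ[X] →ₐ[ℂ] RatFunc ℂ) :=
  transcendental_iff_injective.1 (transcendental_of_forall_ne_C (coord_ne_C hu v))

/-- The equations expressing that `P` pulls a hypergeometric equation back to a Heun equation
with finite singular points `x, y, w`, where `c, c'` and `gx, gy, gw` are the residues of the
first coefficients. -/
structure PullsBack (x y w gx gy gw l m k c c' : ℂ) (P : ℂ[X]) : Prop where
  zeroth : C k * derivative P ^ 2 * ((X - C x) * (X - C y) * (X - C w)) =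
    (C l * X - C m) * (P * (P - 1))
  first : (C c * (P - 1) + C c' * P) * derivative P ^ 2 * ((X - C x) * (X - C y) * (X - C w)) -
      derivative (derivative P) * (P * (P - 1)) * ((X - C x) * (X - C y) * (X - C w)) =
    P * (P - 1) * derivative P * (C gx * ((X - C y) * (X - C w)) + C gy * ((X - C x) * (X - C w)) +
      C gw * ((X - C x) * (X - C y)))

section Field

variable {K : Type*} [Field K]

/-- To be read with `τ = T - v`, `θᵢ` the difference of `T` and the image of `dᵢ`, `S = P(T)` and
`S₁ = P'(T)`. The differences of the two sides of the two equations agree up to a nonzero factor. -/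
theorem zeroth_iff {A q u e₁ e₂ e₃ τ θ₁ θ₂ θ₃ k S S₁ : K} (hu : u ≠ 0) (h₁ : e₁ ≠ 0)
    (h₂ : e₂ ≠ 0) (h₃ : e₃ ≠ 0) (hτ : τ ≠ 0) (hθ₁ : θ₁ ≠ 0) (hθ₂ : θ₂ ≠ 0) (hθ₃ : θ₃ ≠ 0)
    (hS : S ≠ 0) (hS' : S - 1 ≠ 0) :
    (A * (e₁ * e₂ * e₃) / (u / τ) - q) /
        ((e₁ * θ₁ / τ) * (e₂ * θ₂ / τ) * (e₃ * θ₃ / τ) * (u / τ)) =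
      k / (S * (S - 1)) * (S₁ * (-τ ^ 2 / u)) ^ 2 ↔
    k * S₁ ^ 2 * (θ₁ * θ₂ * θ₃) = (A * τ - q * u / (e₁ * e₂ * e₃)) * (S * (S - 1)) := by
  have key : (A * (e₁ * e₂ * e₃) / (u / τ) - q) /
        ((e₁ * θ₁ / τ) * (e₂ * θ₂ / τ) * (e₃ * θ₃ / τ) * (u / τ)) -
      k / (S * (S - 1)) * (S₁ * (-τ ^ 2 / u)) ^ 2 =
      -(τ ^ 4 / (u ^ 2 * (S * (S - 1)) * (θ₁ * θ₂ * θ₃))) * (k * S₁ ^ 2 * (θ₁ * θ₂ * θ₃) -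
        (A * τ - q * u / (e₁ * e₂ * e₃)) * (S * (S - 1))) := by
    field_simp
    ring
  rw [← sub_eq_zero, key, mul_eq_zero, or_iff_right, sub_eq_zero]
  rw [neg_eq_zero]
  positivity

/-- In partial fractions with respect to `T`, each `gᵢ / (s - dᵢ)` contributes `gᵢ τ / u`. By the
Fuchs relation these parts add up to `2τ / u`, which is exactly the contribution of the second
derivative of `T`, so the point `T = v` and the residue `g₄` drop out. -/
theorem first_iff {g₁ g₂ g₃ g₄ u e₁ e₂ e₃ τ θ₁ θ₂ θ₃ c c' S S₁ S₂ : K} (hu : u ≠ 0) (h₁ : e₁ ≠ 0)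
    (h₂ : e₂ ≠ 0) (h₃ : e₃ ≠ 0) (hτ : τ ≠ 0) (hθ₁ : θ₁ ≠ 0) (hθ₂ : θ₂ ≠ 0) (hθ₃ : θ₃ ≠ 0)
    (hS : S ≠ 0) (hS' : S - 1 ≠ 0) (hS₁ : S₁ ≠ 0) (hg : g₁ + g₂ + g₃ + g₄ = 2)
    (he₁ : e₁ * θ₁ = e₁ * τ + u) (he₂ : e₂ * θ₂ = e₂ * τ + u) (he₃ : e₃ * θ₃ = e₃ * τ + u) :
    g₁ / (e₁ * θ₁ / τ) + g₂ / (e₂ * θ₂ / τ) + g₃ / (e₃ * θ₃ / τ) + g₄ / (u / τ) =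
      (c / S + c' / (S - 1)) * (S₁ * (-τ ^ 2 / u)) -
        (S₂ * (-τ ^ 2 / u) * (-τ ^ 2 / u) + S₁ * (2 * τ ^ 3 / u ^ 2)) / (S₁ * (-τ ^ 2 / u)) ↔
    (c * (S - 1) + c' * S) * S₁ ^ 2 * (θ₁ * θ₂ * θ₃) - S₂ * (S * (S - 1)) * (θ₁ * θ₂ * θ₃) =
      S * (S - 1) * S₁ * (g₁ * (θ₂ * θ₃) + g₂ * (θ₁ * θ₃) + g₃ * (θ₁ * θ₂)) := by
  have aux : ∀ g e θ : K, e ≠ 0 → θ ≠ 0 → e * θ = e * τ + u →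
      g / (e * θ / τ) = g * τ / u - g * τ ^ 2 / (u * θ) := by
    intro g e θ he hθ h
    field_simp
    linear_combination -g * h
  have hg₄ : g₄ = 2 - g₁ - g₂ - g₃ := by linear_combination hg
  have key : g₁ / (e₁ * θ₁ / τ) + g₂ / (e₂ * θ₂ / τ) + g₃ / (e₃ * θ₃ / τ) + g₄ / (u / τ) -
      ((c / S + c' / (S - 1)) * (S₁ * (-τ ^ 2 / u)) -
        (S₂ * (-τ ^ 2 / u) * (-τ ^ 2 / u) + S₁ * (2 * τ ^ 3 / u ^ 2)) / (S₁ * (-τ ^ 2 / u))) =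
      τ ^ 2 / (u * (S * (S - 1) * S₁) * (θ₁ * θ₂ * θ₃)) *
      ((c * (S - 1) + c' * S) * S₁ ^ 2 * (θ₁ * θ₂ * θ₃) - S₂ * (S * (S - 1)) * (θ₁ * θ₂ * θ₃) -
      S * (S - 1) * S₁ * (g₁ * (θ₂ * θ₃) + g₂ * (θ₁ * θ₃) + g₃ * (θ₁ * θ₂))) := by
    rw [aux _ _ _ h₁ hθ₁ he₁, aux _ _ _ h₂ hθ₂ he₂, aux _ _ _ h₃ hθ₃ he₃, hg₄]
    field_simp
    ring
  rw [← sub_eq_zero, key, mul_eq_zero, or_iff_right, sub_eq_zero]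
  positivity

end Field

theorem aeval_ne_C {d₄ u : ℂ} (hu : u ≠ 0) (v : ℂ) {P : ℂ[X]} (hP : 0 < P.natDegree) (k : ℂ) :
    aeval (coord d₄ u v) P ≠ RatFunc.C k := by
  intro h
  have h1 : aeval (coord d₄ u v) P = aeval (coord d₄ u v) (C k) := by
    rw [h, aeval_C, RatFunc.algebraMap_eq_C]
  rw [aeval_coord_injective hu v h1, natDegree_C] at hP
  exact lt_irrefl _ hP

theorem derivative_ne_zero_of_pos {P : ℂ[X]} (hP : 0 < P.natDegree) : derivative P ≠ 0 := by
  intro h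
  have := derivative_eq_zero.1 h
  omega

theorem pullback_iff {d₁ d₂ d₃ d₄ α β γ δ ε q u : ℂ} (v : ℂ) (a b c : ℂ)
    (h₁₄ : d₁ ≠ d₄) (h₂₄ : d₂ ≠ d₄) (h₃₄ : d₃ ≠ d₄) (hFuchs : α + β - γ - δ - ε + 1 = 0)
    (hu : u ≠ 0) {P : ℂ[X]} (hP : 0 < P.natDegree) :
    generalHeun d₁ d₂ d₃ d₄ α β γ δ ε q =
        (hypergeometric a b c).pullback (aeval (coord d₄ u v) P) ↔
      PullsBack (u / (d₁ - d₄) + v) (u / (d₂ - d₄) + v) (u / (d₃ - d₄) + v) γ δ ε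
        (α * β) (α * β * v + q * u / ((d₄ - d₁) * (d₄ - d₂) * (d₄ - d₃))) (a * b)
        c (a + b - c + 1) P := by
  set T := coord d₄ u v with hT
  have hinj := aeval_coord_injective (d₄ := d₄) hu v
  rw [← hT] at hinj
  have hne : ∀ k, aeval T P ≠ RatFunc.C k := aeval_ne_C hu v hP
  have hτ := coord_sub_C_ne_zero (d₄ := d₄) hu v
  rw [← hT] at hτ
  have hS₁ : aeval T (derivative P) ≠ 0 := by
    rw [Ne, map_eq_zero_iff _ hinj]
    exact derivative_ne_zero_of_pos hP
  have hS : aeval T P ≠ 0 := by simpa using hne 0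
  have hS' : aeval T P - 1 ≠ 0 := by simpa [sub_eq_zero] using hne 1
  have hT' : ratDeriv T = - (T - RatFunc.C v) ^ 2 / RatFunc.C u := ratDeriv_coord hu v
  have hC := C_ne_zero' hu
  have hT'' : ratDeriv (ratDeriv T) = 2 * (T - RatFunc.C v) ^ 3 / RatFunc.C u ^ 2 := by
    have e : ratDeriv T = aeval T (C (-u⁻¹) * (X - C v) ^ 2) := by
      rw [hT']
      simp [RatFunc.algebraMap_eq_C]
      ring
    rw [e, ratDeriv_aeval, hT']
    simp [RatFunc.algebraMap_eq_C, derivative_pow]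
    field_simp
    exact map_ofNat RatFunc.C 2
  have hθ : ∀ d, d ≠ d₄ → T - RatFunc.C (u / (d - d₄) + v) ≠ 0 := fun d _ =>
    sub_ne_zero.2 (coord_ne_C hu v _)
  have hd : ∀ d, d ≠ d₄ → (RatFunc.C (d₄ - d) : RatFunc ℂ) ≠ 0 := fun d h =>
    C_ne_zero' (sub_ne_zero.2 h.symm)
  have hr : ∀ d, d ≠ d₄ → RatFunc.C (d₄ - d) * (T - RatFunc.C (u / (d - d₄) + v)) =
      RatFunc.C (d₄ - d) * (T - RatFunc.C v) + RatFunc.C u := by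
    intro d h
    have h2 : RatFunc.C (d₄ - d) * RatFunc.C (u / (d - d₄)) = - RatFunc.C u := by
      rw [← map_mul, ← map_neg]
      congr 1
      have := sub_ne_zero.2 h
      field_simp
      ring
    rw [map_add]
    linear_combination -h2
  rw [hypergeometric_pullback hne, LinODE.ext_iff, and_comm]
  have hQ := zeroth_iff (A := RatFunc.C (α * β)) (q := RatFunc.C q) (k := RatFunc.C (a * b))
    (S₁ := aeval T (derivative P)) hC (hd _ h₁₄) (hd _ h₂₄) (hd _ h₃₄) hτ (hθ _ h₁₄) (hθ _ h₂₄)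
    (hθ _ h₃₄) hS hS'
  have hg : RatFunc.C γ + RatFunc.C δ + RatFunc.C ε + RatFunc.C (1 - α - β) = (2 : RatFunc ℂ) := by
    rw [← map_add, ← map_add, ← map_add, ← map_ofNat RatFunc.C 2]
    congr 1
    linear_combination -hFuchs
  have hF := first_iff (c := RatFunc.C c) (c' := RatFunc.C (a + b - c + 1))
    (S₂ := aeval T (derivative (derivative P)))
    hC (hd _ h₁₄) (hd _ h₂₄) (hd _ h₃₄) hτ (hθ _ h₁₄) (hθ _ h₂₄)
    (hθ _ h₃₄) hS hS' hS₁ hg (hr _ h₁₄) (hr _ h₂₄) (hr _ h₃₄)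
  have e1 : ratDeriv (aeval T P) = aeval T (derivative P) *
      (-(T - RatFunc.C v) ^ 2 / RatFunc.C u) := by rw [ratDeriv_aeval, hT']
  have e2 : ratDeriv (ratDeriv (aeval T P)) = aeval T (derivative (derivative P)) *
      (-(T - RatFunc.C v) ^ 2 / RatFunc.C u) * (-(T - RatFunc.C v) ^ 2 / RatFunc.C u) +
      aeval T (derivative P) * (2 * (T - RatFunc.C v) ^ 3 / RatFunc.C u ^ 2) := by
    rw [ratDeriv_aeval, ratDeriv_mul, ratDeriv_aeval, hT'', hT']
  have l4 : lin d₄ = RatFunc.C u / (T - RatFunc.C v) := lin_infty_eq hu v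
  have l1 := lin_eq_coord hu v h₁₄
  have l2 := lin_eq_coord hu v h₂₄
  have l3 := lin_eq_coord hu v h₃₄
  rw [← hT] at l1 l2 l3
  constructor
  · rintro ⟨hq, hp⟩
    simp only [generalHeun] at hq hp
    rw [e1, l1, l2, l3, l4, map_mul RatFunc.C (α * β), map_mul RatFunc.C _ (d₄ - d₃),
      map_mul RatFunc.C (d₄ - d₁)] at hq
    rw [e2, e1, l1, l2, l3, l4] at hp
    have hq' := hQ.1 hq
    have hp' := hF.1 hp
    constructor <;> apply hinj
    · simp only [map_mul, map_sub, map_pow, map_add, aeval_C, aeval_X, map_one, map_div₀,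
        RatFunc.algebraMap_eq_C] at hq' ⊢
      linear_combination hq'
    · simp only [map_mul, map_sub, map_pow, map_add, aeval_C, aeval_X, map_one, map_div₀,
        RatFunc.algebraMap_eq_C] at hp' ⊢
      linear_combination hp'
  · rintro ⟨hq, hp⟩
    have hq' := congrArg (aeval T) hq
    have hp' := congrArg (aeval T) hp
    simp only [generalHeun]
    rw [e2, e1, l1, l2, l3, l4, map_mul RatFunc.C (α * β), map_mul RatFunc.C _ (d₄ - d₃),
      map_mul RatFunc.C (d₄ - d₁)]
    refine ⟨hQ.2 ?_, hF.2 ?_⟩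
    · simp only [map_mul, map_sub, map_pow, map_add, aeval_C, aeval_X, map_one, map_div₀,
        RatFunc.algebraMap_eq_C] at hq' ⊢
      linear_combination hq'
    · simp only [map_mul, map_sub, map_pow, map_add, aeval_C, aeval_X, map_one, map_div₀,
        RatFunc.algebraMap_eq_C] at hp' ⊢
      linear_combination hp'

/-! ### The substitution is a polynomial in the affine coordinate -/

/-- The multiplicity is `m + 1`. The value of `D` at `x` records it, and this is how residues are
later read off from identities that involve `P'`. -/
theorem exists_factor_of_root {P : ℂ[X]} (hP : P ≠ 0) {x : ℂ} (hx : P.eval x = 0) :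
    ∃ (m : ℕ) (P₁ D : ℂ[X]), P = (X - C x) ^ (m + 1) * P₁ ∧ derivative P = (X - C x) ^ m * D ∧
      P₁.eval x ≠ 0 ∧ D.eval x = (m + 1) * P₁.eval x := by
  obtain ⟨P₁, h1, h2⟩ := exists_eq_pow_rootMultiplicity_mul_and_not_dvd P hP x
  have hpos : 0 < P.rootMultiplicity x := (rootMultiplicity_pos hP).2 hx
  obtain ⟨m, hm⟩ : ∃ m, P.rootMultiplicity x = m + 1 := ⟨_, (Nat.succ_pred_eq_of_pos hpos).symm⟩
  rw [hm] at h1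
  refine ⟨m, P₁, C ((m : ℂ) + 1) * P₁ + (X - C x) * derivative P₁, h1, ?_, ?_, ?_⟩
  · conv_lhs => rw [h1]
    simp only [derivative_mul, derivative_pow, derivative_X_sub_C]
    simp
    ring
  · rwa [dvd_iff_isRoot] at h2
  · simp

theorem eval_cubic_derivative (x y w t : ℂ) :
    (derivative ((X - C x) * (X - C y) * (X - C w))).eval t =
      (t - y) * (t - w) + (t - x) * (t - w) + (t - x) * (t - y) := by
  simp [derivative_mul]
  ring

theorem double_root_of_mul_eq {Z T G : ℂ[X]} {x : ℂ}
    (h : Z * T = (X - C x) * ((X - C x) * G)) (hZ : Z.eval x ≠ 0) :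
    T.eval x = 0 ∧ (derivative T).eval x = 0 := by
  have e1 := congrArg (eval x) h
  have e2 := congrArg (fun p => (derivative p).eval x) h
  simp only [derivative_mul, derivative_X_sub_C, eval_add, eval_mul, eval_sub, eval_X, eval_C,
    sub_self, zero_mul, mul_zero, add_zero, eval_one] at e1 e2
  have e3 := (mul_eq_zero.1 e1).resolve_left hZ
  rw [e3, mul_zero, zero_add] at e2
  exact ⟨e3, (mul_eq_zero.1 e2).resolve_left hZ⟩

/-- Expansion in powers of `1 / (s - d₄)`: the degree bound excludes a pole at infinity, and the
value of `N` at `d₄` is the top coefficient, split off at each inductive step. -/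
theorem exists_aeval_eq {d₄ u : ℂ} (hu : u ≠ 0) (v : ℂ) (n : ℕ) :
    ∀ N : ℂ[X], N.natDegree ≤ n → ∃ P : ℂ[X],
      algebraMap ℂ[X] (RatFunc ℂ) N / lin d₄ ^ n = aeval (coord d₄ u v) P := by
  have hL := lin_ne_zero d₄
  have hC := C_ne_zero' hu
  induction n with
  | zero =>
    intro N hN
    refine ⟨C (N.coeff 0), ?_⟩
    rw [eq_C_of_natDegree_le_zero hN]
    simp [RatFunc.algebraMap_eq_C]
  | succ n ih =>
    intro N hN
    obtain ⟨P, hP⟩ := ih (N /ₘ (X - C d₄)) (by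
      rw [natDegree_divByMonic _ (monic_X_sub_C d₄), natDegree_X_sub_C]; omega)
    refine ⟨P + C (N.eval d₄) * (C u⁻¹ * (X - C v)) ^ (n + 1), ?_⟩
    have h1 := modByMonic_add_div N (X - C d₄)
    rw [modByMonic_X_sub_C_eq_C_eval] at h1
    have h2 := congrArg (algebraMap ℂ[X] (RatFunc ℂ)) h1
    rw [map_add, map_mul, ← lin_eq, RatFunc.algebraMap_C] at h2
    rw [← h2, map_add, ← hP]
    simp only [map_mul, map_pow, map_sub, aeval_C, aeval_X, RatFunc.algebraMap_eq_C,
      coord_sub_C, map_inv₀]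
    rw [inv_mul_eq_div, div_div_cancel_left' hC, inv_pow, add_div, mul_comm (lin d₄),
      pow_succ, mul_div_mul_right _ _ hL, add_comm, div_eq_mul_inv (RatFunc.C _)]

/-- A quadratic differential identity confines the poles of `N / M` to `d₄`. -/
theorem root_denom {d₁ d₂ d₃ d₄ k : ℂ} {N M W B : ℂ[X]} (hk : k ≠ 0) (hMN : IsCoprime N M)
    (hM : M ≠ 0) (hW : W = derivative N * M - N * derivative M)
    (h₁₂ : d₁ ≠ d₂) (h₁₃ : d₁ ≠ d₃) (h₂₃ : d₂ ≠ d₃)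
    (h : C k * W ^ 2 * ((X - C d₁) * (X - C d₂) * (X - C d₃)) * (X - C d₄) ^ 2 =
      B * M ^ 2 * (N * (N - M))) {x : ℂ} (hx : M.eval x = 0) : x = d₄ := by
  by_contra hne
  have hN : N.eval x ≠ 0 := by
    intro h0
    obtain ⟨a, b, hab⟩ := hMN
    have := congrArg (eval x) hab
    simp [h0, hx] at this
  obtain ⟨m, M₁, D, h1, h2, h3, h4⟩ := exists_factor_of_root hM hx
  have hWV : W = (X - C x) ^ m * (derivative N * (X - C x) * M₁ - N * D) := by
    rw [hW, h2]
    nth_rw 1 [h1]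
    ring
  set V := derivative N * (X - C x) * M₁ - N * D
  have hm : ((m : ℂ) + 1) ≠ 0 := by exact_mod_cast Nat.succ_ne_zero m
  have hV : V.eval x ≠ 0 := by
    simp only [V, eval_sub, eval_mul, eval_X, eval_C, sub_self, mul_zero, zero_mul, zero_sub,
      neg_ne_zero, h4]
    positivity
  have hX : (X - C x : ℂ[X]) ≠ 0 := X_sub_C_ne_zero x
  -- `W²` contains `X - x` to the power `2m`, but `M²` to the power `2m + 2`. The two spare factors
  -- must divide the cubic, whose roots are simple.
  have key : (C k * V ^ 2 * (X - C d₄) ^ 2) * ((X - C d₁) * (X - C d₂) * (X - C d₃)) =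
      (X - C x) * ((X - C x) * (B * M₁ ^ 2 * (N * (N - M)))) := by
    apply mul_left_cancel₀ (pow_ne_zero (2 * m) hX)
    rw [hWV] at h
    have hM2 : M ^ 2 = (X - C x) ^ (2 * m) * ((X - C x) ^ 2 * M₁ ^ 2) := by
      conv_lhs => rw [h1]
      ring
    rw [hM2] at h
    linear_combination h
  have hZ : (C k * V ^ 2 * (X - C d₄) ^ 2).eval x ≠ 0 := by
    have := sub_ne_zero.2 hne
    simp only [eval_mul, eval_pow, eval_sub, eval_X, eval_C]
    positivity
  obtain ⟨e1, e2'⟩ := double_root_of_mul_eq key hZ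
  rw [eval_cubic_derivative] at e2'
  have e1' : (x - d₁) * (x - d₂) * (x - d₃) = 0 := by simpa using e1
  rcases mul_eq_zero.1 e1' with h' | h'
  · rcases mul_eq_zero.1 h' with h' | h'
    · rw [h', sub_eq_zero.1 h'] at e2'
      simp [sub_eq_zero, h₁₂, h₁₃] at e2'
    · rw [h', sub_eq_zero.1 h'] at e2'
      simp [sub_eq_zero, h₁₂.symm, h₂₃] at e2'
  · rw [h', sub_eq_zero.1 h'] at e2'
    simp [sub_eq_zero, h₁₃.symm, h₂₃.symm] at e2'

/-- If `R = N / M` had a pole at infinity, `R'² / (R (R - 1))` would decay only like `s⁻²`, too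
slowly for a Heun coefficient. -/
theorem natDegree_num_le {d₁ d₂ d₃ d₄ k : ℂ} {N M W B : ℂ[X]} (hk : k ≠ 0)
    (hM : M ≠ 0) (hW : W = derivative N * M - N * derivative M) (hB : B.natDegree ≤ 1)
    (h : C k * W ^ 2 * ((X - C d₁) * (X - C d₂) * (X - C d₃)) * (X - C d₄) ^ 2 =
      B * M ^ 2 * (N * (N - M))) : N.natDegree ≤ M.natDegree := by
  by_contra! hlt
  set n := N.natDegree with hn
  set m := M.natDegree with hm
  have hN : N ≠ 0 := by rintro rfl; simp [hn] at hlt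
  -- The operator `X d/dX` does not raise degrees and multiplies the leading coefficient by the
  -- degree, constants included, so `X * W` has the coefficient `n - m` times a unit in degree `n +
  -- m`.
  have hXd : ∀ p : ℂ[X], (X * derivative p).natDegree ≤ p.natDegree ∧
      (X * derivative p).coeff p.natDegree = p.natDegree * p.leadingCoeff := by
    intro p
    rcases Nat.eq_zero_or_pos p.natDegree with h0 | h0
    · rw [derivative_eq_zero.2 h0]
      simp [h0]
    · obtain ⟨r, hr⟩ : ∃ r, p.natDegree = r + 1 := ⟨_, (Nat.succ_pred_eq_of_pos h0).symm⟩
      constructor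
      · have h1 := natDegree_derivative_le p
        have h2 := natDegree_mul_le (p := (X : ℂ[X])) (q := derivative p)
        rw [natDegree_X] at h2
        omega
      · rw [leadingCoeff, hr, coeff_X_mul, coeff_derivative]
        push_cast
        ring
  have hc : (X * W).coeff (n + m) = ((n : ℂ) - m) * (N.leadingCoeff * M.leadingCoeff) := by
    have : X * W = (X * derivative N) * M - N * (X * derivative M) := by rw [hW]; ring
    rw [this, coeff_sub, coeff_mul_add_eq_of_natDegree_le (hXd N).1 le_rfl,
      coeff_mul_add_eq_of_natDegree_le le_rfl (hXd M).1, (hXd N).2, (hXd M).2]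
    simp only [leadingCoeff]
    ring
  have hnm : ((n : ℂ) - m) ≠ 0 := sub_ne_zero.2 (by exact_mod_cast hlt.ne')
  have hc' : (X * W).coeff (n + m) ≠ 0 := by
    rw [hc]
    exact mul_ne_zero hnm (mul_ne_zero (leadingCoeff_ne_zero.2 hN) (leadingCoeff_ne_zero.2 hM))
  have hXW : X * W ≠ 0 := by
    intro h0
    simp [h0] at hc'
  have hd : n + m ≤ (X * W).natDegree := le_natDegree_of_ne_zero hc'
  have h' : C k * (X * W) ^ 2 * ((X - C d₁) * (X - C d₂) * (X - C d₃)) * (X - C d₄) ^ 2 =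
      X ^ 2 * (B * M ^ 2 * (N * (N - M))) := by linear_combination X ^ 2 * h
  have e := congrArg natDegree h'
  have hC : (C k : ℂ[X]) ≠ 0 := C_ne_zero.2 hk
  have hX : ∀ d : ℂ, (X - C d : ℂ[X]) ≠ 0 := X_sub_C_ne_zero
  have l : (C k * (X * W) ^ 2 * ((X - C d₁) * (X - C d₂) * (X - C d₃)) *
      (X - C d₄) ^ 2).natDegree = 2 * (X * W).natDegree + 5 := by
    rw [natDegree_mul, natDegree_mul, natDegree_mul, natDegree_mul, natDegree_mul, natDegree_pow,
      natDegree_pow, natDegree_C]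
    · simp only [natDegree_X_sub_C]
      ring
    all_goals
      have := hX d₁
      have := hX d₂
      have := hX d₃
      have := hX d₄
      positivity
  have r : (X ^ 2 * (B * M ^ 2 * (N * (N - M)))).natDegree ≤ 2 + (1 + 2 * m + (n + n)) := by
    refine natDegree_mul_le_of_le (natDegree_X_pow_le 2) (natDegree_mul_le_of_le
      (natDegree_mul_le_of_le hB (natDegree_pow_le_of_le 2 le_rfl))
      (natDegree_mul_le_of_le le_rfl ?_))
    exact (natDegree_sub_le _ _).trans (max_le le_rfl hlt.le)
  omega

/-- Nontriviality makes the numerator `A - q (s - d₄)` nonzero, hence `k ≠ 0`, and the bounds on the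
poles apply. The coordinate is left arbitrary because the useful `v` is available only once `αβ ≠ 0`
is known. -/
theorem exists_polynomial {d₁ d₂ d₃ d₄ A q k u : ℂ} {R : RatFunc ℂ}
    (h₁₂ : d₁ ≠ d₂) (h₁₃ : d₁ ≠ d₃) (h₂₃ : d₂ ≠ d₃)
    (hR : ∀ k : ℂ, R ≠ RatFunc.C k) (hAq : A ≠ 0 ∨ q ≠ 0)
    (h : (RatFunc.C A / lin d₄ - RatFunc.C q) / (lin d₁ * lin d₂ * lin d₃ * lin d₄) =
      RatFunc.C k / (R * (R - 1)) * ratDeriv R ^ 2) (hu : u ≠ 0) (v : ℂ) :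
    k ≠ 0 ∧ ∃ P : ℂ[X], 0 < P.natDegree ∧ R = aeval (coord d₄ u v) P := by
  have hL := lin_ne_zero
  have hR0 : R ≠ 0 := by simpa using hR 0
  have hR1 : R - 1 ≠ 0 := by simpa [sub_eq_zero] using hR 1
  have hBR : RatFunc.C A - RatFunc.C q * lin d₄ =
      algebraMap ℂ[X] (RatFunc ℂ) (C A - C q * (X - C d₄)) := by
    rw [lin_eq]
    simp [RatFunc.algebraMap_C]
  have hB0 : C A - C q * (X - C d₄) ≠ 0 := by
    intro h0
    have h1 := congrArg (eval d₄) h0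
    have h2 := congrArg (eval (d₄ + 1)) h0
    simp at h1 h2
    rw [h1] at h2 hAq
    simp_all
  have hk : k ≠ 0 := by
    rintro rfl
    rw [map_zero, zero_div, zero_mul, div_eq_zero_iff, or_iff_left] at h
    · apply hB0
      apply RatFunc.algebraMap_injective ℂ
      rw [← hBR, map_zero]
      have := hL d₄
      field_simp at h
      linear_combination h
    · have := hL d₁
      have := hL d₂
      have := hL d₃
      have := hL d₄
      positivity
  refine ⟨hk, ?_⟩
  have hM := R.denom_ne_zero
  have hM' := RatFunc.algebraMap_ne_zero hM
  have hRd := RatFunc.num_div_denom R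
  have hcop := RatFunc.isCoprime_num_denom R
  have hmon := RatFunc.monic_denom R
  have hder : ratDeriv R = algebraMap ℂ[X] (RatFunc ℂ)
      (derivative R.num * R.denom - R.num * derivative R.denom) /
      algebraMap ℂ[X] (RatFunc ℂ) (R.denom ^ 2) := rfl
  generalize R.num = N at *
  generalize R.denom = M at *
  have hpoly : C k * (derivative N * M - N * derivative M) ^ 2 *
      ((X - C d₁) * (X - C d₂) * (X - C d₃)) * (X - C d₄) ^ 2 =
      (C A - C q * (X - C d₄)) * M ^ 2 * (N * (N - M)) := by
    apply RatFunc.algebraMap_injective ℂ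
    have e : (RatFunc.C A - RatFunc.C q * lin d₄) * (R * (R - 1)) =
        RatFunc.C k * ratDeriv R ^ 2 * (lin d₁ * lin d₂ * lin d₃) * lin d₄ ^ 2 := by
      have := hL d₁
      have := hL d₂
      have := hL d₃
      have := hL d₄
      field_simp at h
      linear_combination h
    rw [hder, ← hRd, hBR] at e
    simp only [lin_eq, map_mul, map_pow, ← RatFunc.algebraMap_C] at e ⊢
    rw [map_sub (algebraMap ℂ[X] (RatFunc ℂ)) N M]
    field_simp at e
    linear_combination -e
  have hroot : ∀ x, M.eval x = 0 → x = d₄ := fun x hx =>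
    root_denom hk hcop hM rfl h₁₂ h₁₃ h₂₃ hpoly hx
  have hdeg : N.natDegree ≤ M.natDegree := by
    refine natDegree_num_le hk hM rfl ?_ hpoly
    refine (natDegree_sub_le _ _).trans (max_le (by simp) ?_)
    exact (natDegree_C_mul_le _ _).trans (natDegree_X_sub_C d₄).le
  -- A monic polynomial over `ℂ` with no root other than `d₄`.
  have hMeq : M = (X - C d₄) ^ M.natDegree := by
    have hs := IsAlgClosed.splits M
    have h1 := hs.eq_prod_roots_of_monic hmon
    have h2 : M.roots = Multiset.replicate M.natDegree d₄ := by
      rw [Multiset.eq_replicate]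
      exact ⟨hs.natDegree_eq_card_roots.symm, fun b hb => hroot b (isRoot_of_mem_roots hb)⟩
    rw [h2] at h1
    simpa using h1
  obtain ⟨P, hP⟩ := exists_aeval_eq (d₄ := d₄) hu v M.natDegree N hdeg
  have hRP : R = aeval (coord d₄ u v) P := by
    rw [← hP, ← hRd, lin_eq, ← map_pow, ← hMeq]
  refine ⟨P, Nat.pos_of_ne_zero fun h0 => ?_, hRP⟩
  rw [eq_C_of_natDegree_eq_zero h0, aeval_C, RatFunc.algebraMap_eq_C] at hRP
  exact hR _ hRP

/-! ### Polynomial substitutions in normal position -/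

/-- `P` pulls a hypergeometric equation with residues `c, c'` back to a Heun equation with finite
singular points `x, y, w`, residues `gx, gy, gw` and apparent zero of the last coefficient at
the origin; the second equation is the first-order consequence of the two pull-back equations. -/
structure NormalPullback (x y w gx gy gw c c' : ℂ) (P : ℂ[X]) : Prop where
  pos : 0 < P.natDegree
  quad : derivative P ^ 2 * ((X - C x) * (X - C y) * (X - C w)) =
    C ((P.natDegree : ℂ) ^ 2) * X * (P * (P - 1))
  log : (C (2 * c - 1) * (P - 1) + C (2 * c' - 1) * P) * derivative P *
      ((X - C x) * (X - C y) * (X - C w)) * X =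
    P * (P - 1) * ((C (2 * gx - 1) * ((X - C y) * (X - C w)) +
      C (2 * gy - 1) * ((X - C x) * (X - C w)) + C (2 * gw - 1) * ((X - C x) * (X - C y))) * X +
      (X - C x) * (X - C y) * (X - C w))

/-- The derivative of the quadratic identity expresses `P''` through lower-order terms. Substituting
it into the other identity leaves a relation for the logarithmic derivatives; the factors
introduced, `P'²` in one direction and `2 X P'` in the other, are cancelled. -/
theorem first_iff_log {x y w gx gy gw c c' n : ℂ} {P : ℂ[X]} (hP : derivative P ≠ 0)
    (hQ : derivative P ^ 2 * ((X - C x) * (X - C y) * (X - C w)) =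
      C (n ^ 2) * X * (P * (P - 1))) :
    (C c * (P - 1) + C c' * P) * derivative P ^ 2 * ((X - C x) * (X - C y) * (X - C w)) -
      derivative (derivative P) * (P * (P - 1)) * ((X - C x) * (X - C y) * (X - C w)) =
    P * (P - 1) * derivative P * (C gx * ((X - C y) * (X - C w)) + C gy * ((X - C x) * (X - C w)) +
      C gw * ((X - C x) * (X - C y))) ↔
    (C (2 * c - 1) * (P - 1) + C (2 * c' - 1) * P) * derivative P *
      ((X - C x) * (X - C y) * (X - C w)) * X =
    P * (P - 1) * ((C (2 * gx - 1) * ((X - C y) * (X - C w)) +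
      C (2 * gy - 1) * ((X - C x) * (X - C w)) + C (2 * gw - 1) * ((X - C x) * (X - C y))) * X +
      (X - C x) * (X - C y) * (X - C w)) := by
  have hd := congrArg derivative hQ
  simp only [derivative_mul, derivative_pow, derivative_C, derivative_X,
    derivative_sub, derivative_one] at hd
  simp only [Nat.cast_ofNat, map_ofNat, Nat.add_one_sub_one, pow_one] at hd
  have h2 : (C 2 : ℂ[X]) = 2 := rfl
  constructor
  · intro h
    apply mul_left_cancel₀ (pow_ne_zero 2 hP)
    simp only [map_sub, map_mul, map_one, h2]
    linear_combination 2 * X * derivative P * h + P * (P - 1) * X * hd -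
      (derivative P * (2 * P - 1) * X + P * (P - 1)) * hQ
  · intro h
    apply mul_left_cancel₀ (mul_ne_zero (mul_ne_zero two_ne_zero X_ne_zero) hP)
    simp only [map_sub, map_mul, map_one, h2] at h
    linear_combination derivative P ^ 2 * h - P * (P - 1) * X * hd +
      (derivative P * (2 * P - 1) * X + P * (P - 1)) * hQ

namespace NormalPullback

variable {x y w gx gy gw c c' : ℂ} {P : ℂ[X]}

/-- The symmetry `z ↦ 1 - z` of the hypergeometric equation exchanges its two finite singular
points, hence the two residues. -/
theorem one_sub (h : NormalPullback x y w gx gy gw c c' P) :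
    NormalPullback x y w gx gy gw c' c (1 - P) := by
  have hn : (1 - P).natDegree = P.natDegree := by
    rw [← natDegree_neg, neg_sub, ← C_1, natDegree_sub_C]
  refine ⟨hn ▸ h.pos, ?_, ?_⟩
  · rw [hn, derivative_sub, derivative_one]
    linear_combination h.quad
  · rw [derivative_sub, derivative_one]
    linear_combination h.log

theorem swap₁₂ (h : NormalPullback x y w gx gy gw c c' P) :
    NormalPullback y x w gy gx gw c c' P :=
  ⟨h.pos, by linear_combination h.quad, by linear_combination h.log⟩

theorem swap₂₃ (h : NormalPullback x y w gx gy gw c c' P) :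
    NormalPullback x w y gx gw gy c c' P :=
  ⟨h.pos, by linear_combination h.quad, by linear_combination h.log⟩

theorem swap₁₃ (h : NormalPullback x y w gx gy gw c c' P) :
    NormalPullback w y x gw gy gx c c' P :=
  ⟨h.pos, by linear_combination h.quad, by linear_combination h.log⟩

theorem ne_zero (h : NormalPullback x y w gx gy gw c c' P) : P ≠ 0 := by
  rintro rfl
  simpa using h.pos

theorem natDegree_sq_ne_zero (h : NormalPullback x y w gx gy gw c c' P) :
    (P.natDegree : ℂ) ^ 2 ≠ 0 :=
  pow_ne_zero 2 (by exact_mod_cast h.pos.ne')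

/-- Zeros of `P` with noninteger exponent difference lie over singular points. -/
theorem eq_of_root (h : NormalPullback x y w gx gy gw c c' P) (hc : 2 * c - 1 ≠ 0) {a : ℂ}
    (ha : P.eval a = 0) : a = 0 ∨ a = x ∨ a = y ∨ a = w := by
  obtain ⟨m, P₁, D, h1, h2, h3, h4⟩ := exists_factor_of_root h.ne_zero ha
  have hm : ((m : ℂ) + 1) ≠ 0 := by exact_mod_cast Nat.succ_ne_zero m
  have e := h.log
  rw [h2] at e
  -- `P'` vanishes at `a` to order `m` only, `P` to order `m + 1`: after division by `(X - a)ᵐ` the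
  -- right side vanishes at `a`, while the left side can vanish only through `X` or the cubic.
  have e1 : (C (2 * c - 1) * (P - 1) + C (2 * c' - 1) * P) * D *
      ((X - C x) * (X - C y) * (X - C w)) * X =
    (X - C a) * P₁ * (P - 1) * ((C (2 * gx - 1) * ((X - C y) * (X - C w)) +
      C (2 * gy - 1) * ((X - C x) * (X - C w)) + C (2 * gw - 1) * ((X - C x) * (X - C y))) * X +
      (X - C x) * (X - C y) * (X - C w)) := by
    apply mul_left_cancel₀ (pow_ne_zero m (X_sub_C_ne_zero a))
    have : (X - C a) ^ m * ((X - C a) * P₁) = P := by rw [h1]; ring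
    linear_combination e - (P - 1) * ((C (2 * gx - 1) * ((X - C y) * (X - C w)) +
      C (2 * gy - 1) * ((X - C x) * (X - C w)) + C (2 * gw - 1) * ((X - C x) * (X - C y))) * X +
      (X - C x) * (X - C y) * (X - C w)) * this
  have e2 := congrArg (eval a) e1
  simp only [eval_mul, eval_add, eval_sub, eval_X, eval_C, eval_one, ha, h4, sub_self,
    zero_mul, mul_zero, add_zero, zero_sub] at e2
  simp only [mul_eq_zero, hc, h3, hm, neg_eq_zero, one_ne_zero, false_or, or_false,
    sub_eq_zero] at e2
  tauto

/-- For a zero of order `m + 1` at `x`, the two sides of the quadratic identity vanish to orders at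
least `2m + 1` and exactly `m + 1`, so `m = 0`. -/
theorem simple_root (h : NormalPullback x y w gx gy gw c c' P) (hx : x ≠ 0)
    (ha : P.eval x = 0) : ∃ P₁ : ℂ[X], P = (X - C x) * P₁ ∧ P₁.eval x ≠ 0 := by
  obtain ⟨m, P₁, D, h1, h2, h3, h4⟩ := exists_factor_of_root h.ne_zero ha
  rcases Nat.eq_zero_or_pos m with rfl | hm
  · exact ⟨P₁, by simpa using h1, h3⟩
  exfalso
  obtain ⟨r, rfl⟩ : ∃ r, m = r + 1 := ⟨_, (Nat.succ_pred_eq_of_pos hm).symm⟩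
  have e := h.quad
  have e1 : (X - C x) ^ r * D ^ 2 * ((X - C x) * (X - C y) * (X - C w)) =
      C ((P.natDegree : ℂ) ^ 2) * X * (P₁ * (P - 1)) := by
    apply mul_left_cancel₀ (pow_ne_zero (r + 1 + 1) (X_sub_C_ne_zero x))
    rw [h2] at e
    linear_combination e + C ((P.natDegree : ℂ) ^ 2) * X * (P - 1) * h1
  have e2 := congrArg (eval x) e1
  simp only [eval_mul, eval_sub, eval_X, eval_C, eval_one, ha, sub_self,
    zero_mul, mul_zero, zero_sub] at e2
  exact mul_ne_zero (mul_ne_zero h.natDegree_sq_ne_zero hx) (mul_ne_zero h3 (by norm_num)) e2.symm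

theorem eval_singular (h : NormalPullback x y w gx gy gw c c' P) (hx : x ≠ 0) :
    P.eval x = 0 ∨ P.eval x = 1 := by
  have e2 := congrArg (eval x) h.quad
  have := h.natDegree_sq_ne_zero
  simp only [eval_mul, eval_sub, eval_X, eval_C, eval_one, sub_self,
    zero_mul, mul_zero, zero_eq_mul] at e2
  simpa [this, hx, sub_eq_zero] using e2

/-- `P` is unramified at such a point, so the exponent difference `1 - c` is carried over unchanged.
-/
theorem residue_eq (h : NormalPullback x y w gx gy gw c c' P) (hx : x ≠ 0) (hxy : x ≠ y)
    (hxw : x ≠ w) (ha : P.eval x = 0) : gx = c := by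
  obtain ⟨P₁, h1, h3⟩ := h.simple_root hx ha
  have e := h.log
  have e1 : (C (2 * c - 1) * (P - 1) + C (2 * c' - 1) * P) * derivative P *
      ((X - C y) * (X - C w)) * X =
    P₁ * (P - 1) * ((C (2 * gx - 1) * ((X - C y) * (X - C w)) +
      C (2 * gy - 1) * ((X - C x) * (X - C w)) + C (2 * gw - 1) * ((X - C x) * (X - C y))) * X +
      (X - C x) * (X - C y) * (X - C w)) := by
    apply mul_left_cancel₀ (X_sub_C_ne_zero x)
    linear_combination e + (P - 1) * ((C (2 * gx - 1) * ((X - C y) * (X - C w)) +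
      C (2 * gy - 1) * ((X - C x) * (X - C w)) + C (2 * gw - 1) * ((X - C x) * (X - C y))) * X +
      (X - C x) * (X - C y) * (X - C w)) * h1
  have hd : (derivative P).eval x = P₁.eval x := by
    rw [h1, derivative_mul]
    simp
  have e2 := congrArg (eval x) e1
  simp only [eval_mul, eval_add, eval_sub, eval_X, eval_C, eval_one, ha, hd, sub_self,
    zero_mul, mul_zero, add_zero, zero_sub] at e2
  have n1 := sub_ne_zero.2 hxy
  have n2 := sub_ne_zero.2 hxw
  have : (P₁.eval x * (x - y) * (x - w) * x) * (gx - c) = 0 := by linear_combination e2 / 2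
  exact sub_eq_zero.1 ((mul_eq_zero.1 this).resolve_left (by positivity))

theorem residue_eq' (h : NormalPullback x y w gx gy gw c c' P) (hx : x ≠ 0) (hxy : x ≠ y)
    (hxw : x ≠ w) (ha : P.eval x = 1) : gx = c' :=
  h.one_sub.residue_eq hx hxy hxw (by simp [ha])

/-- At the origin the left side of the first-order identity vanishes, and the right side is `P (P -
1)` times `-xyw`. -/
theorem eval_zero_of_ne (h : NormalPullback x y w gx gy gw c c' P) (hx : x ≠ 0) (hy : y ≠ 0)
    (hw : w ≠ 0) : P.eval 0 = 0 ∨ P.eval 0 = 1 := by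
  have e2 := congrArg (eval 0) h.log
  simp only [eval_mul, eval_add, eval_sub, eval_X, eval_C, eval_one,
    mul_zero, zero_add, zero_eq_mul] at e2
  simpa [hx, hy, hw, sub_eq_zero] using e2

/-- For `y = 0` the identity is divisible by `X`. The last cubic on the right then merges with the
term of `gy`, which is why `2 * gy - 1` becomes `2 * gy`. -/
theorem log_cancel (h : NormalPullback x 0 w gx gy gw c c' P) :
    (C (2 * c - 1) * (P - 1) + C (2 * c' - 1) * P) * derivative P *
      ((X - C x) * X * (X - C w)) =
    P * (P - 1) * (C (2 * gx - 1) * (X * (X - C w)) +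
      C (2 * gy) * ((X - C x) * (X - C w)) + C (2 * gw - 1) * ((X - C x) * X)) := by
  apply mul_left_cancel₀ (X_ne_zero (R := ℂ))
  have e := h.log
  simp only [map_sub, map_mul, map_one, map_zero, sub_zero] at e ⊢
  linear_combination e

theorem eval_zero_of_eq (h : NormalPullback x 0 w gx gy gw c c' P) (hx : x ≠ 0) (hw : w ≠ 0)
    (hg : gy ≠ 0) : P.eval 0 = 0 ∨ P.eval 0 = 1 := by
  have e2 := congrArg (eval 0) h.log_cancel
  simp only [eval_mul, eval_add, eval_sub, eval_X, eval_C, eval_one,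
    mul_zero, zero_mul, zero_add, add_zero, zero_eq_mul] at e2
  simpa [hx, hw, hg, sub_eq_zero] using e2

/-- A zero of `P` at a nonsingular zero of the last coefficient is triple. -/
theorem triple_root (h : NormalPullback x y w gx gy gw c c' P) (hx : x ≠ 0) (hy : y ≠ 0)
    (hw : w ≠ 0) (ha : P.eval 0 = 0) :
    c = 2 / 3 ∧ ∃ P₁ : ℂ[X], P = X ^ 3 * P₁ ∧ P₁.eval 0 ≠ 0 := by
  obtain ⟨m, P₁, D, h1, h2, h3, h4⟩ := exists_factor_of_root h.ne_zero ha
  have hm : ((m : ℂ) + 1) ≠ 0 := by exact_mod_cast Nat.succ_ne_zero m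
  rw [C_0, sub_zero] at h1 h2
  have hD : D.eval 0 ≠ 0 := by rw [h4]; exact mul_ne_zero hm h3
  have hn := h.natDegree_sq_ne_zero
  have e := h.quad
  have key : X ^ m * (D ^ 2 * ((X - C x) * (X - C y) * (X - C w))) =
      X ^ 2 * (C ((P.natDegree : ℂ) ^ 2) * (P₁ * (P - 1))) := by
    apply mul_left_cancel₀ (pow_ne_zero m (X_ne_zero (R := ℂ)))
    rw [h2] at e
    linear_combination e + C ((P.natDegree : ℂ) ^ 2) * X * (P - 1) * h1
  -- The orders of the two sides of the quadratic identity at the origin are `2m` and `m + 2`.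
  have hm2 : m = 2 := by
    rcases lt_trichotomy m 2 with hlt | heq | hgt
    · exfalso
      have key' : D ^ 2 * ((X - C x) * (X - C y) * (X - C w)) =
          X ^ (2 - m) * (C ((P.natDegree : ℂ) ^ 2) * (P₁ * (P - 1))) := by
        apply mul_left_cancel₀ (pow_ne_zero m (X_ne_zero (R := ℂ)))
        rw [key, ← mul_assoc (X ^ m), ← pow_add, Nat.add_sub_cancel' hlt.le]
      have k := congrArg (eval 0) key'
      rw [eval_mul (p := X ^ (2 - m)), eval_pow, eval_X, zero_pow (by omega), zero_mul] at k
      simp [hD, hx, hy, hw] at k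
    · exact heq
    · exfalso
      obtain ⟨r, rfl⟩ : ∃ r, m = 2 + (r + 1) := ⟨m - 3, by omega⟩
      rw [pow_add, mul_assoc] at key
      have k := congrArg (eval 0) (mul_left_cancel₀ (pow_ne_zero 2 (X_ne_zero (R := ℂ))) key)
      simp [h3, ha] at k
      exact h.pos.ne' k
  subst hm2
  refine ⟨?_, P₁, h1, h3⟩
  have e1 : (C (2 * c - 1) * (P - 1) + C (2 * c' - 1) * P) * D *
      ((X - C x) * (X - C y) * (X - C w)) =
    P₁ * (P - 1) * ((C (2 * gx - 1) * ((X - C y) * (X - C w)) +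
      C (2 * gy - 1) * ((X - C x) * (X - C w)) + C (2 * gw - 1) * ((X - C x) * (X - C y))) * X +
      (X - C x) * (X - C y) * (X - C w)) := by
    apply mul_left_cancel₀ (pow_ne_zero 3 (X_ne_zero (R := ℂ)))
    have e := h.log
    rw [h2] at e
    linear_combination e + (P - 1) * ((C (2 * gx - 1) * ((X - C y) * (X - C w)) +
      C (2 * gy - 1) * ((X - C x) * (X - C w)) + C (2 * gw - 1) * ((X - C x) * (X - C y))) * X +
      (X - C x) * (X - C y) * (X - C w)) * h1
  have e2 := congrArg (eval 0) e1
  simp only [eval_mul, eval_add, eval_sub, eval_X, eval_C, eval_one, ha, h4,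
    mul_zero, add_zero, zero_sub, zero_add] at e2
  -- The first-order identity at a triple zero reads `3 (2c - 1) = 1`.
  have : (P₁.eval 0 * x * y * w) * (3 * c - 2) = 0 := by
    push_cast at e2
    linear_combination e2 / 2
  have := (mul_eq_zero.1 this).resolve_left (by positivity)
  linear_combination this / 3

/-- A zero of `P` at a singular point where the last coefficient has no pole is double. -/
theorem double_root (h : NormalPullback x 0 w gx gy gw c c' P) (hx : x ≠ 0)
    (hw : w ≠ 0) (ha : P.eval 0 = 0) :
    gy = 2 * c - 1 ∧ ∃ P₁ : ℂ[X], P = X ^ 2 * P₁ ∧ P₁.eval 0 ≠ 0 := by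
  obtain ⟨m, P₁, D, h1, h2, h3, h4⟩ := exists_factor_of_root h.ne_zero ha
  have hm : ((m : ℂ) + 1) ≠ 0 := by exact_mod_cast Nat.succ_ne_zero m
  rw [C_0, sub_zero] at h1 h2
  have hD : D.eval 0 ≠ 0 := by rw [h4]; exact mul_ne_zero hm h3
  have hn := h.natDegree_sq_ne_zero
  have e := h.quad
  have key : X ^ m * (D ^ 2 * ((X - C x) * (X - C w))) =
      X ^ 1 * (C ((P.natDegree : ℂ) ^ 2) * (P₁ * (P - 1))) := by
    apply mul_left_cancel₀ (pow_ne_zero (m + 1) (X_ne_zero (R := ℂ)))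
    rw [h2, C_0, sub_zero] at e
    linear_combination e + C ((P.natDegree : ℂ) ^ 2) * X * (P - 1) * h1
  -- Now the cubic contributes a factor `X`, and the orders are `2m + 1` and `m + 2`.
  have hm1 : m = 1 := by
    rcases lt_trichotomy m 1 with hlt | heq | hgt
    · exfalso
      obtain rfl : m = 0 := by omega
      have k := congrArg (eval 0) key
      simp [hD, hx, hw] at k
    · exact heq
    · exfalso
      obtain ⟨r, rfl⟩ : ∃ r, m = 1 + (r + 1) := ⟨m - 2, by omega⟩
      rw [pow_add, mul_assoc] at key
      have k := congrArg (eval 0) (mul_left_cancel₀ (pow_ne_zero 1 (X_ne_zero (R := ℂ))) key)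
      simp [h3, ha] at k
      exact h.pos.ne' k
  subst hm1
  refine ⟨?_, P₁, h1, h3⟩
  have e1 : (C (2 * c - 1) * (P - 1) + C (2 * c' - 1) * P) * D *
      ((X - C x) * (X - C w)) =
    P₁ * (P - 1) * (C (2 * gx - 1) * (X * (X - C w)) +
      C (2 * gy) * ((X - C x) * (X - C w)) + C (2 * gw - 1) * ((X - C x) * X)) := by
    apply mul_left_cancel₀ (pow_ne_zero 2 (X_ne_zero (R := ℂ)))
    have e := h.log_cancel
    rw [h2] at e
    linear_combination e + (P - 1) * (C (2 * gx - 1) * (X * (X - C w)) +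
      C (2 * gy) * ((X - C x) * (X - C w)) + C (2 * gw - 1) * ((X - C x) * X)) * h1
  have e2 := congrArg (eval 0) e1
  simp only [eval_mul, eval_add, eval_sub, eval_X, eval_C, eval_one, ha, h4,
    mul_zero, zero_mul, add_zero, zero_sub, zero_add] at e2
  -- The first-order identity at a double zero reads `2 (2c - 1) = 2 gy`.
  have : (P₁.eval 0 * x * w) * (gy - (2 * c - 1)) = 0 := by
    push_cast at e2
    linear_combination e2 / 2
  exact sub_eq_zero.1 ((mul_eq_zero.1 this).resolve_left (by positivity))

end NormalPullback

/-! ### Factorization of polynomials with prescribed roots. -/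

theorem exists_simple_factor {P : ℂ[X]} (x : ℂ)
    (h : P.eval x = 0 → ∃ P₁ : ℂ[X], P = (X - C x) * P₁ ∧ P₁.eval x ≠ 0) :
    ∃ i : Fin 2, ∃ P₁ : ℂ[X], P = (X - C x) ^ (i : ℕ) * P₁ ∧ P₁.eval x ≠ 0 := by
  by_cases hx : P.eval x = 0
  · obtain ⟨P₁, h1, h2⟩ := h hx
    exact ⟨1, P₁, by simpa using h1, h2⟩
  · exact ⟨0, P, by simp, hx⟩

theorem simple_factor_of_mul {P P₁ A : ℂ[X]} {x : ℂ} (hP : P = A * P₁)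
    (h : P.eval x = 0 → ∃ P₂ : ℂ[X], P = (X - C x) * P₂ ∧ P₂.eval x ≠ 0) :
    P₁.eval x = 0 → ∃ P₂ : ℂ[X], P₁ = (X - C x) * P₂ ∧ P₂.eval x ≠ 0 := by
  intro h0
  obtain ⟨P₂, h1, h2⟩ := h (by rw [hP, eval_mul, h0, mul_zero])
  obtain ⟨P₃, h3⟩ := dvd_iff_isRoot.2 h0
  refine ⟨P₃, h3, fun h4 => h2 ?_⟩
  have : P₂ = A * P₃ := by
    apply mul_left_cancel₀ (X_sub_C_ne_zero x)
    rw [← h1, hP, h3]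
    ring
  rw [this, eval_mul, h4, mul_zero]

theorem eq_C_of_no_root {P : ℂ[X]} (h : ∀ a, P.eval a ≠ 0) : ∃ k : ℂ, k ≠ 0 ∧ P = C k := by
  have h0 : P.degree = 0 := by
    by_contra hd
    obtain ⟨a, ha⟩ := IsAlgClosed.exists_root P hd
    exact h a ha
  have := eq_C_of_degree_eq_zero h0
  refine ⟨P.coeff 0, fun h1 => h 0 ?_, this⟩
  rw [this, h1, C_0, eval_zero]

/-- A polynomial with roots among `0, x, y, w`, the last three simple. -/
theorem eq_prod_of_roots {x y w : ℂ} {P P₀ : ℂ[X]} (e : ℕ) (hxy : x ≠ y) (hxw : x ≠ w)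
    (hyw : y ≠ w) (hx0 : x ≠ 0) (hy0 : y ≠ 0) (hw0 : w ≠ 0)
    (h0 : P = X ^ e * P₀) (h0' : P₀.eval 0 ≠ 0)
    (hr : ∀ a, P.eval a = 0 → a = 0 ∨ a = x ∨ a = y ∨ a = w)
    (hx : P.eval x = 0 → ∃ P₁ : ℂ[X], P = (X - C x) * P₁ ∧ P₁.eval x ≠ 0)
    (hy : P.eval y = 0 → ∃ P₁ : ℂ[X], P = (X - C y) * P₁ ∧ P₁.eval y ≠ 0)
    (hw : P.eval w = 0 → ∃ P₁ : ℂ[X], P = (X - C w) * P₁ ∧ P₁.eval w ≠ 0) :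
    ∃ k : ℂ, k ≠ 0 ∧ ∃ i j l : Fin 2,
      P = C k * X ^ e * (X - C x) ^ (i : ℕ) * (X - C y) ^ (j : ℕ) * (X - C w) ^ (l : ℕ) := by
  obtain ⟨i, P₁, h1, h1'⟩ := exists_simple_factor x
    (simple_factor_of_mul h0 hx)
  have e1 : P = X ^ e * (X - C x) ^ (i : ℕ) * P₁ := by rw [h0, h1]; ring
  obtain ⟨j, P₂, h2, h2'⟩ := exists_simple_factor y
    (simple_factor_of_mul e1 hy)
  have e2 : P = X ^ e * (X - C x) ^ (i : ℕ) * (X - C y) ^ (j : ℕ) * P₂ := by rw [e1, h2]; ring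
  obtain ⟨l, P₃, h3, h3'⟩ := exists_simple_factor w
    (simple_factor_of_mul e2 hw)
  have e3 : P = X ^ e * (X - C x) ^ (i : ℕ) * (X - C y) ^ (j : ℕ) * (X - C w) ^ (l : ℕ) * P₃ := by
    rw [e2, h3]; ring
  obtain ⟨k, hk, hk'⟩ := eq_C_of_no_root (P := P₃) (by
    intro a ha
    rcases hr a (by rw [e3, eval_mul, ha, mul_zero]) with rfl | rfl | rfl | rfl
    · rw [h1, h2, h3] at h0'
      simp [ha] at h0'
    · rw [h2, h3] at h1'
      simp [ha] at h1'
    · rw [h3] at h2'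
      simp [ha] at h2'
    · exact h3' ha)
  exact ⟨k, hk, i, j, l, by rw [e3, hk']; ring⟩

/-- A polynomial with roots among `0, x, w`, the last two simple. -/
theorem eq_prod_of_roots' {x w : ℂ} {P P₀ : ℂ[X]} (e : ℕ) (hxw : x ≠ w)
    (hx0 : x ≠ 0) (hw0 : w ≠ 0) (h0 : P = X ^ e * P₀) (h0' : P₀.eval 0 ≠ 0)
    (hr : ∀ a, P.eval a = 0 → a = 0 ∨ a = x ∨ a = w)
    (hx : P.eval x = 0 → ∃ P₁ : ℂ[X], P = (X - C x) * P₁ ∧ P₁.eval x ≠ 0)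
    (hw : P.eval w = 0 → ∃ P₁ : ℂ[X], P = (X - C w) * P₁ ∧ P₁.eval w ≠ 0) :
    ∃ k : ℂ, k ≠ 0 ∧ ∃ i l : Fin 2,
      P = C k * X ^ e * (X - C x) ^ (i : ℕ) * (X - C w) ^ (l : ℕ) := by
  obtain ⟨i, P₁, h1, h1'⟩ := exists_simple_factor x
    (simple_factor_of_mul h0 hx)
  have e1 : P = X ^ e * (X - C x) ^ (i : ℕ) * P₁ := by rw [h0, h1]; ring
  obtain ⟨l, P₃, h3, h3'⟩ := exists_simple_factor w
    (simple_factor_of_mul e1 hw)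
  have e3 : P = X ^ e * (X - C x) ^ (i : ℕ) * (X - C w) ^ (l : ℕ) * P₃ := by
    rw [e1, h3]; ring
  obtain ⟨k, hk, hk'⟩ := eq_C_of_no_root (P := P₃) (by
    intro a ha
    rcases hr a (by rw [e3, eval_mul, ha, mul_zero]) with rfl | rfl | rfl
    · rw [h1, h3] at h0'
      simp [ha] at h0'
    · rw [h3] at h1'
      simp [ha] at h1'
    · exact h3' ha)
  exact ⟨k, hk, i, l, by rw [e3, hk']; ring⟩

theorem natDegree_prod_form {k : ℂ} (hk : k ≠ 0) (x y w : ℂ) (e i j l : ℕ) :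
    (C k * X ^ e * (X - C x) ^ i * (X - C y) ^ j * (X - C w) ^ l).natDegree =
      e + i + j + l := by
  have h1 := X_sub_C_ne_zero x
  have h2 := X_sub_C_ne_zero y
  have h3 := X_sub_C_ne_zero w
  have h4 : (C k : ℂ[X]) ≠ 0 := C_ne_zero.2 hk
  have h5 := X_ne_zero (R := ℂ)
  rw [natDegree_mul, natDegree_mul, natDegree_mul, natDegree_C_mul_X_pow _ _ hk]
  · simp
  all_goals positivity

/-! ### The seven normal forms -/

/-- The polynomial substitution in normalized position. -/
noncomputable def Subcase.polynomial : Subcase → ℂ[X]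
  | harmonic => X * (2 - X)
  | realCubic => (X - 1) ^ 2 * (1 - C (1 / 4) * X)
  | specialHarmonic => 4 * (X * (2 - X) - C (1 / 2)) ^ 2
  | equianharmonic => (1 - C (p equianharmonic)⁻¹ * X) ^ 3
  | quartic => (1 - C (D quartic)⁻¹ * X) * (1 - C (p quartic)⁻¹ * X) ^ 3
  | quintic => C (-Complex.I * (2025 * ((√15 : ℝ) : ℂ) / 64)) * X * (X - 1) *
      (X - C (p quintic)) ^ 3
  | specialEquianharmonic => 4 * ((1 - C (p specialEquianharmonic)⁻¹ * X) ^ 3 - C (1 / 2)) ^ 2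

theorem Subcase.poly_aeval (κ : Subcase) (T : RatFunc ℂ) (L : ℂ[X]) :
    κ.poly (aeval T L) = aeval T (κ.polynomial.comp L) := by
  rw [aeval_comp]
  generalize aeval T L = t
  have h4 : (RatFunc.C (1 / 4) : RatFunc ℂ) = 1 / 4 := by simp [map_ofNat]
  have h2 : (RatFunc.C (1 / 2) : RatFunc ℂ) = 1 / 2 := by simp [map_ofNat]
  cases κ <;>
    simp only [poly, polynomial, map_mul, map_sub, map_pow, map_one, map_ofNat, aeval_X, aeval_C,
      RatFunc.algebraMap_eq_C, h4, h2, map_inv₀, map_neg, map_div₀] <;> ring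

/-- The affine coordinate with `x ↦ 0` and `y ↦ 1`. -/
noncomputable def affine (x y : ℂ) : ℂ[X] := C (y - x)⁻¹ * (X - C x)

/-- `P` is one of the seven substitutions, for the given ordering of the singular points. -/
def IsNormalForm (x y w gx gy gw : ℂ) (P : ℂ[X]) : Prop :=
  ∃ κ : Subcase, κ.ExponentCondition gx gy gw ∧ w - x = κ.D * (y - x) ∧ -x = κ.p * (y - x) ∧
    (P = κ.polynomial.comp (affine x y) ∨ P = 1 - κ.polynomial.comp (affine x y))

/-- `P` is one of the seven substitutions, for some ordering of the singular points. -/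
def HasNormalForm (x y w gx gy gw : ℂ) (P : ℂ[X]) : Prop :=
  IsNormalForm x y w gx gy gw P ∨ IsNormalForm y x w gy gx gw P ∨
  IsNormalForm x w y gx gw gy P ∨ IsNormalForm w x y gw gx gy P ∨
  IsNormalForm y w x gy gw gx P ∨ IsNormalForm w y x gw gy gx P

theorem IsNormalForm.one_sub {x y w gx gy gw : ℂ} {P : ℂ[X]}
    (h : IsNormalForm x y w gx gy gw (1 - P)) : IsNormalForm x y w gx gy gw P := by
  obtain ⟨κ, h1, h2, h3, h4⟩ := h
  refine ⟨κ, h1, h2, h3, h4.symm.imp (fun h => ?_) (fun h => ?_)⟩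
  · exact sub_right_inj.1 h
  · rw [← h, sub_sub_cancel]

namespace HasNormalForm

variable {x y w gx gy gw : ℂ} {P : ℂ[X]}

theorem one_sub (h : HasNormalForm x y w gx gy gw (1 - P)) : HasNormalForm x y w gx gy gw P :=
  h.imp IsNormalForm.one_sub (Or.imp IsNormalForm.one_sub (Or.imp IsNormalForm.one_sub
    (Or.imp IsNormalForm.one_sub (Or.imp IsNormalForm.one_sub IsNormalForm.one_sub))))

theorem swap₁₂ (h : HasNormalForm y x w gy gx gw P) : HasNormalForm x y w gx gy gw P := by
  unfold HasNormalForm at *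
  tauto

theorem swap₂₃ (h : HasNormalForm x w y gx gw gy P) : HasNormalForm x y w gx gy gw P := by
  unfold HasNormalForm at *
  tauto

theorem swap₁₃ (h : HasNormalForm w y x gw gy gx P) : HasNormalForm x y w gx gy gw P := by
  unfold HasNormalForm at *
  tauto

end HasNormalForm

theorem C_two : (C (2 : ℂ) : ℂ[X]) = 2 := rfl

theorem C_three : (C (3 : ℂ) : ℂ[X]) = 3 := rfl

theorem I_sq' : Complex.I ^ 2 = -1 := Complex.I_sq

theorem sqrt_sq_cast {r : ℝ} (hr : 0 ≤ r) : ((√r : ℝ) : ℂ) ^ 2 = (r : ℂ) := by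
  rw [← Complex.ofReal_pow, Real.sq_sqrt hr]

/-- Since `p` is the affine coordinate of the origin, the affine function on the left vanishes at `t
= 0`; it equals `1` at `t = x`. With `h = y - x`, this turns the normalized cubes into powers of the
coordinate centred at the zero of the last coefficient. -/
theorem one_sub_div_p {x h p t : ℂ} (hx : x ≠ 0) (hh : h ≠ 0) (hp : -x = p * h) :
    1 - p⁻¹ * (h⁻¹ * (t - x)) = t / x := by
  have hp0 : p ≠ 0 := by
    rintro rfl
    simp [hx] at hp
  have : x = -(p * h) := by rw [← hp, neg_neg]
  rw [this]
  field_simp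
  ring

namespace NormalPullback

variable {x y w gx gy gw c c' : ℂ} {P : ℂ[X]}

/-! #### Critical zero at a singular point -/

theorem form_harmonic (h : NormalPullback x 0 w gx gy gw c c' P) (hx : x ≠ 0) (hw : w ≠ 0)
    (hxw : x ≠ w) {k : ℂ} (hk : k ≠ 0) (hP : P = C k * X ^ 2) :
    IsNormalForm x 0 w gx gy gw P := by
  have hn : P.natDegree = 2 := by rw [hP, natDegree_C_mul_X_pow _ _ hk]
  have hd : derivative P = C k * (2 * X) := by
    rw [hP, derivative_C_mul, derivative_X_pow, Nat.cast_ofNat, C_two]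
    ring
  have e : C k * ((X - C x) * (X - C w)) = C k * X ^ 2 - 1 := by
    apply mul_left_cancel₀ (mul_ne_zero (mul_ne_zero (C_ne_zero.2 hk) (pow_ne_zero 3 X_ne_zero))
      (show (4 : ℂ[X]) ≠ 0 by norm_num))
    have e := h.quad
    rw [hd, hn, hP, C_0, sub_zero] at e
    have h4 : (C (((2 : ℕ) : ℂ) ^ 2) : ℂ[X]) = 4 := by norm_num; rfl
    rw [h4] at e
    linear_combination e
  -- Coefficients are compared by evaluation, here and in the other normal forms: the combinations
  -- of values of `f` used later are finite differences that isolate a coefficient.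
  have f : ∀ t, k * ((t - x) * (t - w)) = k * t ^ 2 - 1 := fun t => by
    simpa using congrArg (eval t) e
  have hsum : w = -x := by
    have : k * (w + x) = 0 := by linear_combination f 0 - f 1
    linear_combination (mul_eq_zero.1 this).resolve_left hk
  have hkx : k * x ^ 2 = 1 := by linear_combination -f 0 + k * x * hsum
  have h0 : ∀ a, a ≠ 0 → (P.eval a = 0 ∨ P.eval a = 1) → P.eval a = 1 := by
    intro a ha h
    refine h.resolve_left ?_
    rw [hP]
    simp [hk, ha]
  have g1 := h.residue_eq' hx hx hxw (h0 x hx (h.eval_singular hx))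
  have g2 := h.swap₁₃.residue_eq' hw hw hxw.symm (h0 w hw (h.swap₁₃.eval_singular hw))
  refine ⟨.harmonic, g1.trans g2.symm, ?_, ?_, Or.inr ?_⟩
  · simp only [Subcase.D]
    linear_combination hsum
  · simp [Subcase.p]
  · apply Polynomial.funext
    intro t
    rw [hP]
    simp only [Subcase.polynomial, affine, eval_sub, eval_one, eval_comp, eval_mul, eval_X,
      eval_ofNat, eval_C, eval_pow]
    have : k = 1 / x ^ 2 := by field_simp; linear_combination hkx
    rw [this]
    field_simp
    ring

/-- Here `w` lies over `0` and `x` over `1`, whence `gw = c` and `gx = c' = 1/2`. Cancelling common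
factors in the quadratic identity leaves a cubic one, whose coefficients give `w = -3x` and `4kx³ =
1`. -/
theorem form_realCubic (h : NormalPullback x 0 w gx gy gw c c' P) (hx : x ≠ 0) (hw : w ≠ 0)
    (hxw : x ≠ w) (hc : P.natDegree = 3 → c' = 1 / 2) (hy : gy = 2 * c - 1) {k : ℂ} (hk : k ≠ 0)
    (hP : P = C k * X ^ 2 * (X - C w)) : IsNormalForm x 0 w gx gy gw P := by
  have hn : P.natDegree = 3 := by
    have := natDegree_prod_form hk w 0 0 2 1 0 0
    rw [hP]
    simpa using this
  have hd : derivative P = C k * X * (3 * X - 2 * C w) := by rw [hP]; simp; ring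
  have e : C k * ((3 * X - 2 * C w) ^ 2 * (X - C x)) = 9 * (C k * X ^ 2 * (X - C w) - 1) := by
    apply mul_left_cancel₀ (mul_ne_zero (mul_ne_zero (C_ne_zero.2 hk) (pow_ne_zero 3 X_ne_zero))
      (X_sub_C_ne_zero w))
    have e := h.quad
    rw [hd, hn, hP, C_0, sub_zero] at e
    have h4 : (C (((3 : ℕ) : ℂ) ^ 2) : ℂ[X]) = 9 := by norm_num; rfl
    rw [h4] at e
    linear_combination e
  have f : ∀ t, k * ((3 * t - 2 * w) ^ 2 * (t - x)) = 9 * (k * t ^ 2 * (t - w) - 1) := fun t => by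
    simpa using congrArg (eval t) e
  have hsum : w = -3 * x := by
    have : k * (w + 3 * x) = 0 := by linear_combination -(f 1 + f (-1) - 2 * f 0) / 6
    linear_combination (mul_eq_zero.1 this).resolve_left hk
  have hkx : k * (4 * x ^ 3) = 1 := by
    have := f 0
    rw [hsum] at this
    linear_combination -this / 9
  have hPw : P.eval w = 0 := by rw [hP]; simp
  have hPx : P.eval x = 1 := by
    refine (h.eval_singular hx).resolve_left ?_
    rw [hP]
    simp [hk, hx, sub_eq_zero, hxw]
  have g1 := h.residue_eq' hx hx hxw hPx
  have g2 := h.swap₁₃.residue_eq hw hw hxw.symm hPw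
  refine ⟨.realCubic, ⟨?_, g1.trans (hc hn)⟩, ?_, ?_, Or.inl ?_⟩
  · rw [hy, g2]
    ring
  · simp only [Subcase.D]
    linear_combination hsum
  · simp [Subcase.p]
  · apply Polynomial.funext
    intro t
    rw [hP, hsum]
    simp only [Subcase.polynomial, affine, eval_sub, eval_one, eval_comp, eval_mul, eval_X,
      eval_C, eval_pow]
    have : k = 1 / (4 * x ^ 3) := by field_simp; linear_combination hkx
    rw [this]
    field_simp
    ring

/-- The points `x` and `w` both lie over `0`, so after cancellation `P - 1` is a constant times a
square; this forces `w = -x` and `kx⁴ = -4`. -/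
theorem form_specialHarmonic (h : NormalPullback x 0 w gx gy gw c c' P) (hx : x ≠ 0)
    (hw : w ≠ 0) (hxw : x ≠ w) (hy : gy = 2 * c - 1) {k : ℂ} (hk : k ≠ 0)
    (hP : P = C k * X ^ 2 * (X - C x) * (X - C w)) : IsNormalForm x 0 w gx gy gw P := by
  have hn : P.natDegree = 4 := by
    have := natDegree_prod_form hk x w 0 2 1 1 0
    rw [hP]
    simpa using this
  have hd : derivative P = C k * X * (4 * X ^ 2 - 3 * (C x + C w) * X + 2 * C x * C w) := by
    rw [hP]; simp; ring
  have e : C k * (4 * X ^ 2 - 3 * (C x + C w) * X + 2 * C x * C w) ^ 2 =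
      16 * (C k * X ^ 2 * (X - C x) * (X - C w) - 1) := by
    apply mul_left_cancel₀ (mul_ne_zero (mul_ne_zero (mul_ne_zero (C_ne_zero.2 hk)
      (pow_ne_zero 3 X_ne_zero)) (X_sub_C_ne_zero w)) (X_sub_C_ne_zero x))
    have e := h.quad
    rw [hd, hn, hP, C_0, sub_zero] at e
    have h4 : (C (((4 : ℕ) : ℂ) ^ 2) : ℂ[X]) = 16 := by norm_num; rfl
    rw [h4] at e
    linear_combination e
  have f : ∀ t, k * (4 * t ^ 2 - 3 * (x + w) * t + 2 * x * w) ^ 2 =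
      16 * (k * t ^ 2 * (t - x) * (t - w) - 1) := fun t => by
    simpa using congrArg (eval t) e
  have hsum : w = -x := by
    have : k * (w + x) = 0 := by
      linear_combination -((f 2 - f (-2)) - 2 * (f 1 - f (-1))) / 96
    linear_combination (mul_eq_zero.1 this).resolve_left hk
  have hkx : k * x ^ 4 = -4 := by
    have := f 0
    rw [hsum] at this
    linear_combination this / 4
  have hPw : P.eval w = 0 := by rw [hP]; simp
  have hPx : P.eval x = 0 := by rw [hP]; simp
  have g1 := h.residue_eq hx hx hxw hPx
  have g2 := h.swap₁₃.residue_eq hw hw hxw.symm hPw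
  refine ⟨.specialHarmonic, ⟨g1.trans g2.symm, ?_⟩, ?_, ?_, Or.inr ?_⟩
  · rw [hy, g1]
    ring
  · simp only [Subcase.D]
    linear_combination hsum
  · simp [Subcase.p]
  · apply Polynomial.funext
    intro t
    rw [hP, hsum]
    simp only [Subcase.polynomial, affine, eval_sub, eval_one, eval_comp, eval_mul, eval_X,
      eval_ofNat, eval_C, eval_pow]
    have : k = -4 / x ^ 4 := by field_simp; linear_combination hkx
    rw [this]
    field_simp
    ring

/-! #### Critical zero at a nonsingular point -/

/-- The quadratic identity becomes `k (X - x)(X - y)(X - w) = kX³ - 1`: the singular points are the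
three cube roots of `1/k`, all lying over `1`, and have equal residues. -/
theorem form_equianharmonic (h : NormalPullback x y w gx gy gw c c' P) (hx : x ≠ 0) (hy : y ≠ 0)
    (hw : w ≠ 0) (hxy : x ≠ y) (hxw : x ≠ w) (hyw : y ≠ w) {k : ℂ} (hk : k ≠ 0)
    (hP : P = C k * X ^ 3) : HasNormalForm x y w gx gy gw P := by
  have hn : P.natDegree = 3 := by rw [hP, natDegree_C_mul_X_pow _ _ hk]
  have hd : derivative P = C k * (3 * X ^ 2) := by
    rw [hP, derivative_C_mul, derivative_X_pow, Nat.cast_ofNat, C_three]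
  have e : C k * ((X - C x) * (X - C y) * (X - C w)) = C k * X ^ 3 - 1 := by
    apply mul_left_cancel₀ (mul_ne_zero (mul_ne_zero (C_ne_zero.2 hk) (pow_ne_zero 4 X_ne_zero))
      (show (9 : ℂ[X]) ≠ 0 by norm_num))
    have e := h.quad
    rw [hd, hn, hP] at e
    have h4 : (C (((3 : ℕ) : ℂ) ^ 2) : ℂ[X]) = 9 := by norm_num; rfl
    rw [h4] at e
    linear_combination e
  have f : ∀ t, k * ((t - x) * (t - y) * (t - w)) = k * t ^ 3 - 1 := fun t => by
    simpa using congrArg (eval t) e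
  have s1 : x + y + w = 0 := by
    have : k * (x + y + w) = 0 := by linear_combination -(f 1 + f (-1) - 2 * f 0) / 2
    exact (mul_eq_zero.1 this).resolve_left hk
  have s2 : x * y + y * w + x * w = 0 := by
    have : k * (x * y + y * w + x * w) = 0 := by linear_combination (f 1 - f (-1)) / 2
    exact (mul_eq_zero.1 this).resolve_left hk
  have h0 : ∀ a, a ≠ 0 → (P.eval a = 0 ∨ P.eval a = 1) → P.eval a = 1 := by
    intro a ha h
    refine h.resolve_left ?_
    rw [hP]
    simp [hk, ha]
  have g1 := h.residue_eq' hx hxy hxw (h0 x hx (h.eval_singular hx))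
  have g2 := h.swap₁₂.residue_eq' hy hxy.symm hyw (h0 y hy (h.swap₁₂.eval_singular hy))
  have g3 := h.swap₁₃.residue_eq' hw hyw.symm hxw.symm (h0 w hw (h.swap₁₃.eval_singular hw))
  have kx : ∀ a, P.eval a = 1 → k * a ^ 3 = 1 := by
    intro a ha
    rw [hP] at ha
    simpa using ha
  -- Symmetric functions determine only the square of `w / (y - x)`. The other square root
  -- corresponds to exchanging `x` and `y`, so this is proved for variable `x, y` and used in both
  -- orders.
  have main : ∀ x y gx gy : ℂ, x ≠ 0 → x ≠ y → P.eval x = 1 → gx = c' → gy = c' →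
      x + y + w = 0 → 3 * w = Complex.I * ((√3 : ℝ) : ℂ) * (y - x) →
      IsNormalForm x y w gx gy gw P := by
    intro x y gx gy hx hxy hPx g1 g2 s1 hω
    have hp : -x = Subcase.equianharmonic.p * (y - x) := by
      simp only [Subcase.p]
      linear_combination hω / 6 - s1 / 2
    refine ⟨.equianharmonic, ⟨g1.trans g2.symm, g2.trans g3.symm⟩, ?_, hp, Or.inl ?_⟩
    · simp only [Subcase.D]
      linear_combination hω / 2 - s1 / 2
    · apply Polynomial.funext
      intro t
      simp only [Subcase.polynomial, affine, eval_sub, eval_one, eval_comp, eval_mul, eval_X,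
        eval_C, eval_pow, one_sub_div_p hx (sub_ne_zero.2 hxy.symm) hp]
      have := kx x hPx
      rw [hP]
      simp only [eval_mul, eval_C, eval_pow, eval_X]
      field_simp
      linear_combination t ^ 3 * this
  have hsq : (3 * w) ^ 2 = (Complex.I * ((√3 : ℝ) : ℂ) * (y - x)) ^ 2 := by
    rw [mul_pow (Complex.I * _), mul_pow Complex.I, I_sq', sqrt_sq_cast (by norm_num)]
    push_cast
    linear_combination 3 * (x + y + 3 * w) * s1 - 12 * s2
  rcases sq_eq_sq_iff_eq_or_eq_neg.1 hsq with hω | hω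
  · exact Or.inl (main x y gx gy hx hxy (h0 x hx (h.eval_singular hx)) g1 g2 s1 hω)
  · exact Or.inr (Or.inl (main y x gy gx hy hxy.symm (h0 y hy (h.swap₁₂.eval_singular hy)) g2 g1
      (by linear_combination s1) (by linear_combination hω)))

/-- Here `w` lies over `0` with residue `2/3`, and `x, y` over `1` with residue `1/2`. The cubic and
quadratic coefficients determine `x + y` and `xy` in terms of `w`. -/
theorem form_quartic (h : NormalPullback x y w gx gy gw c c' P) (hx : x ≠ 0) (hy : y ≠ 0)
    (hw : w ≠ 0) (hxy : x ≠ y) (hxw : x ≠ w) (hyw : y ≠ w) (hc : c = 2 / 3)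
    (hc' : 4 ≤ P.natDegree → c' = 1 / 2) {k : ℂ} (hk : k ≠ 0)
    (hP : P = C k * X ^ 3 * (X - C w)) : HasNormalForm x y w gx gy gw P := by
  have hn : P.natDegree = 4 := by
    have := natDegree_prod_form hk w 0 0 3 1 0 0
    rw [hP]
    simpa using this
  have hd : derivative P = C k * X ^ 2 * (4 * X - 3 * C w) := by rw [hP]; simp [C_two]; ring
  have e : C k * ((4 * X - 3 * C w) ^ 2 * ((X - C x) * (X - C y))) =
      16 * (C k * X ^ 3 * (X - C w) - 1) := by
    apply mul_left_cancel₀ (mul_ne_zero (mul_ne_zero (C_ne_zero.2 hk) (pow_ne_zero 4 X_ne_zero))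
      (X_sub_C_ne_zero w))
    have e := h.quad
    rw [hd, hn, hP] at e
    have h4 : (C (((4 : ℕ) : ℂ) ^ 2) : ℂ[X]) = 16 := by norm_num; rfl
    rw [h4] at e
    linear_combination e
  have f : ∀ t, k * ((4 * t - 3 * w) ^ 2 * ((t - x) * (t - y))) =
      16 * (k * t ^ 3 * (t - w) - 1) := fun t => by
    simpa using congrArg (eval t) e
  have s1 : x + y = -w / 2 := by
    have : k * (x + y + w / 2) = 0 := by
      linear_combination -((f 2 - f (-2)) - 2 * (f 1 - f (-1))) / 192
    linear_combination (mul_eq_zero.1 this).resolve_left hk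
  have s2 : x * y = 3 * w ^ 2 / 16 := by
    have : k * (16 * (x * y) + 24 * w * (x + y) + 9 * w ^ 2) = 0 := by
      linear_combination (16 * (f 1 + f (-1) - 2 * f 0) - (f 2 + f (-2) - 2 * f 0)) / 24
    have := (mul_eq_zero.1 this).resolve_left hk
    linear_combination this / 16 - 3 / 2 * w * s1
  have hPw : P.eval w = 0 := by rw [hP]; simp
  have h0 : ∀ a, a ≠ 0 → a ≠ w → (P.eval a = 0 ∨ P.eval a = 1) → P.eval a = 1 := by
    intro a ha ha' h
    refine h.resolve_left ?_
    rw [hP]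
    simp [hk, ha, sub_eq_zero, ha']
  have hPx := h0 x hx hxw (h.eval_singular hx)
  have hPy := h0 y hy hyw (h.swap₁₂.eval_singular hy)
  have g1 := h.residue_eq' hx hxy hxw hPx
  have g2 := h.swap₁₂.residue_eq' hy hxy.symm hyw hPy
  have g3 := h.swap₁₃.residue_eq hw hyw.symm hxw.symm hPw
  rw [hc' hn.ge] at g1 g2
  rw [hc] at g3
  have main : ∀ x y gx gy : ℂ, x ≠ 0 → x ≠ y → x ≠ w → P.eval x = 1 → gx = 1 / 2 → gy = 1 / 2 →
      x + y = -w / 2 → w = Complex.I * ((√2 : ℝ) : ℂ) * (y - x) →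
      IsNormalForm x y w gx gy gw P := by
    intro x y gx gy hx hxy hxw hPx g1 g2 s1 hω
    have hp : -x = Subcase.quartic.p * (y - x) := by
      simp only [Subcase.p]
      linear_combination hω / 4 - s1 / 2
    have hD : w - x = Subcase.quartic.D * (y - x) := by
      simp only [Subcase.D]
      linear_combination 5 / 4 * hω - s1 / 2
    refine ⟨.quartic, ⟨g3, g1, g2⟩, hD, hp, Or.inl ?_⟩
    apply Polynomial.funext
    intro t
    simp only [Subcase.polynomial, affine, eval_sub, eval_one, eval_comp, eval_mul, eval_X,
      eval_C, eval_pow, one_sub_div_p hx (sub_ne_zero.2 hxy.symm) hp]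
    have hwx := sub_ne_zero.2 hxw.symm
    have hyx := sub_ne_zero.2 hxy.symm
    have hDe : Subcase.quartic.D = (w - x) / (y - x) := by rw [hD, mul_div_cancel_right₀ _ hyx]
    rw [hDe]
    rw [hP] at hPx ⊢
    simp only [eval_mul, eval_C, eval_pow, eval_X, eval_sub] at hPx ⊢
    field_simp
    linear_combination (-(t ^ 3 * (t - w))) * hPx
  have hsq : w ^ 2 = (Complex.I * ((√2 : ℝ) : ℂ) * (y - x)) ^ 2 := by
    rw [mul_pow (Complex.I * _), mul_pow Complex.I, I_sq', sqrt_sq_cast (by norm_num)]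
    push_cast
    linear_combination 2 * (x + y - w / 2) * s1 - 8 * s2
  rcases sq_eq_sq_iff_eq_or_eq_neg.1 hsq with hω | hω
  · exact Or.inl (main x y gx gy hx hxy hxw hPx g1 g2 s1 hω)
  · exact Or.inr (Or.inl (main y x gy gx hy hxy.symm hyw hPy g2 g1
      (by linear_combination s1) (by linear_combination hω)))

/-- The roles are reversed compared with the quartic: `x, y` lie over `0` and `w` over `1`. Besides
`x + y` and `xy`, the leading coefficient is needed, and it comes from the constant term. -/
theorem form_quintic (h : NormalPullback x y w gx gy gw c c' P) (hx : x ≠ 0) (hy : y ≠ 0)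
    (hw : w ≠ 0) (hxy : x ≠ y) (hxw : x ≠ w) (hyw : y ≠ w) (hc : c = 2 / 3)
    (hc' : 4 ≤ P.natDegree → c' = 1 / 2) {k : ℂ} (hk : k ≠ 0)
    (hP : P = C k * X ^ 3 * (X - C x) * (X - C y)) : HasNormalForm x y w gx gy gw P := by
  have hn : P.natDegree = 5 := by
    have := natDegree_prod_form hk x y 0 3 1 1 0
    rw [hP]
    simpa using this
  have hd : derivative P = C k * X ^ 2 * (5 * X ^ 2 - 4 * (C x + C y) * X + 3 * C x * C y) := by
    rw [hP]; simp [C_two]; ring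
  have e : C k * ((5 * X ^ 2 - 4 * (C x + C y) * X + 3 * C x * C y) ^ 2 * (X - C w)) =
      25 * (C k * X ^ 3 * (X - C x) * (X - C y) - 1) := by
    apply mul_left_cancel₀ (mul_ne_zero (mul_ne_zero (mul_ne_zero (C_ne_zero.2 hk)
      (pow_ne_zero 4 X_ne_zero)) (X_sub_C_ne_zero x)) (X_sub_C_ne_zero y))
    have e := h.quad
    rw [hd, hn, hP] at e
    have h4 : (C (((5 : ℕ) : ℂ) ^ 2) : ℂ[X]) = 25 := by norm_num; rfl
    rw [h4] at e
    linear_combination e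
  have f : ∀ t, k * ((5 * t ^ 2 - 4 * (x + y) * t + 3 * x * y) ^ 2 * (t - w)) =
      25 * (k * t ^ 3 * (t - x) * (t - y) - 1) := fun t => by
    simpa using congrArg (eval t) e
  have s1 : x + y = -5 * w / 3 := by
    have : k * (3 * (x + y) + 5 * w) = 0 := by
      linear_combination -((f 2 + f (-2) - 2 * f 0) - 4 * (f 1 + f (-1) - 2 * f 0)) / 120
    linear_combination (mul_eq_zero.1 this).resolve_left hk / 3
  have s2 : x * y = 40 * w ^ 2 / 9 := by
    have : k * (16 * (x + y) ^ 2 + 30 * (x * y) + 40 * (x + y) * w - 25 * (x * y)) = 0 := by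
      linear_combination ((f 2 - f (-2)) - 2 * (f 1 - f (-1))) / 12
    have := (mul_eq_zero.1 this).resolve_left hk
    rw [s1] at this
    linear_combination this / 5
  have s3 : 64 * k * w ^ 5 = 9 := by
    have := f 0
    have h2 : (x * y) ^ 2 = (40 * w ^ 2 / 9) ^ 2 := by rw [s2]
    linear_combination -9 / 25 * this - 81 / 25 * k * w * h2
  have hPx : P.eval x = 0 := by rw [hP]; simp
  have hPy : P.eval y = 0 := by rw [hP]; simp
  have hPw : P.eval w = 1 := by
    refine (h.swap₁₃.eval_singular hw).resolve_left ?_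
    rw [hP]
    simp [hk, hw, sub_eq_zero, hxw.symm, hyw.symm]
  have g1 := h.residue_eq hx hxy hxw hPx
  have g2 := h.swap₁₂.residue_eq hy hxy.symm hyw hPy
  have g3 := h.swap₁₃.residue_eq' hw hyw.symm hxw.symm hPw
  rw [hc' (by omega)] at g3
  rw [hc] at g1 g2
  have h15 : ((√15 : ℝ) : ℂ) ^ 2 = 15 := by
    rw [sqrt_sq_cast (by norm_num)]
    norm_num
  have main : ∀ x y gx gy : ℂ, x ≠ 0 → x ≠ y → P = C k * X ^ 3 * (X - C x) * (X - C y) →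
      gx = 2 / 3 → gy = 2 / 3 →
      x + y = -5 * w / 3 → 15 * w = Complex.I * ((√15 : ℝ) : ℂ) * (y - x) →
      IsNormalForm x y w gx gy gw P := by
    intro x y gx gy hx hxy hP g1 g2 s1 hω
    have hp : -x = Subcase.quintic.p * (y - x) := by
      simp only [Subcase.p]
      linear_combination hω / 18 - s1 / 2
    have hyx := sub_ne_zero.2 hxy.symm
    refine ⟨.quintic, ⟨g3, g1, g2⟩, ?_, hp, Or.inl ?_⟩
    · simp only [Subcase.D]
      linear_combination 11 / 90 * hω - s1 / 2
    · have hpe : Subcase.quintic.p = -x / (y - x) := by rw [hp, mul_div_cancel_right₀ _ hyx]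
      -- Rescaling by `y - x` multiplies the leading coefficient of the quintic by `(y - x)⁵`; with
      -- `y - x = -i √15 w` and `64 k w⁵ = 9` this is the stated constant.
      have hk5 : k * (y - x) ^ 5 = -Complex.I * (2025 * ((√15 : ℝ) : ℂ) / 64) := by
        have hw2 : 15 * w ^ 2 = - (y - x) ^ 2 := by
          have : (15 * w) ^ 2 = (Complex.I * ((√15 : ℝ) : ℂ) * (y - x)) ^ 2 := by rw [hω]
          rw [mul_pow (Complex.I * _), mul_pow Complex.I, I_sq', h15] at this
          linear_combination this / 15
        have hyxw : y - x = - Complex.I * ((√15 : ℝ) : ℂ) * w := by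
          have : Complex.I * ((√15 : ℝ) : ℂ) * (15 * w) = -15 * (y - x) := by
            rw [hω]
            linear_combination ((√15 : ℝ) : ℂ) ^ 2 * (y - x) * I_sq' - (y - x) * h15
          linear_combination this / 15
        calc k * (y - x) ^ 5 = k * ((y - x) ^ 2) ^ 2 * (y - x) := by ring
          _ = k * (-15 * w ^ 2) ^ 2 * (- Complex.I * ((√15 : ℝ) : ℂ) * w) := by
            rw [← hyxw]
            rw [show (y - x) ^ 2 = -15 * w ^ 2 by linear_combination hw2]
          _ = _ := by linear_combination (-Complex.I * ((√15 : ℝ) : ℂ) * 225 / 64) * s3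
      apply Polynomial.funext
      intro t
      simp only [Subcase.polynomial, affine, eval_sub, eval_one, eval_comp, eval_mul, eval_X,
        eval_C, eval_pow]
      rw [hpe, ← hk5, hP]
      simp only [eval_mul, eval_C, eval_pow, eval_X, eval_sub]
      field_simp
      ring
  have hsq : (15 * w) ^ 2 = (Complex.I * ((√15 : ℝ) : ℂ) * (y - x)) ^ 2 := by
    rw [mul_pow (Complex.I * _), mul_pow Complex.I, I_sq', h15]
    linear_combination 15 * (x + y - 5 * w / 3) * s1 - 60 * s2
  rcases sq_eq_sq_iff_eq_or_eq_neg.1 hsq with hω | hω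
  · exact Or.inl (main x y gx gy hx hxy hP g1 g2 s1 hω)
  · exact Or.inr (Or.inl (main y x gy gx hy hxy.symm (by rw [hP]; ring) g2 g1
      (by linear_combination s1) (by linear_combination hω)))

/-- All three singular points lie over `0`, so `P - 1` is a constant times the square of a cubic.
The first two elementary symmetric functions of `x, y, w` vanish, as in the equianharmonic cubic. -/
theorem form_specialEquianharmonic (h : NormalPullback x y w gx gy gw c c' P) (hx : x ≠ 0)
    (hy : y ≠ 0) (hw : w ≠ 0) (hxy : x ≠ y) (hxw : x ≠ w) (hyw : y ≠ w) (hc : c = 2 / 3)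
    {k : ℂ} (hk : k ≠ 0) (hP : P = C k * X ^ 3 * (X - C x) * (X - C y) * (X - C w)) :
    HasNormalForm x y w gx gy gw P := by
  have hn : P.natDegree = 6 := by
    have := natDegree_prod_form hk x y w 3 1 1 1
    rw [hP]
    simpa using this
  have hd : derivative P = C k * X ^ 2 * (6 * X ^ 3 - 5 * (C x + C y + C w) * X ^ 2 +
      4 * (C x * C y + C y * C w + C x * C w) * X - 3 * (C x * C y * C w)) := by
    rw [hP]; simp [C_two]; ring
  have e : C k * (6 * X ^ 3 - 5 * (C x + C y + C w) * X ^ 2 +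
      4 * (C x * C y + C y * C w + C x * C w) * X - 3 * (C x * C y * C w)) ^ 2 =
      36 * (C k * X ^ 3 * (X - C x) * (X - C y) * (X - C w) - 1) := by
    apply mul_left_cancel₀ (mul_ne_zero (mul_ne_zero (mul_ne_zero (mul_ne_zero (C_ne_zero.2 hk)
      (pow_ne_zero 4 X_ne_zero)) (X_sub_C_ne_zero x)) (X_sub_C_ne_zero y)) (X_sub_C_ne_zero w))
    have e := h.quad
    rw [hd, hn, hP] at e
    have h4 : (C (((6 : ℕ) : ℂ) ^ 2) : ℂ[X]) = 36 := by norm_num; rfl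
    rw [h4] at e
    linear_combination e
  have f : ∀ t, k * (6 * t ^ 3 - 5 * (x + y + w) * t ^ 2 +
      4 * (x * y + y * w + x * w) * t - 3 * (x * y * w)) ^ 2 =
      36 * (k * t ^ 3 * (t - x) * (t - y) * (t - w) - 1) := fun t => by
    simpa using congrArg (eval t) e
  have s1 : x + y + w = 0 := by
    have : k * (x + y + w) = 0 := by
      -- The odd differences with weights `5, -4, 1` annihilate the linear and cubic coefficients
      -- and isolate that of `t⁵`.
      linear_combination -(5 * (f 1 - f (-1)) - 4 * (f 2 - f (-2)) + (f 3 - f (-3))) / 5760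
    exact (mul_eq_zero.1 this).resolve_left hk
  have s2 : x * y + y * w + x * w = 0 := by
    have : k * (12 * (x * y + y * w + x * w) + 25 * (x + y + w) ^ 2) = 0 := by
      linear_combination ((f 2 + f (-2) - 2 * f 0) - 4 * (f 1 + f (-1) - 2 * f 0)) / 24
    have := (mul_eq_zero.1 this).resolve_left hk
    rw [s1] at this
    linear_combination this / 12
  have s3 : k * (x * y * w) ^ 2 = -4 := by linear_combination f 0 / 9
  have g1 := h.residue_eq hx hxy hxw (by rw [hP]; simp)
  have g2 := h.swap₁₂.residue_eq hy hxy.symm hyw (by rw [hP]; simp)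
  have g3 := h.swap₁₃.residue_eq hw hyw.symm hxw.symm (by rw [hP]; simp)
  rw [hc] at g1 g2 g3
  have main : ∀ x y gx gy : ℂ, x ≠ 0 → x ≠ y → k * (x * y * w) ^ 2 = -4 →
      P = C k * X ^ 3 * (X - C x) * (X - C y) * (X - C w) → gx = 2 / 3 → gy = 2 / 3 →
      x + y + w = 0 → x * y + y * w + x * w = 0 →
      3 * w = Complex.I * ((√3 : ℝ) : ℂ) * (y - x) →
      IsNormalForm x y w gx gy gw P := by
    intro x y gx gy hx hxy s3 hP g1 g2 s1 s2 hω
    have hp : -x = Subcase.specialEquianharmonic.p * (y - x) := by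
      simp only [Subcase.p]
      linear_combination hω / 6 - s1 / 2
    refine ⟨.specialEquianharmonic, ⟨g1, g2, g3⟩, ?_, hp, Or.inr ?_⟩
    · simp only [Subcase.D]
      linear_combination hω / 2 - s1 / 2
    · apply Polynomial.funext
      intro t
      simp only [Subcase.polynomial, affine, eval_sub, eval_one, eval_comp, eval_mul, eval_X,
        eval_C, eval_pow, eval_ofNat, one_sub_div_p hx (sub_ne_zero.2 hxy.symm) hp]
      have hxyw : x * y * w = x ^ 3 := by linear_combination x * s2 - x ^ 2 * s1
      rw [hxyw] at s3
      have hk6 : k = -4 / x ^ 6 := by field_simp; linear_combination s3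
      have ht : (t - x) * (t - y) * (t - w) = t ^ 3 - x ^ 3 := by
        linear_combination -t ^ 2 * s1 + t * s2 - hxyw
      rw [hP]
      simp only [eval_mul, eval_C, eval_pow, eval_X, eval_sub]
      rw [mul_assoc (k * t ^ 3), mul_assoc (k * t ^ 3), ht, hk6]
      field_simp
      ring
  have hsq : (3 * w) ^ 2 = (Complex.I * ((√3 : ℝ) : ℂ) * (y - x)) ^ 2 := by
    rw [mul_pow (Complex.I * _), mul_pow Complex.I, I_sq', sqrt_sq_cast (by norm_num)]
    push_cast
    linear_combination 3 * (x + y + 3 * w) * s1 - 12 * s2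
  rcases sq_eq_sq_iff_eq_or_eq_neg.1 hsq with hω | hω
  · exact Or.inl (main x y gx gy hx hxy s3 hP g1 g2 s1 s2 hω)
  · exact Or.inr (Or.inl (main y x gy gx hy hxy.symm (by linear_combination s3)
      (by rw [hP]; ring) g2 g1
      (by linear_combination s1) (by linear_combination s2) (by linear_combination hω)))

end NormalPullback

namespace NormalPullback

variable {x y w gx gy gw c c' : ℂ} {P : ℂ[X]}

/-! ### Classification -/

/-- Otherwise `eq_of_root` applies to `1 - P`, which does not vanish at the origin: its zeros would
be simple and among `x, y, w`, so its degree would be at most `3`. -/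
theorem exponent_eq_half (h : NormalPullback x y w gx gy gw c c' P) (hx : x ≠ 0) (hy : y ≠ 0)
    (hw : w ≠ 0) (hxy : x ≠ y) (hxw : x ≠ w) (hyw : y ≠ w) (h0 : P.eval 0 = 0)
    (hn : 4 ≤ P.natDegree) : c' = 1 / 2 := by
  by_contra hc
  have hc' : 2 * c' - 1 ≠ 0 := fun h1 => hc (by linear_combination h1 / 2)
  have h' := h.one_sub
  obtain ⟨k, hk, i, j, l, hP⟩ := eq_prod_of_roots 0 hxy hxw hyw hx hy hw
    (P := 1 - P) (P₀ := 1 - P) (by simp) (by simp [h0]) (fun a => h'.eq_of_root hc')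
    (h'.simple_root hx) (h'.swap₁₂.simple_root hy) (h'.swap₁₃.simple_root hw)
  have hd : (1 - P).natDegree = P.natDegree := by
    rw [← natDegree_neg, neg_sub, ← C_1, natDegree_sub_C]
  rw [hP, natDegree_prod_form hk] at hd
  have := i.2
  have := j.2
  have := l.2
  omega

theorem exponent_eq_half' (h : NormalPullback x 0 w gx gy gw c c' P) (hx : x ≠ 0)
    (hw : w ≠ 0) (hxw : x ≠ w) (h0 : P.eval 0 = 0) (hn : 3 ≤ P.natDegree) : c' = 1 / 2 := by
  by_contra hc
  have hc' : 2 * c' - 1 ≠ 0 := fun h1 => hc (by linear_combination h1 / 2)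
  have h' := h.one_sub
  obtain ⟨k, hk, i, l, hP⟩ := eq_prod_of_roots' 0 hxw hx hw
    (P := 1 - P) (P₀ := 1 - P) (by simp) (by simp [h0])
    (fun a ha => by have := h'.eq_of_root hc' ha; tauto)
    (h'.simple_root hx) (h'.swap₁₃.simple_root hw)
  have hd : (1 - P).natDegree = P.natDegree := by
    rw [← natDegree_neg, neg_sub, ← C_1, natDegree_sub_C]
  have := natDegree_prod_form hk x w 0 0 i l 0
  rw [pow_zero (X - C 0), mul_one, ← hP, hd] at this
  have := i.2
  have := l.2
  omega

/-- The triple zero gives `c = 2/3`, so `2c - 1 ≠ 0` and all zeros of `P` are located. The eight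
subsets of `x, y, w` lying over `0` fall into four types by cardinality. -/
theorem hasNormalForm_of_root (h : NormalPullback x y w gx gy gw c c' P) (hx : x ≠ 0)
    (hy : y ≠ 0) (hw : w ≠ 0) (hxy : x ≠ y) (hxw : x ≠ w) (hyw : y ≠ w) (h0 : P.eval 0 = 0) :
    HasNormalForm x y w gx gy gw P := by
  obtain ⟨hc, P₀, hP₀, h0'⟩ := h.triple_root hx hy hw h0
  have hc' := h.exponent_eq_half hx hy hw hxy hxw hyw h0
  obtain ⟨k, hk, i, j, l, hP⟩ := eq_prod_of_roots 3 hxy hxw hyw hx hy hw hP₀ h0'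
    (fun a => h.eq_of_root (by rw [hc]; norm_num))
    (h.simple_root hx) (h.swap₁₂.simple_root hy) (h.swap₁₃.simple_root hw)
  fin_cases i <;> fin_cases j <;> fin_cases l <;>
    simp only [pow_zero, pow_one, mul_one] at hP
  · exact h.form_equianharmonic hx hy hw hxy hxw hyw hk hP
  · exact h.form_quartic hx hy hw hxy hxw hyw hc hc' hk hP
  · exact .swap₂₃ (h.swap₂₃.form_quartic hx hw hy hxw hxy hyw.symm hc hc' hk hP)
  · exact .swap₁₃ (h.swap₁₃.form_quintic hw hy hx hyw.symm hxw.symm hxy.symm hc hc' hk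
      (by rw [hP]; ring))
  · exact .swap₁₃ (h.swap₁₃.form_quartic hw hy hx hyw.symm hxw.symm hxy.symm hc hc' hk hP)
  · exact .swap₂₃ (h.swap₂₃.form_quintic hx hw hy hxw hxy hyw.symm hc hc' hk hP)
  · exact h.form_quintic hx hy hw hxy hxw hyw hc hc' hk hP
  · exact h.form_specialEquianharmonic hx hy hw hxy hxw hyw hc hk hP

/-- At the double zero `2c - 1 = gy ≠ 0`, which locates all zeros of `P`. The four subsets of `x, w`
lying over `0` give three types. -/
theorem hasNormalForm_of_root' (h : NormalPullback x 0 w gx gy gw c c' P) (hx : x ≠ 0)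
    (hw : w ≠ 0) (hxw : x ≠ w) (hg : gy ≠ 0) (h0 : P.eval 0 = 0) :
    HasNormalForm x 0 w gx gy gw P := by
  obtain ⟨hc, P₀, hP₀, h0'⟩ := h.double_root hx hw h0
  have hc' := h.exponent_eq_half' hx hw hxw h0
  obtain ⟨k, hk, i, l, hP⟩ := eq_prod_of_roots' 2 hxw hx hw hP₀ h0'
    (fun a ha => by have := h.eq_of_root (hc ▸ hg) ha; tauto)
    (h.simple_root hx) (h.swap₁₃.simple_root hw)
  fin_cases i <;> fin_cases l <;>
    simp only [pow_zero, pow_one, mul_one] at hP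
  · exact Or.inl (h.form_harmonic hx hw hxw hk hP)
  · exact Or.inl (h.form_realCubic hx hw hxw (fun hn => hc' hn.ge) hc hk hP)
  · exact .swap₁₃ (Or.inl (h.swap₁₃.form_realCubic hw hx hxw.symm (fun hn => hc' hn.ge) hc hk hP))
  · exact Or.inl (h.form_specialHarmonic hx hw hxw hc hk hP)

theorem hasNormalForm_of_eq (h : NormalPullback x 0 w gx gy gw c c' P) (hx : x ≠ 0)
    (hw : w ≠ 0) (hxw : x ≠ w) (hg : gy ≠ 0) : HasNormalForm x 0 w gx gy gw P := by
  rcases h.eval_zero_of_eq hx hw hg with h0 | h0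
  · exact h.hasNormalForm_of_root' hx hw hxw hg h0
  · exact .one_sub (h.one_sub.hasNormalForm_of_root' hx hw hxw hg (by simp [h0]))

theorem hasNormalForm (h : NormalPullback x y w gx gy gw c c' P) (hxy : x ≠ y) (hxw : x ≠ w)
    (hyw : y ≠ w) (hgx : x = 0 → gx ≠ 0) (hgy : y = 0 → gy ≠ 0) (hgw : w = 0 → gw ≠ 0) :
    HasNormalForm x y w gx gy gw P := by
  by_cases hx : x = 0
  · subst hx
    exact .swap₁₂ (h.swap₁₂.hasNormalForm_of_eq hxy.symm hxw.symm hyw (hgx rfl))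
  by_cases hy : y = 0
  · subst hy
    exact h.hasNormalForm_of_eq hx hyw.symm hxw (hgy rfl)
  by_cases hw : w = 0
  · subst hw
    exact .swap₂₃ (h.swap₂₃.hasNormalForm_of_eq hx hy hxy (hgw rfl))
  rcases h.eval_zero_of_ne hx hy hw with h0 | h0
  · exact h.hasNormalForm_of_root hx hy hw hxy hxw hyw h0
  · exact .one_sub (h.one_sub.hasNormalForm_of_root hx hy hw hxy hxw hyw (by simp [h0]))

end NormalPullback

/-! ### The seven substitutions are pull-backs -/

theorem p_equianharmonic_sq : Subcase.equianharmonic.p ^ 2 - Subcase.equianharmonic.p =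
    -(1 / 3) := by
  have h3 : ((√3 : ℝ) : ℂ) ^ 2 = 3 := by
    rw [sqrt_sq_cast (by norm_num)]
    norm_num
  simp only [Subcase.p]
  linear_combination ((√3 : ℝ) : ℂ) ^ 2 / 36 * I_sq' - h3 / 36

/-- This is `x + y + w = 0`, read in the coordinate in which `x, y, w` and the origin are `0, 1, D,
p`. The linear relations for the quartic and the quintic arise likewise from `x + y = -w/2` and `x +
y = -5w/3`. -/
theorem D_equianharmonic_eq :
    Subcase.equianharmonic.D = 3 * Subcase.equianharmonic.p - 1 := by
  simp only [Subcase.p, Subcase.D]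
  ring

theorem p_quartic_sq : Subcase.quartic.p ^ 2 - Subcase.quartic.p = -(3 / 8) := by
  have h3 : ((√2 : ℝ) : ℂ) ^ 2 = 2 := by
    rw [sqrt_sq_cast (by norm_num)]
    norm_num
  simp only [Subcase.p]
  linear_combination ((√2 : ℝ) : ℂ) ^ 2 / 16 * I_sq' - h3 / 16

theorem D_quartic_eq : Subcase.quartic.D = 5 * Subcase.quartic.p - 2 := by
  simp only [Subcase.p, Subcase.D]
  ring

theorem p_quintic_sq : Subcase.quintic.p ^ 2 - Subcase.quintic.p = -(8 / 27) := by
  have h3 : ((√15 : ℝ) : ℂ) ^ 2 = 15 := by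
    rw [sqrt_sq_cast (by norm_num)]
    norm_num
  simp only [Subcase.p]
  linear_combination ((√15 : ℝ) : ℂ) ^ 2 / 324 * I_sq' - h3 / 324

theorem D_quintic_eq : Subcase.quintic.D = 11 / 5 * Subcase.quintic.p - 3 / 5 := by
  simp only [Subcase.p, Subcase.D]
  ring

theorem coeff_quintic_eq : -Complex.I * (2025 * ((√15 : ℝ) : ℂ) / 64) =
    -(18225 / 64) * (2 * Subcase.quintic.p - 1) := by
  simp only [Subcase.p]
  ring

theorem ne_zero_of_sq_sub {p r : ℂ} (hr : r ≠ 0) (h : p ^ 2 - p = r) : p ≠ 0 := by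
  rintro rfl
  apply hr
  rw [← h]
  ring

namespace NormalPullback

variable {x y w gx gy gw k : ℂ}

/-- The residue at the origin remains free; `c = (1 + gy) / 2` solves `gy = 2c - 1`. -/
theorem of_sq (hk : k ≠ 0) (hxw : w = -x) (hkx : k * x ^ 2 = 1) (hg : gx = gw) :
    NormalPullback x 0 w gx gy gw ((1 + gy) / 2) gx (C k * X ^ 2) := by
  have hn : (C k * X ^ 2).natDegree = 2 := natDegree_C_mul_X_pow _ _ hk
  have hd : ∀ t, (derivative (C k * X ^ 2)).eval t = k * (2 * t) := by
    intro t
    rw [derivative_C_mul, derivative_X_pow]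
    simp
  refine ⟨by rw [hn]; norm_num, ?_, ?_⟩ <;> apply Polynomial.funext <;> intro t <;>
    simp only [eval_mul, eval_add, eval_sub, eval_X, eval_C, eval_one, eval_pow, hd, hn]
  · subst hxw
    push_cast
    linear_combination (-4 * k * t ^ 3) * hkx
  · subst hxw hg
    linear_combination ((2 - 4 * gx) * k * t ^ 5) * hkx

theorem of_realCubic (hk : k ≠ 0) (hxw : w = -3 * x) (hkx : 4 * k * x ^ 3 = 1) (g : ℂ) :
    NormalPullback x 0 w (1 / 2) (2 * g - 1) g g (1 / 2) (C k * X ^ 2 * (X - C w)) := by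
  have hn : (C k * X ^ 2 * (X - C w)).natDegree = 3 := by
    simpa using natDegree_prod_form hk w 0 0 2 1 0 0
  have hd : ∀ t, (derivative (C k * X ^ 2 * (X - C w))).eval t = k * t * (3 * t - 2 * w) := by
    intro t
    simp
    ring
  refine ⟨by rw [hn]; norm_num, ?_, ?_⟩ <;> apply Polynomial.funext <;> intro t <;>
    simp only [eval_mul, eval_add, eval_sub, eval_X, eval_C, eval_one, eval_pow, hd, hn]
  · have e : k * ((3 * t - 2 * w) ^ 2 * (t - x)) = 9 * (k * t ^ 2 * (t - w) - 1) := by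
      rw [hxw]
      linear_combination -9 * hkx
    push_cast
    linear_combination k * t ^ 3 * (t - w) * e
  -- With residue `1/2` over `1` the term of `2c' - 1` disappears and `P - 1` is a common factor;
  -- what remains is the logarithmic derivative of the product `P`.
  · ring

theorem of_specialHarmonic (hk : k ≠ 0) (hxw : w = -x) (hkx : k * x ^ 4 = -4) (g : ℂ) :
    NormalPullback x 0 w g (2 * g - 1) g g (1 / 2)
      (C k * X ^ 2 * (X - C x) * (X - C w)) := by
  have hn : (C k * X ^ 2 * (X - C x) * (X - C w)).natDegree = 4 := by
    simpa using natDegree_prod_form hk x w 0 2 1 1 0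
  have hd : ∀ t, (derivative (C k * X ^ 2 * (X - C x) * (X - C w))).eval t =
      k * t * (4 * t ^ 2 - 3 * (x + w) * t + 2 * x * w) := by
    intro t
    simp
    ring
  refine ⟨by rw [hn]; norm_num, ?_, ?_⟩ <;> apply Polynomial.funext <;> intro t <;>
    simp only [eval_mul, eval_add, eval_sub, eval_X, eval_C, eval_one, eval_pow, hd, hn]
  · have e : k * (4 * t ^ 2 - 3 * (x + w) * t + 2 * x * w) ^ 2 =
        16 * (k * t ^ 2 * (t - x) * (t - w) - 1) := by
      rw [hxw]
      linear_combination 4 * hkx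
    push_cast
    linear_combination k * t ^ 3 * (t - x) * (t - w) * e
  · ring

theorem of_equianharmonic (hk : k ≠ 0) (s1 : x + y + w = 0) (s2 : x * y + y * w + x * w = 0)
    (s3 : k * (x * y * w) = 1) (g : ℂ) :
    NormalPullback x y w g g g (2 / 3) g (C k * X ^ 3) := by
  have hn : (C k * X ^ 3).natDegree = 3 := natDegree_C_mul_X_pow _ _ hk
  have hd : ∀ t, (derivative (C k * X ^ 3)).eval t = k * (3 * t ^ 2) := by
    intro t
    rw [derivative_C_mul, derivative_X_pow]
    simp
  have e : ∀ t, (t - x) * (t - y) * (t - w) = t ^ 3 - x * y * w := by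
    intro t
    linear_combination -t ^ 2 * s1 + t * s2
  have e' : ∀ t, (t - y) * (t - w) + (t - x) * (t - w) + (t - x) * (t - y) = 3 * t ^ 2 := by
    intro t
    linear_combination -2 * t * s1 + s2
  refine ⟨by rw [hn]; norm_num, ?_, ?_⟩ <;> apply Polynomial.funext <;> intro t <;>
    simp only [eval_mul, eval_add, eval_sub, eval_X, eval_C, eval_one, eval_pow, hd, hn, e]
  · push_cast
    linear_combination -9 * k * t ^ 4 * s3
  · linear_combination (-k * t ^ 3 * (k * t ^ 3 - 1) * (2 * g - 1) * t) * e' t -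
      3 * k * t ^ 6 * (2 * g - 1) * s3

theorem of_quartic (hk : k ≠ 0) (s1 : x + y = -w / 2) (s2 : x * y = 3 * w ^ 2 / 16)
    (s3 : 27 * k * w ^ 4 = -256) :
    NormalPullback x y w (1 / 2) (1 / 2) (2 / 3) (2 / 3) (1 / 2)
      (C k * X ^ 3 * (X - C w)) := by
  have hn : (C k * X ^ 3 * (X - C w)).natDegree = 4 := by
    simpa using natDegree_prod_form hk w 0 0 3 1 0 0
  have hd : ∀ t, (derivative (C k * X ^ 3 * (X - C w))).eval t =
      k * t ^ 2 * (4 * t - 3 * w) := by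
    intro t
    simp
    ring
  refine ⟨by rw [hn]; norm_num, ?_, ?_⟩ <;> apply Polynomial.funext <;> intro t <;>
    simp only [eval_mul, eval_add, eval_sub, eval_X, eval_C, eval_one, eval_pow, hd, hn]
  · have e : k * ((4 * t - 3 * w) ^ 2 * ((t - x) * (t - y))) = 16 * (k * t ^ 3 * (t - w) - 1) := by
      have : (t - x) * (t - y) = t ^ 2 + w * t / 2 + 3 * w ^ 2 / 16 := by
        linear_combination -t * s1 + s2
      rw [this]
      linear_combination s3 / 16
    push_cast
    linear_combination k * t ^ 4 * (t - w) * e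
  · ring

theorem of_quintic (hk : k ≠ 0) (s1 : x + y = -5 * w / 3) (s2 : x * y = 40 * w ^ 2 / 9)
    (s3 : 64 * k * w ^ 5 = 9) :
    NormalPullback x y w (2 / 3) (2 / 3) (1 / 2) (2 / 3) (1 / 2)
      (C k * X ^ 3 * (X - C x) * (X - C y)) := by
  have hn : (C k * X ^ 3 * (X - C x) * (X - C y)).natDegree = 5 := by
    simpa using natDegree_prod_form hk x y 0 3 1 1 0
  have hd : ∀ t, (derivative (C k * X ^ 3 * (X - C x) * (X - C y))).eval t =
      k * t ^ 2 * (5 * t ^ 2 - 4 * (x + y) * t + 3 * (x * y)) := by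
    intro t
    simp
    ring
  refine ⟨by rw [hn]; norm_num, ?_, ?_⟩ <;> apply Polynomial.funext <;> intro t <;>
    simp only [eval_mul, eval_add, eval_sub, eval_X, eval_C, eval_one, eval_pow, hd, hn]
  · have e : k * ((5 * t ^ 2 - 4 * (x + y) * t + 3 * (x * y)) ^ 2 * (t - w)) =
        25 * (k * t ^ 3 * ((t - x) * (t - y)) - 1) := by
      have : (t - x) * (t - y) = t ^ 2 + 5 * w / 3 * t + 40 * w ^ 2 / 9 := by
        linear_combination -t * s1 + s2
      rw [this, s1, s2]
      linear_combination -25 / 9 * s3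
    push_cast
    linear_combination k * t ^ 4 * (t - x) * (t - y) * e
  · ring

theorem of_specialEquianharmonic (hk : k ≠ 0) (s1 : x + y + w = 0)
    (s2 : x * y + y * w + x * w = 0) (s3 : k * (x * y * w) ^ 2 = -4) :
    NormalPullback x y w (2 / 3) (2 / 3) (2 / 3) (2 / 3) (1 / 2)
      (C k * X ^ 3 * (X - C x) * (X - C y) * (X - C w)) := by
  have hn : (C k * X ^ 3 * (X - C x) * (X - C y) * (X - C w)).natDegree = 6 := by
    simpa using natDegree_prod_form hk x y w 3 1 1 1
  have hd : ∀ t, (derivative (C k * X ^ 3 * (X - C x) * (X - C y) * (X - C w))).eval t =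
      k * t ^ 2 * (6 * t ^ 3 - 5 * (x + y + w) * t ^ 2 + 4 * (x * y + y * w + x * w) * t -
        3 * (x * y * w)) := by
    intro t
    simp
    ring
  refine ⟨by rw [hn]; norm_num, ?_, ?_⟩ <;> apply Polynomial.funext <;> intro t <;>
    simp only [eval_mul, eval_add, eval_sub, eval_X, eval_C, eval_one, eval_pow, hd, hn]
  · have e : k * (6 * t ^ 3 - 5 * (x + y + w) * t ^ 2 + 4 * (x * y + y * w + x * w) * t -
        3 * (x * y * w)) ^ 2 = 36 * (k * t ^ 3 * ((t - x) * (t - y) * (t - w)) - 1) := by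
      have : (t - x) * (t - y) * (t - w) = t ^ 3 - x * y * w := by
        linear_combination -t ^ 2 * s1 + t * s2
      rw [this, s1, s2]
      linear_combination 9 * s3
    push_cast
    linear_combination k * t ^ 4 * (t - x) * (t - y) * (t - w) * e
  · ring

end NormalPullback

theorem equianharmonic_relations {x y w : ℂ} (hD : w - x = Subcase.equianharmonic.D * (y - x))
    (hp : -x = Subcase.equianharmonic.p * (y - x)) :
    x + y + w = 0 ∧ x * y + y * w + x * w = 0 ∧ x * y * w = x ^ 3 := by
  have s1 : x + y + w = 0 := by
    rw [D_equianharmonic_eq] at hD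
    linear_combination hD - 3 * hp
  have s2 : x * y + y * w + x * w = 0 := by
    have hsq := p_equianharmonic_sq
    generalize Subcase.equianharmonic.p = p at *
    have hx' : x = -p * (y - x) := by linear_combination -hp
    have hy' : y = (1 - p) * (y - x) := by linear_combination -hp
    have : x ^ 2 + x * y + y ^ 2 = 0 := by
      calc x ^ 2 + x * y + y ^ 2 = (-p * (y - x)) ^ 2 + (-p * (y - x)) * ((1 - p) * (y - x)) +
          ((1 - p) * (y - x)) ^ 2 := by rw [← hx', ← hy']
        _ = 0 := by linear_combination (3 * (y - x) ^ 2) * hsq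
    linear_combination (x + y) * s1 - this
  exact ⟨s1, s2, by linear_combination x * s2 - x ^ 2 * s1⟩

theorem IsNormalForm.normalPullback {x y w gx gy gw : ℂ} {P : ℂ[X]} (hxy : x ≠ y)
    (h : IsNormalForm x y w gx gy gw P) : ∃ c c', NormalPullback x y w gx gy gw c c' P := by
  obtain ⟨κ, hE, hD, hp, hP⟩ := h
  have hyx := sub_ne_zero.2 hxy.symm
  -- In the harmonic and the two special subcases the listed polynomial takes the value `1` at the
  -- origin, and it is its complement that has the product form.
  suffices H : (∃ c c', NormalPullback x y w gx gy gw c c' (κ.polynomial.comp (affine x y))) ∨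
      ∃ c c', NormalPullback x y w gx gy gw c c' (1 - κ.polynomial.comp (affine x y)) by
    have H' : ∃ c c', NormalPullback x y w gx gy gw c c' (κ.polynomial.comp (affine x y)) := by
      rcases H with H | ⟨c, c', H⟩
      · exact H
      · exact ⟨c', c, by simpa using H.one_sub⟩
    obtain ⟨c, c', H⟩ := H'
    rcases hP with rfl | rfl
    · exact ⟨c, c', H⟩
    · exact ⟨c', c, H.one_sub⟩
  cases κ with
  | harmonic =>
    simp only [Subcase.ExponentCondition, Subcase.D, Subcase.p] at hE hD hp
    obtain rfl : y = 0 := by linear_combination -hp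
    have hx : x ≠ 0 := hxy
    have hw : w = -x := by linear_combination hD
    have e : 1 - Subcase.harmonic.polynomial.comp (affine x 0) = C (1 / x ^ 2) * X ^ 2 := by
      apply Polynomial.funext
      intro t
      simp only [Subcase.polynomial, affine, eval_sub, eval_one, eval_comp, eval_mul, eval_X,
        eval_ofNat, eval_C, eval_pow]
      field_simp
      ring
    rw [e]
    exact Or.inr ⟨_, _, .of_sq (one_div_ne_zero (pow_ne_zero 2 hx)) hw (by field_simp) hE⟩
  | realCubic =>
    simp only [Subcase.ExponentCondition, Subcase.D, Subcase.p] at hE hD hp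
    obtain rfl : y = 0 := by linear_combination -hp
    have hx : x ≠ 0 := hxy
    have hw : w = -3 * x := by linear_combination hD
    obtain ⟨h1, rfl⟩ := hE
    obtain rfl : gy = 2 * gw - 1 := by linear_combination -h1
    have e : Subcase.realCubic.polynomial.comp (affine x 0) =
        C (1 / (4 * x ^ 3)) * X ^ 2 * (X - C w) := by
      apply Polynomial.funext
      intro t
      simp only [Subcase.polynomial, affine, eval_sub, eval_one, eval_comp, eval_mul, eval_X,
        eval_C, eval_pow, hw]
      field_simp
      ring
    rw [e]
    exact Or.inl ⟨_, _, .of_realCubic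
      (one_div_ne_zero (mul_ne_zero (show (4 : ℂ) ≠ 0 by norm_num) (pow_ne_zero 3 hx))) hw (by field_simp) gw⟩
  | specialHarmonic =>
    simp only [Subcase.ExponentCondition, Subcase.D, Subcase.p] at hE hD hp
    obtain rfl : y = 0 := by linear_combination -hp
    have hx : x ≠ 0 := hxy
    have hw : w = -x := by linear_combination hD
    obtain ⟨rfl, h1⟩ := hE
    obtain rfl : gy = 2 * gx - 1 := by linear_combination -h1
    have e : 1 - Subcase.specialHarmonic.polynomial.comp (affine x 0) =
        C (-4 / x ^ 4) * X ^ 2 * (X - C x) * (X - C w) := by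
      apply Polynomial.funext
      intro t
      simp only [Subcase.polynomial, affine, eval_sub, eval_one, eval_comp, eval_mul, eval_X,
        eval_C, eval_pow, eval_ofNat, hw]
      field_simp
      ring
    rw [e]
    exact Or.inr ⟨_, _, .of_specialHarmonic (div_ne_zero (by norm_num) (pow_ne_zero 4 hx)) hw
      (by field_simp) gx⟩
  | equianharmonic =>
    obtain ⟨rfl, rfl⟩ := hE
    have hp0 := ne_zero_of_sq_sub (by norm_num) p_equianharmonic_sq
    have hx : x ≠ 0 := by
      rw [← neg_ne_zero, hp]
      exact mul_ne_zero hp0 hyx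
    obtain ⟨s1, s2, s3⟩ := equianharmonic_relations hD hp
    have e : Subcase.equianharmonic.polynomial.comp (affine x y) = C (1 / x ^ 3) * X ^ 3 := by
      apply Polynomial.funext
      intro t
      simp only [Subcase.polynomial, affine, eval_sub, eval_one, eval_comp, eval_mul, eval_X,
        eval_C, eval_pow, one_sub_div_p hx hyx hp]
      ring
    rw [e]
    exact Or.inl ⟨_, _, .of_equianharmonic (one_div_ne_zero (pow_ne_zero 3 hx)) s1 s2
      (by rw [s3]; field_simp) gx⟩
  | quartic =>
    obtain ⟨rfl, rfl, rfl⟩ := hE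
    have hsq := p_quartic_sq
    have hp0 := ne_zero_of_sq_sub (by norm_num) hsq
    have hx : x ≠ 0 := by
      rw [← neg_ne_zero, hp]
      exact mul_ne_zero hp0 hyx
    have hD0 : Subcase.quartic.D ≠ 0 := by
      rw [D_quartic_eq]
      intro h0
      have : Subcase.quartic.p = 2 / 5 := by linear_combination h0 / 5
      rw [this] at hsq
      norm_num at hsq
    have hxw : x - w ≠ 0 := by
      rw [← neg_ne_zero, neg_sub, hD]
      exact mul_ne_zero hD0 hyx
    have hDe : Subcase.quartic.D = (w - x) / (y - x) := by rw [hD, mul_div_cancel_right₀ _ hyx]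
    have e : Subcase.quartic.polynomial.comp (affine x y) =
        C (1 / (x ^ 3 * (x - w))) * X ^ 3 * (X - C w) := by
      apply Polynomial.funext
      intro t
      simp only [Subcase.polynomial, affine, eval_sub, eval_one, eval_comp, eval_mul, eval_X,
        eval_C, eval_pow, one_sub_div_p hx hyx hp]
      rw [hDe]
      have hwx : w - x ≠ 0 := by rwa [← neg_ne_zero, neg_sub]
      field_simp
      ring
    rw [e]
    rw [D_quartic_eq] at hD
    generalize Subcase.quartic.p = p at *
    have hw : w = (4 * p - 2) * (y - x) := by linear_combination hD - hp
    have s1 : x + y = -w / 2 := by linear_combination hw / 2 - 2 * hp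
    have s2 : x * y = 3 * w ^ 2 / 16 := by
      have hx' : x = -p * (y - x) := by linear_combination -hp
      have hy' : y = (1 - p) * (y - x) := by linear_combination -hp
      rw [hw]
      calc x * y = (-p * (y - x)) * ((1 - p) * (y - x)) := by rw [← hx', ← hy']
        _ = _ := by linear_combination (-2 * (y - x) ^ 2) * hsq
    -- By `s1` and `s2`, `x` is a root of `t² + wt/2 + 3w²/16`; the multiplier below is the quotient
    -- of `t⁴ - wt³ + 27w⁴/256` by it, at `t = x`.
    have s3 : x ^ 3 * (x - w) = -(27 * w ^ 4 / 256) := by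
      linear_combination (x ^ 2 - 3 / 2 * w * x + 9 / 16 * w ^ 2) * (x * s1 - s2)
    refine Or.inl ⟨_, _, .of_quartic
      (one_div_ne_zero (mul_ne_zero (pow_ne_zero 3 hx) hxw)) s1 s2 ?_⟩
    field_simp
    linear_combination 256 * s3
  | quintic =>
    obtain ⟨rfl, rfl, rfl⟩ := hE
    have hsq := p_quintic_sq
    have hpe : Subcase.quintic.p = -x / (y - x) := by rw [hp, mul_div_cancel_right₀ _ hyx]
    have e : Subcase.quintic.polynomial.comp (affine x y) =
        C (-(18225 / 64) * (2 * Subcase.quintic.p - 1) / (y - x) ^ 5) * X ^ 3 *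
          (X - C x) * (X - C y) := by
      apply Polynomial.funext
      intro t
      simp only [Subcase.polynomial, coeff_quintic_eq, affine, eval_sub, eval_one, eval_comp,
        eval_mul, eval_X, eval_C, eval_pow, hpe]
      field_simp
      ring
    rw [e]
    rw [D_quintic_eq] at hD
    generalize Subcase.quintic.p = p at *
    have hw : w = 3 / 5 * (2 * p - 1) * (y - x) := by linear_combination hD - hp
    have hp2 : (2 * p - 1) ^ 2 = -(5 / 27) := by linear_combination 4 * hsq
    have hp1 : 2 * p - 1 ≠ 0 := by
      intro h0
      rw [h0] at hp2
      norm_num at hp2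
    have s1 : x + y = -5 * w / 3 := by linear_combination 5 / 3 * hw - 2 * hp
    have s2 : x * y = 40 * w ^ 2 / 9 := by
      have hx' : x = -p * (y - x) := by linear_combination -hp
      have hy' : y = (1 - p) * (y - x) := by linear_combination -hp
      rw [hw]
      calc x * y = (-p * (y - x)) * ((1 - p) * (y - x)) := by rw [← hx', ← hy']
        _ = _ := by linear_combination (-27 / 5 * (y - x) ^ 2) * hsq
    refine Or.inl ⟨_, _, .of_quintic
      (div_ne_zero (mul_ne_zero (by norm_num) hp1) (by positivity)) s1 s2 ?_⟩
    rw [hw]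
    -- Five factors `2p - 1` come from `w⁵`, the sixth from the leading coefficient.
    have : (2 * p - 1) ^ 6 = -(125 / 19683) := by
      calc (2 * p - 1) ^ 6 = ((2 * p - 1) ^ 2) ^ 3 := by ring
        _ = _ := by rw [hp2]; norm_num
    field_simp
    linear_combination (-(18225 * 243)) * this
  | specialEquianharmonic =>
    obtain ⟨rfl, rfl, rfl⟩ := hE
    have hp0 := ne_zero_of_sq_sub (by norm_num) p_equianharmonic_sq
    have hx : x ≠ 0 := by
      rw [← neg_ne_zero, hp]
      exact mul_ne_zero hp0 hyx
    obtain ⟨s1, s2, s3⟩ := equianharmonic_relations hD hp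
    have ht : ∀ t, (t - x) * (t - y) * (t - w) = t ^ 3 - x ^ 3 := by
      intro t
      linear_combination -t ^ 2 * s1 + t * s2 - s3
    have e : 1 - Subcase.specialEquianharmonic.polynomial.comp (affine x y) =
        C (-4 / x ^ 6) * X ^ 3 * (X - C x) * (X - C y) * (X - C w) := by
      apply Polynomial.funext
      intro t
      simp only [Subcase.polynomial, affine, eval_sub, eval_one, eval_comp, eval_mul, eval_X,
        eval_C, eval_pow, eval_ofNat, one_sub_div_p hx hyx hp]
      rw [mul_assoc (_ * t ^ 3), mul_assoc (_ * t ^ 3), ht]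
      field_simp
      ring
    rw [e]
    exact Or.inr ⟨_, _, .of_specialEquianharmonic (div_ne_zero (by norm_num) (by positivity))
      s1 s2 (by rw [s3]; field_simp)⟩

/-! ### Reducibility of the Heun equation -/

theorem generalHeun_swap₁₂ (d₁ d₂ d₃ d₄ α β γ δ ε q : ℂ) :
    generalHeun d₂ d₁ d₃ d₄ α β δ γ ε q = generalHeun d₁ d₂ d₃ d₄ α β γ δ ε q := by
  unfold generalHeun
  congr 1
  · ring
  · rw [mul_comm (d₄ - d₂), mul_comm (lin d₂)]

theorem generalHeun_swap₁₃ (d₁ d₂ d₃ d₄ α β γ δ ε q : ℂ) :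
    generalHeun d₃ d₂ d₁ d₄ α β ε δ γ q = generalHeun d₁ d₂ d₃ d₄ α β γ δ ε q := by
  unfold generalHeun
  congr 1
  · ring
  · rw [show (d₄ - d₃) * (d₄ - d₂) * (d₄ - d₁) = (d₄ - d₁) * (d₄ - d₂) * (d₄ - d₃) by ring,
      show lin d₃ * lin d₂ * lin d₁ = lin d₁ * lin d₂ * lin d₃ by ring]

theorem not_isRoot_denom {f g : ℂ[X]} {d : ℂ} (hg : g.eval d ≠ 0) :
    ¬ (algebraMap ℂ[X] (RatFunc ℂ) f / algebraMap ℂ[X] (RatFunc ℂ) g).denom.IsRoot d :=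
  fun h => hg (h.dvd (RatFunc.denom_div_dvd f g))

/-- A singular point where the last coefficient has no pole has a nonzero residue. -/
theorem residue_ne_zero {d₁ d₂ d₃ d₄ α β γ δ ε q v : ℂ}
    (h₁₂ : d₁ ≠ d₂) (h₁₃ : d₁ ≠ d₃) (h₁₄ : d₁ ≠ d₄)
    (hv : α * β * v * ((d₄ - d₁) * (d₄ - d₂) * (d₄ - d₃)) + q = 0)
    (hs : (generalHeun d₁ d₂ d₃ d₄ α β γ δ ε q).IsSingularAt d₁)
    (h0 : 1 / (d₁ - d₄) + v = 0) : γ ≠ 0 := by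
  rintro rfl
  have hd := sub_ne_zero.2 h₁₄
  have e₁₂ := sub_ne_zero.2 h₁₂
  have e₁₃ := sub_ne_zero.2 h₁₃
  have hL := lin_ne_zero
  have l1 := hL d₁
  have l2 := hL d₂
  have l3 := hL d₃
  have l4 := hL d₄
  rcases hs with hs | hs
  · have e : (generalHeun d₁ d₂ d₃ d₄ α β 0 δ ε q).p =
        algebraMap ℂ[X] (RatFunc ℂ) (C δ * ((X - C d₃) * (X - C d₄)) +
          C ε * ((X - C d₂) * (X - C d₄)) + C (1 - α - β) * ((X - C d₂) * (X - C d₃))) /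
        algebraMap ℂ[X] (RatFunc ℂ) ((X - C d₂) * (X - C d₃) * (X - C d₄)) := by
      simp only [generalHeun, map_add, map_mul, ← lin_eq, RatFunc.algebraMap_C, map_zero,
        zero_div]
      field_simp
      ring
    rw [e] at hs
    refine not_isRoot_denom ?_ hs
    simp only [eval_mul, eval_sub, eval_X, eval_C]
    positivity
  · have e : (generalHeun d₁ d₂ d₃ d₄ α β 0 δ ε q).q =
        algebraMap ℂ[X] (RatFunc ℂ) (C (-q)) /
        algebraMap ℂ[X] (RatFunc ℂ) ((X - C d₂) * (X - C d₃) * (X - C d₄) ^ 2) := by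
      simp only [generalHeun]
      rw [map_mul (algebraMap ℂ[X] (RatFunc ℂ)), map_mul (algebraMap ℂ[X] (RatFunc ℂ)), map_pow,
        ← lin_eq, ← lin_eq, ← lin_eq, RatFunc.algebraMap_C]
      -- The numerator of the last coefficient vanishes at `d₁` and cancels the factor `s - d₁`;
      -- with zero residue, `d₁` would not be singular.
      have hA : α * β * ((d₄ - d₁) * (d₄ - d₂) * (d₄ - d₃)) = q * (d₁ - d₄) := by
        have : v = -(1 / (d₁ - d₄)) := by linear_combination h0
        rw [this] at hv
        field_simp at hv
        linear_combination -hv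
      have hA' : RatFunc.C (α * β * ((d₄ - d₁) * (d₄ - d₂) * (d₄ - d₃))) =
          RatFunc.C q * (lin d₄ - lin d₁) := by
        rw [hA, map_mul]
        simp only [lin, map_sub]
        ring
      rw [hA', map_neg]
      field_simp
      ring
    rw [e] at hs
    refine not_isRoot_denom ?_ hs
    simp only [eval_mul, eval_sub, eval_X, eval_C, eval_pow]
    positivity

/-! ### Degrees, leading coefficients and the recovery of the hypergeometric parameters. -/

theorem leadingCoeff_one_sub' {P : ℂ[X]} (hP : 0 < P.natDegree) :
    (P - 1).natDegree = P.natDegree ∧ (P - 1).leadingCoeff = P.leadingCoeff := by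
  have h : (P - 1).natDegree = P.natDegree := by rw [← C_1, natDegree_sub_C]
  refine ⟨h, ?_⟩
  rw [leadingCoeff, h, coeff_sub, coeff_one, if_neg hP.ne', sub_zero, leadingCoeff]

/-- With `n = deg P`, the left side of the first identity has degree `2n + 1`; for `l = 0` the right
side has degree at most `2n`. Applied with `l = αβ`, this excludes `αβ = 0`. -/
theorem PullsBack.l_ne_zero {x y w gx gy gw l m k c c' : ℂ} {P : ℂ[X]} (hP : 0 < P.natDegree)
    (hk : k ≠ 0) (h : PullsBack x y w gx gy gw l m k c c' P) : l ≠ 0 := by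
  rintro rfl
  have e := congrArg natDegree h.zeroth
  have h1 := X_sub_C_ne_zero x
  have h2 := X_sub_C_ne_zero y
  have h3 := X_sub_C_ne_zero w
  have h4 : (C k : ℂ[X]) ≠ 0 := C_ne_zero.2 hk
  have h5 := derivative_ne_zero_of_pos hP
  rw [natDegree_mul, natDegree_mul, natDegree_mul, natDegree_mul, natDegree_pow,
    natDegree_derivative] at e
  · simp only [natDegree_C, natDegree_X_sub_C, map_zero, zero_mul, zero_sub, ← C_neg] at e
    have := natDegree_C_mul_le (-m) (P * (P - 1))
    have h7 := natDegree_mul_le (p := P) (q := P - 1)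
    rw [(leadingCoeff_one_sub' hP).1] at h7
    omega
  all_goals positivity

theorem PullsBack.k_eq {x y w gx gy gw l m k c c' : ℂ} {P : ℂ[X]} (hP : 0 < P.natDegree)
    (hl : l ≠ 0) (h : PullsBack x y w gx gy gw l m k c c' P) : k * (P.natDegree : ℂ) ^ 2 = l := by
  have e := congrArg leadingCoeff h.zeroth
  have hlin : (C l * X - C m : ℂ[X]).leadingCoeff = l := by
    rw [sub_eq_add_neg, ← C_neg, leadingCoeff_linear hl]
  have hP0 : P.leadingCoeff ≠ 0 := by
    rw [Ne, leadingCoeff_eq_zero]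
    rintro rfl
    simp at hP
  simp only [leadingCoeff_mul, leadingCoeff_pow, leadingCoeff_X_sub_C, leadingCoeff_C, hlin,
    (leadingCoeff_one_sub' hP).2, leadingCoeff_derivative] at e
  apply mul_right_cancel₀ (pow_ne_zero 2 hP0)
  linear_combination e

theorem PullsBack.normalPullback {x y w gx gy gw l k c c' : ℂ} {P : ℂ[X]} (hP : 0 < P.natDegree)
    (hk : k ≠ 0) (hl : l ≠ 0) (h : PullsBack x y w gx gy gw l 0 k c c' P) :
    NormalPullback x y w gx gy gw c c' P := by
  have hq : derivative P ^ 2 * ((X - C x) * (X - C y) * (X - C w)) =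
      C ((P.natDegree : ℂ) ^ 2) * X * (P * (P - 1)) := by
    apply mul_left_cancel₀ (C_ne_zero.2 hk)
    have e := h.zeroth
    rw [← h.k_eq hP hl, C_mul, C_0] at e
    linear_combination e
  exact ⟨hP, hq, (first_iff_log (derivative_ne_zero_of_pos hP) hq).1 h.first⟩

theorem NormalPullback.pullsBack {x y w gx gy gw l c c' : ℂ} {P : ℂ[X]}
    (h : NormalPullback x y w gx gy gw c c' P) :
    PullsBack x y w gx gy gw l 0 (l / (P.natDegree : ℂ) ^ 2) c c' P := by
  refine ⟨?_, (first_iff_log (derivative_ne_zero_of_pos h.pos) h.quad).2 h.log⟩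
  have hl : l = l / (P.natDegree : ℂ) ^ 2 * (P.natDegree : ℂ) ^ 2 :=
    (div_mul_cancel₀ _ h.natDegree_sq_ne_zero).symm
  have hC : (C l : ℂ[X]) = C (l / (P.natDegree : ℂ) ^ 2) * C ((P.natDegree : ℂ) ^ 2) := by
    rw [← C_mul, ← hl]
  rw [hC, C_0]
  linear_combination C (l / (P.natDegree : ℂ) ^ 2) * h.quad

/-- The hypergeometric equation involves `a, b` only through their sum and product, so these may be
prescribed. -/
theorem exists_add_mul (s m : ℂ) : ∃ a b : ℂ, a + b = s ∧ a * b = m := by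
  obtain ⟨r, hr⟩ := IsAlgClosed.exists_pow_nat_eq (s ^ 2 - 4 * m) (n := 2) (by norm_num)
  exact ⟨(s + r) / 2, (s - r) / 2, by ring, by linear_combination -hr / 4⟩

theorem HasNormalForm.normalPullback {x y w gx gy gw : ℂ} {P : ℂ[X]} (hxy : x ≠ y)
    (hxw : x ≠ w) (hyw : y ≠ w) (h : HasNormalForm x y w gx gy gw P) :
    ∃ c c', NormalPullback x y w gx gy gw c c' P := by
  rcases h with h | h | h | h | h | h
  · exact h.normalPullback hxy
  · obtain ⟨c, c', h⟩ := h.normalPullback hxy.symm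
    exact ⟨c, c', h.swap₁₂⟩
  · obtain ⟨c, c', h⟩ := h.normalPullback hxw
    exact ⟨c, c', h.swap₂₃⟩
  · obtain ⟨c, c', h⟩ := h.normalPullback hxw.symm
    exact ⟨c, c', h.swap₁₂.swap₂₃⟩
  · obtain ⟨c, c', h⟩ := h.normalPullback hyw
    exact ⟨c, c', h.swap₂₃.swap₁₂⟩
  · obtain ⟨c, c', h⟩ := h.normalPullback hyw.symm
    exact ⟨c, c', h.swap₁₃⟩

theorem coord_ne {d d' d₄ v : ℂ} (h : d ≠ d') :
    1 / (d - d₄) + v ≠ 1 / (d' - d₄) + v := by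
  intro e
  have := add_right_cancel e
  rw [one_div, one_div, inv_inj] at this
  exact h (by linear_combination this)

/-- The condition on `v` says that the zero of the last coefficient has coordinate `0`, which is
what normal position requires. -/
theorem reducedBy_iff {d₁ d₂ d₃ d₄ α β γ δ ε q : ℂ} {R : RatFunc ℂ}
    (h₁₂ : d₁ ≠ d₂) (h₁₃ : d₁ ≠ d₃) (h₁₄ : d₁ ≠ d₄)
    (h₂₃ : d₂ ≠ d₃) (h₂₄ : d₂ ≠ d₄) (h₃₄ : d₃ ≠ d₄)
    (hFuchs : α + β - γ - δ - ε + 1 = 0)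
    (hs₁ : (generalHeun d₁ d₂ d₃ d₄ α β γ δ ε q).IsSingularAt d₁)
    (hs₂ : (generalHeun d₁ d₂ d₃ d₄ α β γ δ ε q).IsSingularAt d₂)
    (hs₃ : (generalHeun d₁ d₂ d₃ d₄ α β γ δ ε q).IsSingularAt d₃)
    (hnontrivial : α * β ≠ 0 ∨ q ≠ 0) :
    ReducedBy (generalHeun d₁ d₂ d₃ d₄ α β γ δ ε q) R ↔
      α * β ≠ 0 ∧ ∃ v, α * β * v * ((d₄ - d₁) * (d₄ - d₂) * (d₄ - d₃)) + q = 0 ∧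
        ∃ P : ℂ[X], R = aeval (coord d₄ 1 v) P ∧
          HasNormalForm (1 / (d₁ - d₄) + v) (1 / (d₂ - d₄) + v) (1 / (d₃ - d₄) + v) γ δ ε P := by
  have e₁ := sub_ne_zero.2 h₁₄.symm
  have e₂ := sub_ne_zero.2 h₂₄.symm
  have e₃ := sub_ne_zero.2 h₃₄.symm
  have hK : (d₄ - d₁) * (d₄ - d₂) * (d₄ - d₃) ≠ 0 := mul_ne_zero (mul_ne_zero e₁ e₂) e₃
  have hm : ∀ v, α * β * v * ((d₄ - d₁) * (d₄ - d₂) * (d₄ - d₃)) + q = 0 →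
      α * β * v + q * 1 / ((d₄ - d₁) * (d₄ - d₂) * (d₄ - d₃)) = 0 := by
    intro v hv
    field_simp
    linear_combination hv
  constructor
  · rintro ⟨hR, a, b, c, hE⟩
    have hq := hE
    rw [hypergeometric_pullback hR, LinODE.ext_iff] at hq
    have hq := hq.2
    simp only [generalHeun] at hq
    have hAq : α * β * ((d₄ - d₁) * (d₄ - d₂) * (d₄ - d₃)) ≠ 0 ∨ q ≠ 0 :=
      hnontrivial.imp_left fun h => mul_ne_zero h hK
    -- Used twice: `v = 0` yields `αβ ≠ 0`, after which the condition on `v` can be solved and the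
    -- normalized coordinate used.
    have hpol := fun v => exists_polynomial h₁₂ h₁₃ h₂₃ hR hAq hq one_ne_zero v
    have hαβ : α * β ≠ 0 := by
      obtain ⟨hk, P, hP, rfl⟩ := hpol 0
      rw [pullback_iff 0 a b c h₁₄ h₂₄ h₃₄ hFuchs one_ne_zero hP] at hE
      exact hE.l_ne_zero hP hk
    have hv : α * β * (-q / (α * β * ((d₄ - d₁) * (d₄ - d₂) * (d₄ - d₃)))) *
        ((d₄ - d₁) * (d₄ - d₂) * (d₄ - d₃)) + q = 0 := by
      rw [← mul_div_assoc, mul_div_mul_left _ _ hαβ, div_mul_cancel₀ _ hK]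
      ring
    generalize -q / (α * β * ((d₄ - d₁) * (d₄ - d₂) * (d₄ - d₃))) = v at hv
    obtain ⟨hk, P, hP, rfl⟩ := hpol v
    rw [pullback_iff v a b c h₁₄ h₂₄ h₃₄ hFuchs one_ne_zero hP, hm v hv] at hE
    refine ⟨hαβ, v, hv, P, rfl, (hE.normalPullback hP hk hαβ).hasNormalForm (coord_ne h₁₂)
      (coord_ne h₁₃) (coord_ne h₂₃) (residue_ne_zero h₁₂ h₁₃ h₁₄ hv hs₁) ?_ ?_⟩
    · rw [← generalHeun_swap₁₂] at hs₂
      exact residue_ne_zero h₁₂.symm h₂₃ h₂₄ (by linear_combination hv) hs₂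
    · rw [← generalHeun_swap₁₃] at hs₃
      exact residue_ne_zero h₂₃.symm h₁₃.symm h₃₄ (by linear_combination hv) hs₃
  · rintro ⟨hαβ, v, hv, P, rfl, hN⟩
    obtain ⟨c, c', h⟩ := hN.normalPullback (coord_ne h₁₂) (coord_ne h₁₃) (coord_ne h₂₃)
    obtain ⟨a, b, hab, hab'⟩ := exists_add_mul (c + c' - 1) (α * β / (P.natDegree : ℂ) ^ 2)
    refine ⟨aeval_ne_C one_ne_zero v h.pos, a, b, c, ?_⟩
    rw [pullback_iff v a b c h₁₄ h₂₄ h₃₄ hFuchs one_ne_zero h.pos, hm v hv, hab',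
      show a + b - c + 1 = c' by linear_combination hab]
    exact h.pullsBack

/-! ### Translation to the original coordinate -/

theorem coord_sub_coord {d d' d₄ : ℂ} (hd : d ≠ d₄) (hd' : d' ≠ d₄) (v : ℂ) :
    (1 / (d - d₄) + v) - (1 / (d' - d₄) + v) = (d' - d) / ((d - d₄) * (d' - d₄)) := by
  have h1 := sub_ne_zero.2 hd
  have h2 := sub_ne_zero.2 hd'
  field_simp
  ring

/-- Once `d₄` is at infinity, the cross-ratio is a ratio of differences, and it does not depend on
the affine coordinate chosen. -/
theorem normalizes_iff {x y w d₄ D : ℂ} (v : ℂ) (hxy : x ≠ y) (hx : x ≠ d₄) (hy : y ≠ d₄)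
    (hw : w ≠ d₄) : Normalizes x y w d₄ D ↔
      (1 / (w - d₄) + v) - (1 / (x - d₄) + v) =
        D * ((1 / (y - d₄) + v) - (1 / (x - d₄) + v)) := by
  have h1 := sub_ne_zero.2 hx
  have h2 := sub_ne_zero.2 hy
  have h3 := sub_ne_zero.2 hw
  have h4 := sub_ne_zero.2 hxy.symm
  rw [coord_sub_coord hw hx, coord_sub_coord hy hx, Normalizes]
  constructor
  · rintro rfl
    field_simp
    ring
  · intro h
    field_simp at h ⊢
    linear_combination -h

/-- Apart from a factor symmetric in `x, y, w`, the accessory parameter is the value of `1 / (s -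
d₄)` at the point with normalized position `p`. Independence of the ordering thus becomes
independence of that point. -/
theorem accessory_eq {x y w d₄ : ℂ} (α β p v : ℂ) (hx : x ≠ d₄) (hy : y ≠ d₄) :
    accessory x y w d₄ α β p = α * β * ((d₄ - x) * (d₄ - y) * (d₄ - w)) *
      (1 / (x - d₄) + p * ((1 / (y - d₄) + v) - (1 / (x - d₄) + v))) := by
  have h1 := sub_ne_zero.2 hx
  have h2 := sub_ne_zero.2 hy
  rw [coord_sub_coord hy hx, accessory]
  field_simp
  ring

theorem aeval_affine {x y d₄ : ℂ} (v : ℂ) (hx : x ≠ d₄) (hy : y ≠ d₄) (hxy : x ≠ y) :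
    aeval (coord d₄ 1 v) (affine (1 / (x - d₄) + v) (1 / (y - d₄) + v)) = moebius x y d₄ := by
  have hT := coord_sub_C_ne_zero (d₄ := d₄) one_ne_zero v
  have h1 := sub_ne_zero.2 hx
  have h2 := sub_ne_zero.2 hy
  have h4 := sub_ne_zero.2 hxy.symm
  have hc : ((1 / (y - d₄) + v) - (1 / (x - d₄) + v))⁻¹ = (y - d₄) / (y - x) * (d₄ - x) := by
    rw [coord_sub_coord hy hx, inv_div, eq_comm, eq_div_iff (sub_ne_zero.2 hxy)]
    field_simp
    ring
  rw [affine, moebius, lin_eq_coord one_ne_zero v hx, lin_infty_eq one_ne_zero v, hc]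
  simp only [map_mul, map_sub, aeval_C, aeval_X, RatFunc.algebraMap_eq_C, map_one]
  field_simp

theorem exists_isNormalForm_iff {x y w d₄ α β q v : ℂ} (gx gy gw : ℂ) {R : RatFunc ℂ}
    (hx : x ≠ d₄) (hy : y ≠ d₄) (hw : w ≠ d₄) (hxy : x ≠ y) (hαβ : α * β ≠ 0)
    (hv : α * β * v * ((d₄ - x) * (d₄ - y) * (d₄ - w)) + q = 0) :
    (∃ P : ℂ[X], R = aeval (coord d₄ 1 v) P ∧
      IsNormalForm (1 / (x - d₄) + v) (1 / (y - d₄) + v) (1 / (w - d₄) + v) gx gy gw P) ↔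
    ∃ κ : Subcase, Normalizes x y w d₄ κ.D ∧ κ.ExponentCondition gx gy gw ∧
      q = accessory x y w d₄ α β κ.p ∧
      (R = κ.poly (moebius x y d₄) ∨ R = 1 - κ.poly (moebius x y d₄)) := by
  have hK : α * β * ((d₄ - x) * (d₄ - y) * (d₄ - w)) ≠ 0 :=
    mul_ne_zero hαβ (mul_ne_zero (mul_ne_zero (sub_ne_zero.2 hx.symm) (sub_ne_zero.2 hy.symm))
      (sub_ne_zero.2 hw.symm))
  have hacc : ∀ p, q = accessory x y w d₄ α β p ↔
      -(1 / (x - d₄) + v) = p * ((1 / (y - d₄) + v) - (1 / (x - d₄) + v)) := by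
    intro p
    rw [accessory_eq α β p v hx hy]
    constructor
    · intro h
      apply mul_left_cancel₀ hK
      linear_combination h - hv
    · intro h
      linear_combination hv + α * β * ((d₄ - x) * (d₄ - y) * (d₄ - w)) * h
  have hpoly : ∀ κ : Subcase, κ.poly (moebius x y d₄) = aeval (coord d₄ 1 v)
      (κ.polynomial.comp (affine (1 / (x - d₄) + v) (1 / (y - d₄) + v))) := by
    intro κ
    rw [← Subcase.poly_aeval, aeval_affine v hx hy hxy]
  simp only [normalizes_iff v hxy hx hy hw, hacc, hpoly]
  constructor
  · rintro ⟨P, rfl, κ, h1, h2, h3, h4⟩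
    refine ⟨κ, h2, h1, h3, h4.imp (fun h => by rw [h]) (fun h => by rw [h, map_sub, map_one])⟩
  · rintro ⟨κ, h1, h2, h3, h4 | h4⟩
    · exact ⟨_, h4, κ, h2, h1, h3, Or.inl rfl⟩
    · exact ⟨_, by rw [h4, map_sub, map_one], κ, h2, h1, h3, Or.inr rfl⟩

/-! ### Cross-ratio orbits -/

theorem bracket_coe (z w : ℂ) : bracket (z : OnePoint ℂ) (w : OnePoint ℂ) = z - w := by
  simp [bracket, homog]

theorem bracket_infty (z : ℂ) : bracket (z : OnePoint ℂ) ∞ = -1 := by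
  simp [bracket, homog]

theorem infty_bracket (z : ℂ) : bracket ∞ (z : OnePoint ℂ) = 1 := by
  simp [bracket, homog]

theorem infty_bracket_infty : bracket ∞ ∞ = 0 := by
  simp [bracket, homog]

theorem crossRatioOrbit_comp (P : Fin 4 → OnePoint ℂ) (τ : Equiv.Perm (Fin 4)) :
    crossRatioOrbit (P ∘ τ) = crossRatioOrbit P := by
  ext z
  constructor
  · rintro ⟨σ, rfl⟩
    exact ⟨σ.trans τ, rfl⟩
  · rintro ⟨σ, rfl⟩
    exact ⟨σ.trans τ.symm, by simp⟩

/-- Each of the four points occurs once in the numerator and once in the denominator of a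
cross-ratio, so rescaled homogeneous coordinates and a common determinant cancel. -/
theorem crossRatioOrbit_eq_of_bracket {P Q : Fin 4 → OnePoint ℂ} (l : Fin 4 → ℂ) (m : ℂ)
    (hl : ∀ i, l i ≠ 0) (hm : m ≠ 0)
    (h : ∀ i j, bracket (P i) (P j) = l i * l j * m * bracket (Q i) (Q j)) :
    crossRatioOrbit P = crossRatioOrbit Q := by
  unfold crossRatioOrbit
  congr 1
  funext σ
  simp only [crossRatio, h]
  rw [show ∀ a b c d x y : ℂ, a * b * m * x * (c * d * m * y) = (a * b * c * d * m ^ 2) * (x * y)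
      by intros; ring, show ∀ a b c d x y : ℂ, c * b * m * x * (a * d * m * y) =
      (a * b * c * d * m ^ 2) * (x * y) by intros; ring]
  refine mul_div_mul_left _ _ ?_
  have := hl (σ 0)
  have := hl (σ 1)
  have := hl (σ 2)
  have := hl (σ 3)
  positivity

theorem crossRatioOrbit_of_normalizes {x y w d₄ D : ℂ} (hxy : x ≠ y)
    (hx : x ≠ d₄) (hy : y ≠ d₄) (hw : w ≠ d₄) (h : Normalizes x y w d₄ D) :
    crossRatioOrbit ![(x : OnePoint ℂ), (y : OnePoint ℂ), (w : OnePoint ℂ), (d₄ : OnePoint ℂ)] =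
      crossRatioOrbit ![((0 : ℂ) : OnePoint ℂ), ((1 : ℂ) : OnePoint ℂ), (D : OnePoint ℂ), ∞] := by
  have h1 := sub_ne_zero.2 hx
  have h2 := sub_ne_zero.2 hy
  have h3 := sub_ne_zero.2 hw
  have h4 := sub_ne_zero.2 hxy
  have h4' := sub_ne_zero.2 hxy.symm
  -- With weights `s - d₄` at the three finite points, `m` is forced by the pair `(x, y)`, whose
  -- images have bracket `-1`; the weight `-(1 / m)` of the fourth point is forced by the brackets
  -- with `∞`.
  set m : ℂ := (x - y) / ((x - d₄) * (y - d₄)) * (-1) with hm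
  have hm0 : m ≠ 0 := mul_ne_zero (div_ne_zero h4 (mul_ne_zero h1 h2)) (by norm_num)
  have e1 : (x - d₄) * (y - d₄) * m = -(x - y) := by
    rw [hm]
    field_simp
  have e2 : (x - d₄) * (w - d₄) * m * D = -(x - w) := by
    rw [hm, ← h]
    field_simp
    ring
  have e3 : (y - d₄) * (w - d₄) * m * (1 - D) = y - w := by
    rw [hm, ← h]
    field_simp
    ring
  have e4 : m * (-(1 / m)) = -1 := by field_simp
  refine crossRatioOrbit_eq_of_bracket ![x - d₄, y - d₄, w - d₄, -(1 / m)] m ?_ hm0 ?_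
  · intro i
    fin_cases i
    · exact h1
    · exact h2
    · exact h3
    · exact neg_ne_zero.2 (one_div_ne_zero hm0)
  · intro i j
    fin_cases i <;> fin_cases j <;>
      simp only [Fin.zero_eta, Fin.mk_one, Fin.reduceFinMk, Fin.isValue, Matrix.cons_val_zero,
        Matrix.cons_val_one, Matrix.cons_val, bracket_coe, bracket_infty, infty_bracket,
        infty_bracket_infty, sub_self, mul_zero]
    · linear_combination e1
    · linear_combination e2
    · linear_combination (x - d₄) * e4
    · linear_combination -e1
    · linear_combination -e3
    · linear_combination (y - d₄) * e4
    · linear_combination -e2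
    · linear_combination e3
    · linear_combination (w - d₄) * e4
    · linear_combination -(x - d₄) * e4
    · linear_combination -(y - d₄) * e4
    · linear_combination -(w - d₄) * e4

/-! ### Recovering an ordering from the cross-ratio orbit. -/

theorem mem_crossRatioOrbit (D : ℂ) : D ∈ crossRatioOrbit
    ![((0 : ℂ) : OnePoint ℂ), ((1 : ℂ) : OnePoint ℂ), (D : OnePoint ℂ), ∞] := by
  -- The ordering `(0, ∞; D, 1)` has cross-ratio `D`.
  refine ⟨Equiv.swap 1 3, ?_⟩
  have h0 : Equiv.swap (1 : Fin 4) 3 0 = 0 := by decide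
  have h1 : Equiv.swap (1 : Fin 4) 3 1 = 3 := by decide
  have h2 : Equiv.swap (1 : Fin 4) 3 2 = 2 := by decide
  have h3 : Equiv.swap (1 : Fin 4) 3 3 = 1 := by decide
  simp [h0, h1, h2, h3, crossRatio, bracket_coe, bracket_infty]

theorem bracket_swap (P Q : OnePoint ℂ) : bracket P Q = -bracket Q P := by
  unfold bracket
  ring

theorem crossRatio_swap₁ (A B C D : OnePoint ℂ) : crossRatio B A D C = crossRatio A B C D := by
  unfold crossRatio
  rw [mul_comm (bracket D B), mul_comm (bracket C B)]

theorem crossRatio_swap₂ (A B C D : OnePoint ℂ) : crossRatio C D A B = crossRatio A B C D := by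
  unfold crossRatio
  rw [bracket_swap A C, bracket_swap B D, bracket_swap B C, bracket_swap A D, neg_mul_neg,
    neg_mul_neg, mul_comm (bracket C B)]

theorem exists_perm_fin_three_iff (F : Fin 3 → Fin 3 → Fin 3 → Prop) :
    (∃ σ : Equiv.Perm (Fin 3), F (σ 0) (σ 1) (σ 2)) ↔
      F 0 1 2 ∨ F 1 0 2 ∨ F 0 2 1 ∨ F 2 0 1 ∨ F 1 2 0 ∨ F 2 1 0 := by
  have h : ∀ i j k : Fin 3, (∃ σ : Equiv.Perm (Fin 3), σ 0 = i ∧ σ 1 = j ∧ σ 2 = k) ↔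
      (i, j, k) = (0, 1, 2) ∨ (i, j, k) = (1, 0, 2) ∨ (i, j, k) = (0, 2, 1) ∨
        (i, j, k) = (2, 0, 1) ∨ (i, j, k) = (1, 2, 0) ∨ (i, j, k) = (2, 1, 0) := by decide
  constructor
  · rintro ⟨σ, hσ⟩
    have := (h _ _ _).1 ⟨σ, rfl, rfl, rfl⟩
    simp only [Prod.mk.injEq] at this
    rcases this with ⟨h1, h2, h3⟩ | ⟨h1, h2, h3⟩ | ⟨h1, h2, h3⟩ | ⟨h1, h2, h3⟩ | ⟨h1, h2, h3⟩ |
      ⟨h1, h2, h3⟩ <;> rw [h1, h2, h3] at hσ <;> tauto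
  · have h' : ∀ i j k : Fin 3, F i j k → ((i, j, k) = (0, 1, 2) ∨ (i, j, k) = (1, 0, 2) ∨
        (i, j, k) = (0, 2, 1) ∨ (i, j, k) = (2, 0, 1) ∨ (i, j, k) = (1, 2, 0) ∨
        (i, j, k) = (2, 1, 0)) → ∃ σ : Equiv.Perm (Fin 3), F (σ 0) (σ 1) (σ 2) := by
      intro i j k hF hijk
      obtain ⟨σ, rfl, rfl, rfl⟩ := (h i j k).2 hijk
      exact ⟨σ, hF⟩
    rintro (hF | hF | hF | hF | hF | hF) <;> exact h' _ _ _ hF (by simp)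

/-- Up to the Klein four-group, the last of four points is in the second position. -/
theorem exists_perm_klein (τ : Equiv.Perm (Fin 4)) : ∃ σ : Equiv.Perm (Fin 3),
    (τ 0, τ 1, τ 2, τ 3) = ((σ 0).castSucc, 3, (σ 2).castSucc, (σ 1).castSucc) ∨
    (τ 0, τ 1, τ 2, τ 3) = (3, (σ 0).castSucc, (σ 1).castSucc, (σ 2).castSucc) ∨
    (τ 0, τ 1, τ 2, τ 3) = ((σ 2).castSucc, (σ 1).castSucc, (σ 0).castSucc, 3) ∨
    (τ 0, τ 1, τ 2, τ 3) = ((σ 1).castSucc, (σ 2).castSucc, 3, (σ 0).castSucc) := by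
  revert τ
  decide

/-- `Normalizes x y w d₄ D` says that the cross-ratio `(x, d₄; w, y)` is `D`. Cross-ratios are
invariant under the Klein four-group, so any ordering of the four points can be replaced by one with
`d₄` in second place. -/
theorem exists_normalizes_of_mem {d : Fin 3 → ℂ} {d₄ D : ℂ}
    (h : D ∈ crossRatioOrbit ![(d 0 : OnePoint ℂ), (d 1 : OnePoint ℂ), (d 2 : OnePoint ℂ),
      (d₄ : OnePoint ℂ)]) :
    ∃ σ : Equiv.Perm (Fin 3), Normalizes (d (σ 0)) (d (σ 1)) (d (σ 2)) d₄ D := by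
  obtain ⟨τ, hτ⟩ := h
  obtain ⟨σ, hσ⟩ := exists_perm_klein τ
  have hc : ∀ i : Fin 3, ![(d 0 : OnePoint ℂ), (d 1 : OnePoint ℂ), (d 2 : OnePoint ℂ),
      (d₄ : OnePoint ℂ)] i.castSucc = (d i : OnePoint ℂ) := by
    intro i
    fin_cases i <;> rfl
  have h3 : ![(d 0 : OnePoint ℂ), (d 1 : OnePoint ℂ), (d 2 : OnePoint ℂ),
      (d₄ : OnePoint ℂ)] 3 = (d₄ : OnePoint ℂ) := rfl
  have key : crossRatio (d (σ 0)) d₄ (d (σ 2)) (d (σ 1)) = D := by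
    rw [← hτ]
    simp only [Prod.mk.injEq] at hσ
    rcases hσ with ⟨h0, h1, h2, h3'⟩ | ⟨h0, h1, h2, h3'⟩ | ⟨h0, h1, h2, h3'⟩ |
      ⟨h0, h1, h2, h3'⟩ <;> beta_reduce <;> rw [h0, h1, h2, h3'] <;> simp only [hc, h3]
    · exact crossRatio_swap₁ _ _ _ _
    · exact crossRatio_swap₂ _ _ _ _
    · rw [crossRatio_swap₁, crossRatio_swap₂]
  refine ⟨σ, ?_⟩
  rw [Normalizes, ← key, crossRatio]
  simp only [bracket_coe]

/-! ### Uniqueness of the accessory parameter -/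

/-- The coincidences among the positions of the fourth point in different orderings. -/
theorem Subcase.orbit_facts (κ : Subcase) :
    2 * κ.D ≠ 1 ∧ κ.D ^ 2 ≠ 1 ∧ κ.D ≠ 0 ∧ (κ.D = 2 → κ.p = 1) ∧
      (κ.D ^ 2 - κ.D = -1 → κ.p * (2 - κ.D) = 1 ∧ κ.p * (1 + κ.D) = κ.D) := by
  -- The excluded values are those of `t² - t`: `-1/4` at `1/2`, `0` at `0` and `1`, `2` at `2` and
  -- `-1`. This avoids computing with square roots.
  have aux : ∀ D r : ℂ, D ^ 2 - D = r → 1 + 4 * r ≠ 0 → r ≠ 0 → r ≠ 2 →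
      2 * D ≠ 1 ∧ D ^ 2 ≠ 1 ∧ D ≠ 0 ∧ D ≠ 2 := by
    intro D r h h1 h2 h3
    refine ⟨fun h0 => h1 ?_, fun h0 => ?_, ?_, ?_⟩
    · rw [← h]
      linear_combination (2 * D - 1) * h0
    · have h4 : (D - 1) * (D + 1) = 0 := by linear_combination h0
      rcases mul_eq_zero.1 h4 with h5 | h5
      · exact h2 (by rw [← h]; linear_combination D * h5)
      · exact h3 (by rw [← h]; linear_combination (D - 2) * h5)
    · rintro rfl
      exact h2 (by rw [← h]; ring)
    · rintro rfl
      exact h3 (by rw [← h]; norm_num)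
  have hequi : 2 * equianharmonic.D ≠ 1 ∧ equianharmonic.D ^ 2 ≠ 1 ∧ equianharmonic.D ≠ 0 ∧
      (equianharmonic.D = 2 → equianharmonic.p = 1) ∧
      (equianharmonic.D ^ 2 - equianharmonic.D = -1 →
        equianharmonic.p * (2 - equianharmonic.D) = 1 ∧
        equianharmonic.p * (1 + equianharmonic.D) = equianharmonic.D) := by
    have hsq := p_equianharmonic_sq
    rw [D_equianharmonic_eq]
    obtain ⟨h1, h2, h3, h4⟩ := aux (3 * equianharmonic.p - 1) (-1)
      (by linear_combination 9 * hsq) (by norm_num) (by norm_num) (by norm_num)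
    exact ⟨h1, h2, h3, fun h => absurd h h4, fun _ =>
      ⟨by linear_combination -3 * hsq, by linear_combination 3 * hsq⟩⟩
  cases κ with
  | harmonic => norm_num [D, p]
  | realCubic => norm_num [D, p]
  | specialHarmonic => norm_num [D, p]
  | equianharmonic => exact hequi
  | specialEquianharmonic => exact hequi
  | quartic =>
    have hsq := p_quartic_sq
    rw [D_quartic_eq]
    have h : (5 * quartic.p - 2) ^ 2 - (5 * quartic.p - 2) = -(27 / 8) := by
      linear_combination 25 * hsq
    obtain ⟨h1, h2, h3, h4⟩ := aux _ _ h (by norm_num) (by norm_num) (by norm_num)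
    exact ⟨h1, h2, h3, fun h => absurd h h4, fun h5 => absurd (h.symm.trans h5) (by norm_num)⟩
  | quintic =>
    have hsq := p_quintic_sq
    rw [D_quintic_eq]
    have h : (11 / 5 * quintic.p - 3 / 5) ^ 2 - (11 / 5 * quintic.p - 3 / 5) = -(64 / 135) := by
      linear_combination 121 / 25 * hsq
    obtain ⟨h1, h2, h3, h4⟩ := aux _ _ h (by norm_num) (by norm_num) (by norm_num)
    exact ⟨h1, h2, h3, fun h => absurd h h4, fun h5 => absurd (h.symm.trans h5) (by norm_num)⟩

/-- A second ordering with the same `D` forces, in turn, `2D = 1`, `D² = 1`, `D² - D + 1 = 0`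
(twice) or `D (D - 2) = 0`. The first two never occur. In the others the corresponding affine
symmetry of the triple fixes the point with position `p`: its centroid in the equianharmonic case,
the middle point in the harmonic one. -/
theorem Subcase.position_eq (κ : Subcase) {x y w : ℂ} (hxy : x ≠ y) (h : w - x = κ.D * (y - x)) :
    (w - y = κ.D * (x - y) → y + κ.p * (x - y) = x + κ.p * (y - x)) ∧
    (y - x = κ.D * (w - x) → x + κ.p * (w - x) = x + κ.p * (y - x)) ∧
    (y - w = κ.D * (x - w) → w + κ.p * (x - w) = x + κ.p * (y - x)) ∧
    (x - y = κ.D * (w - y) → y + κ.p * (w - y) = x + κ.p * (y - x)) ∧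
    (x - w = κ.D * (y - w) → w + κ.p * (y - w) = x + κ.p * (y - x)) := by
  obtain ⟨h1, h2, h3, h4, h5⟩ := κ.orbit_facts
  have hyx := sub_ne_zero.2 hxy.symm
  generalize κ.D = D at *
  generalize κ.p = p at *
  obtain rfl : w = x + D * (y - x) := by linear_combination h
  refine ⟨fun e => ?_, fun e => ?_, fun e => ?_, fun e => ?_, fun e => ?_⟩
  · exact absurd (mul_right_cancel₀ hyx (by linear_combination e : 2 * D * (y - x) = 1 * (y - x)))
      h1
  · exact absurd (mul_right_cancel₀ hyx (by linear_combination -e : D ^ 2 * (y - x) = 1 * (y - x)))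
      h2
  · have hD : D ^ 2 - D = -1 := mul_right_cancel₀ hyx (by linear_combination e)
    linear_combination -(y - x) * (h5 hD).2
  · have hD : D ^ 2 - D = -1 := mul_right_cancel₀ hyx (by linear_combination -e)
    linear_combination -(y - x) * (h5 hD).1
  · have hD : D * (D - 2) = 0 := mul_right_cancel₀ hyx (by linear_combination e)
    have hD2 : D = 2 := by linear_combination (mul_eq_zero.1 hD).resolve_left h3
    rw [h4 hD2]
    ring

theorem Subcase.position_unique (κ : Subcase) {t : Fin 3 → ℂ} (ht : Function.Injective t)
    (σ σ' : Equiv.Perm (Fin 3)) (h : t (σ 2) - t (σ 0) = κ.D * (t (σ 1) - t (σ 0)))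
    (h' : t (σ' 2) - t (σ' 0) = κ.D * (t (σ' 1) - t (σ' 0))) :
    t (σ' 0) + κ.p * (t (σ' 1) - t (σ' 0)) = t (σ 0) + κ.p * (t (σ 1) - t (σ 0)) := by
  have hne : t (σ 0) ≠ t (σ 1) := fun e => by simpa using σ.injective (ht e)
  obtain ⟨h2, h3, h4, h5, h6⟩ := κ.position_eq hne h
  have key := (exists_perm_fin_three_iff fun i j k =>
    σ i = σ' 0 ∧ σ j = σ' 1 ∧ σ k = σ' 2).1 ⟨σ'.trans σ.symm, by simp⟩
  rcases key with ⟨e0, e1, e2⟩ | ⟨e0, e1, e2⟩ | ⟨e0, e1, e2⟩ | ⟨e0, e1, e2⟩ | ⟨e0, e1, e2⟩ |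
    ⟨e0, e1, e2⟩ <;> rw [← e0, ← e1, ← e2] at h' <;> rw [← e0, ← e1]
  · exact h2 h'
  · exact h3 h'
  · exact h4 h'
  · exact h5 h'
  · exact h6 h'

/-! ### The three parts of the theorem -/

section Main

variable {d : Fin 3 → ℂ} {d₄ α β q : ℂ} {g : Fin 3 → ℂ}

theorem reducedBy_iff_exists_perm {R : RatFunc ℂ} (hd : Function.Injective d)
    (hd₄ : ∀ i, d i ≠ d₄) (hFuchs : α + β - g 0 - g 1 - g 2 + 1 = 0)
    (hs : ∀ i, (generalHeun (d 0) (d 1) (d 2) d₄ α β (g 0) (g 1) (g 2) q).IsSingularAt (d i))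
    (hnontrivial : α * β ≠ 0 ∨ q ≠ 0) :
    ReducedBy (generalHeun (d 0) (d 1) (d 2) d₄ α β (g 0) (g 1) (g 2) q) R ↔
      α * β ≠ 0 ∧ ∃ κ : Subcase, ∃ σ : Equiv.Perm (Fin 3),
        Normalizes (d (σ 0)) (d (σ 1)) (d (σ 2)) d₄ κ.D ∧
        κ.ExponentCondition (g (σ 0)) (g (σ 1)) (g (σ 2)) ∧
        q = accessory (d (σ 0)) (d (σ 1)) (d (σ 2)) d₄ α β κ.p ∧
        (R = κ.poly (moebius (d (σ 0)) (d (σ 1)) d₄) ∨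
          R = 1 - κ.poly (moebius (d (σ 0)) (d (σ 1)) d₄)) := by
  have hne : ∀ i j, i ≠ j → d i ≠ d j := fun i j hij => hd.ne hij
  have h01 := hne 0 1 (by decide)
  have h02 := hne 0 2 (by decide)
  have h12 := hne 1 2 (by decide)
  rw [reducedBy_iff h01 h02 (hd₄ 0) h12 (hd₄ 1) (hd₄ 2) hFuchs (hs 0) (hs 1) (hs 2) hnontrivial]
  refine and_congr_right fun hαβ => ?_
  have hK : α * β * ((d₄ - d 0) * (d₄ - d 1) * (d₄ - d 2)) ≠ 0 :=
    mul_ne_zero hαβ (mul_ne_zero (mul_ne_zero (sub_ne_zero.2 (hd₄ 0).symm)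
      (sub_ne_zero.2 (hd₄ 1).symm)) (sub_ne_zero.2 (hd₄ 2).symm))
  have hF : ∀ v, α * β * v * ((d₄ - d 0) * (d₄ - d 1) * (d₄ - d 2)) + q = 0 →
      ((∃ P : ℂ[X], R = aeval (coord d₄ 1 v) P ∧ HasNormalForm (1 / (d 0 - d₄) + v)
        (1 / (d 1 - d₄) + v) (1 / (d 2 - d₄) + v) (g 0) (g 1) (g 2) P) ↔
      ∃ κ : Subcase, ∃ σ : Equiv.Perm (Fin 3),
        Normalizes (d (σ 0)) (d (σ 1)) (d (σ 2)) d₄ κ.D ∧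
        κ.ExponentCondition (g (σ 0)) (g (σ 1)) (g (σ 2)) ∧
        q = accessory (d (σ 0)) (d (σ 1)) (d (σ 2)) d₄ α β κ.p ∧
        (R = κ.poly (moebius (d (σ 0)) (d (σ 1)) d₄) ∨
          R = 1 - κ.poly (moebius (d (σ 0)) (d (σ 1)) d₄))) := by
    intro v hv
    rw [exists_comm]
    rw [exists_perm_fin_three_iff fun i j k => ∃ κ : Subcase, Normalizes (d i) (d j) (d k) d₄ κ.D ∧
      κ.ExponentCondition (g i) (g j) (g k) ∧ q = accessory (d i) (d j) (d k) d₄ α β κ.p ∧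
      (R = κ.poly (moebius (d i) (d j) d₄) ∨ R = 1 - κ.poly (moebius (d i) (d j) d₄))]
    have key := fun i j k hij hv =>
      exists_isNormalForm_iff (R := R) (g i) (g j) (g k) (hd₄ i) (hd₄ j) (hd₄ k) (hne i j hij)
        hαβ (q := q) (v := v) hv
    rw [← key 0 1 2 (by decide) hv, ← key 1 0 2 (by decide) (by linear_combination hv),
      ← key 0 2 1 (by decide) (by linear_combination hv),
      ← key 2 0 1 (by decide) (by linear_combination hv),
      ← key 1 2 0 (by decide) (by linear_combination hv),
      ← key 2 1 0 (by decide) (by linear_combination hv)]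
    simp only [← exists_or, ← and_or_left]
    rfl
  constructor
  · rintro ⟨v, hv, h⟩
    exact (hF v hv).1 h
  · intro h
    have hv : α * β * (-q / (α * β * ((d₄ - d 0) * (d₄ - d 1) * (d₄ - d 2)))) *
        ((d₄ - d 0) * (d₄ - d 1) * (d₄ - d 2)) + q = 0 := by
      rw [mul_right_comm, mul_div_cancel₀ _ hK]
      ring
    exact ⟨_, hv, (hF _ hv).2 h⟩

theorem crossRatioOrbit_of_perm {D : ℂ} (hd : Function.Injective d) (hd₄ : ∀ i, d i ≠ d₄)
    {σ : Equiv.Perm (Fin 3)} (h : Normalizes (d (σ 0)) (d (σ 1)) (d (σ 2)) d₄ D) :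
    crossRatioOrbit ![(d 0 : OnePoint ℂ), (d 1 : OnePoint ℂ), (d 2 : OnePoint ℂ),
        (d₄ : OnePoint ℂ)] =
      crossRatioOrbit ![((0 : ℂ) : OnePoint ℂ), ((1 : ℂ) : OnePoint ℂ), (D : OnePoint ℂ), ∞] := by
  rw [← crossRatioOrbit_of_normalizes (hd.ne (σ.injective.ne (by decide))) (hd₄ _) (hd₄ _)
    (hd₄ _) h]
  have hτ : ∀ σ : Equiv.Perm (Fin 3), ∃ τ : Equiv.Perm (Fin 4), τ 0 = (σ 0).castSucc ∧
      τ 1 = (σ 1).castSucc ∧ τ 2 = (σ 2).castSucc ∧ τ 3 = 3 := by decide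
  obtain ⟨τ, h0, h1, h2, h3⟩ := hτ σ
  rw [← crossRatioOrbit_comp _ τ]
  congr 1
  have hc : ∀ i : Fin 3, ![(d 0 : OnePoint ℂ), (d 1 : OnePoint ℂ), (d 2 : OnePoint ℂ),
      (d₄ : OnePoint ℂ)] i.castSucc = (d i : OnePoint ℂ) := by
    intro i
    fin_cases i <;> rfl
  funext i
  fin_cases i
  · exact (congrArg _ h0).trans (hc _)
  · exact (congrArg _ h1).trans (hc _)
  · exact (congrArg _ h2).trans (hc _)
  · exact congrArg _ h3

theorem existsUnique_accessory (hd : Function.Injective d) (hd₄ : ∀ i, d i ≠ d₄) (κ : Subcase)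
    (h : crossRatioOrbit ![(d 0 : OnePoint ℂ), (d 1 : OnePoint ℂ), (d 2 : OnePoint ℂ),
        (d₄ : OnePoint ℂ)] =
      crossRatioOrbit ![((0 : ℂ) : OnePoint ℂ), ((1 : ℂ) : OnePoint ℂ), (κ.D : OnePoint ℂ), ∞]) :
    ∃! v : ℂ, ∃ σ : Equiv.Perm (Fin 3), Normalizes (d (σ 0)) (d (σ 1)) (d (σ 2)) d₄ κ.D ∧
      v = accessory (d (σ 0)) (d (σ 1)) (d (σ 2)) d₄ α β κ.p := by
  obtain ⟨σ, hσ⟩ := exists_normalizes_of_mem (h ▸ mem_crossRatioOrbit κ.D)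
  refine ⟨_, ⟨σ, hσ, rfl⟩, ?_⟩
  rintro v ⟨σ', hσ', rfl⟩
  have hn : ∀ σ : Equiv.Perm (Fin 3), d (σ 0) ≠ d (σ 1) := fun σ =>
    hd.ne (σ.injective.ne (by decide))
  rw [normalizes_iff 0 (hn _) (hd₄ _) (hd₄ _) (hd₄ _)] at hσ hσ'
  have ht : Function.Injective fun i => 1 / (d i - d₄) + 0 := by
    intro i j e
    by_contra hij
    exact coord_ne (hd.ne hij) e
  have key := κ.position_unique ht σ σ' hσ hσ'
  -- The factor in `accessory_eq` that depends on `w` is symmetric, so only the position of the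
  -- point can vary with the ordering.
  have hprod : ∀ σ : Equiv.Perm (Fin 3), (d₄ - d (σ 0)) * (d₄ - d (σ 1)) * (d₄ - d (σ 2)) =
      ∏ i, (d₄ - d i) := by
    intro σ
    rw [← Equiv.prod_comp σ, Fin.prod_univ_three]
  rw [accessory_eq α β κ.p 0 (hd₄ _) (hd₄ _), accessory_eq α β κ.p 0 (hd₄ _) (hd₄ _), hprod,
    hprod]
  linear_combination α * β * (∏ i, (d₄ - d i)) * key

end Main

end HeunReduction

open HeunReduction

/-- `σ` records which of `d₁, d₂, d₃` go to `0`, `1`, `D` respectively. The first part is the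
criterion for reducibility, the second says that the accessory parameter in it depends only on
the subcase (and on `α β` and the singular points), the third lists the substitutions. -/
theorem mainTheorem6 (d₁ d₂ d₃ d₄ α β γ δ ε q : ℂ)
    (h₁₂ : d₁ ≠ d₂) (h₁₃ : d₁ ≠ d₃) (h₁₄ : d₁ ≠ d₄)
    (h₂₃ : d₂ ≠ d₃) (h₂₄ : d₂ ≠ d₄) (h₃₄ : d₃ ≠ d₄)
    (hFuchs : α + β - γ - δ - ε + 1 = 0)
    (hs₁ : (generalHeun d₁ d₂ d₃ d₄ α β γ δ ε q).IsSingularAt d₁)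
    (hs₂ : (generalHeun d₁ d₂ d₃ d₄ α β γ δ ε q).IsSingularAt d₂)
    (hs₃ : (generalHeun d₁ d₂ d₃ d₄ α β γ δ ε q).IsSingularAt d₃)
    (hs₄ : (generalHeun d₁ d₂ d₃ d₄ α β γ δ ε q).IsSingularAt d₄)
    (hnontrivial : α * β ≠ 0 ∨ q ≠ 0) :
    ((∃ R : RatFunc ℂ, ReducedBy (generalHeun d₁ d₂ d₃ d₄ α β γ δ ε q) R) ↔
      α * β ≠ 0 ∧ ∃ κ : Subcase,
        crossRatioOrbit ![(d₁ : OnePoint ℂ), (d₂ : OnePoint ℂ), (d₃ : OnePoint ℂ),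
            (d₄ : OnePoint ℂ)] =
          crossRatioOrbit ![((0 : ℂ) : OnePoint ℂ), ((1 : ℂ) : OnePoint ℂ),
            (κ.D : OnePoint ℂ), ∞] ∧
        ∃ σ : Equiv.Perm (Fin 3),
          Normalizes (![d₁, d₂, d₃] (σ 0)) (![d₁, d₂, d₃] (σ 1)) (![d₁, d₂, d₃] (σ 2)) d₄ κ.D ∧
          κ.ExponentCondition (![γ, δ, ε] (σ 0)) (![γ, δ, ε] (σ 1)) (![γ, δ, ε] (σ 2)) ∧
          q = accessory (![d₁, d₂, d₃] (σ 0)) (![d₁, d₂, d₃] (σ 1)) (![d₁, d₂, d₃] (σ 2)) d₄ α β κ.p) ∧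
    (∀ κ : Subcase,
      crossRatioOrbit ![(d₁ : OnePoint ℂ), (d₂ : OnePoint ℂ), (d₃ : OnePoint ℂ),
          (d₄ : OnePoint ℂ)] =
        crossRatioOrbit ![((0 : ℂ) : OnePoint ℂ), ((1 : ℂ) : OnePoint ℂ),
          (κ.D : OnePoint ℂ), ∞] →
      ∃! v : ℂ, ∃ σ : Equiv.Perm (Fin 3),
        Normalizes (![d₁, d₂, d₃] (σ 0)) (![d₁, d₂, d₃] (σ 1)) (![d₁, d₂, d₃] (σ 2)) d₄ κ.D ∧
        v = accessory (![d₁, d₂, d₃] (σ 0)) (![d₁, d₂, d₃] (σ 1)) (![d₁, d₂, d₃] (σ 2)) d₄ α β κ.p) ∧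
    (∀ R : RatFunc ℂ, ReducedBy (generalHeun d₁ d₂ d₃ d₄ α β γ δ ε q) R ↔
      α * β ≠ 0 ∧ ∃ κ : Subcase, ∃ σ : Equiv.Perm (Fin 3),
        Normalizes (![d₁, d₂, d₃] (σ 0)) (![d₁, d₂, d₃] (σ 1)) (![d₁, d₂, d₃] (σ 2)) d₄ κ.D ∧
        κ.ExponentCondition (![γ, δ, ε] (σ 0)) (![γ, δ, ε] (σ 1)) (![γ, δ, ε] (σ 2)) ∧
        q = accessory (![d₁, d₂, d₃] (σ 0)) (![d₁, d₂, d₃] (σ 1)) (![d₁, d₂, d₃] (σ 2)) d₄ α β κ.p ∧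
        (R = κ.poly (moebius (![d₁, d₂, d₃] (σ 0)) (![d₁, d₂, d₃] (σ 1)) d₄) ∨
          R = 1 - κ.poly (moebius (![d₁, d₂, d₃] (σ 0)) (![d₁, d₂, d₃] (σ 1)) d₄))) := by
  have hd : Function.Injective ![d₁, d₂, d₃] := by
    intro i j hij
    fin_cases i <;> fin_cases j <;> simp_all
  have hd₄ : ∀ i, ![d₁, d₂, d₃] i ≠ d₄ := by
    intro i
    fin_cases i <;> assumption
  have e0 : ![d₁, d₂, d₃] 0 = d₁ := rfl
  have e1 : ![d₁, d₂, d₃] 1 = d₂ := rfl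
  have e2 : ![d₁, d₂, d₃] 2 = d₃ := rfl
  have f0 : ![γ, δ, ε] 0 = γ := rfl
  have f1 : ![γ, δ, ε] 1 = δ := rfl
  have f2 : ![γ, δ, ε] 2 = ε := rfl
  have hC := fun R : RatFunc ℂ => reducedBy_iff_exists_perm (R := R) (α := α) (β := β) (q := q)
    (g := ![γ, δ, ε]) hd hd₄
  have hB := fun κ : Subcase => existsUnique_accessory (α := α) (β := β) hd hd₄ κ
  have hO := fun (κ : Subcase) (σ : Equiv.Perm (Fin 3)) =>
    crossRatioOrbit_of_perm (D := κ.D) (σ := σ) hd hd₄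
  simp only [e0, e1, e2, f0, f1, f2] at hC hB hO
  replace hC := fun R => hC R hFuchs
    (by intro i; fin_cases i; exacts [hs₁, hs₂, hs₃]) hnontrivial
  -- The criterion follows from the list of substitutions: the equality of orbits is implied by any
  -- normalizing ordering through `hO`, and conversely the normalized polynomial composed with the
  -- Möbius transformation serves as `R`.
  refine ⟨⟨?_, ?_⟩, hB, hC⟩
  · rintro ⟨R, hR⟩
    obtain ⟨hαβ, κ, σ, h1, h2, h3, -⟩ := (hC R).1 hR
    exact ⟨hαβ, κ, hO κ σ h1, σ, h1, h2, h3⟩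
  · rintro ⟨hαβ, κ, -, σ, h1, h2, h3⟩
    exact ⟨_, (hC _).2 ⟨hαβ, κ, σ, h1, h2, h3, Or.inl rfl⟩⟩
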